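/- Let $K$ be an algebraically closed field with $\operatorname{char}K\neq 2$, let $n\geq 1$, and let $\Lambda=P(\mathbb L_n)$ be the preprojective algebra of type $\mathbb L_n$: it is $KQ/I$, where $Q$ has vertices $1,\dots,n$, a loop $\epsilon$ at $1$ and arrows $a_i:i\to i+1$, $\bar a_i:i+1\to i$ $(1\le i<n)$, and $I$ is generated by the elements $\sum_{a:\,i(a)=i}a\bar a$ for each vertex $i$. Here $i(a)$, $t(a)$ are the origin and the end of the arrow $a$, $\bar\epsilon=\epsilon$, $\bar{\bar a}_i=a_i$, and paths are written from left to right. Put $\omega_i=(-1)^{i(i-1)/2}\,\bar a_{i-1}\cdots\bar a_1\,\epsilon^{2(n-i)+1}\,a_1\cdots a_{i-1}$. Let $P=\bigoplus_i\Lambda e_i\otimes e_i\Lambda$ and $Q'=\bigoplus_{a}\Lambda e_{i(a)}\otimes e_{t(a)}\Lambda$ (sum over all arrows $a$). The $\Lambda$-bimodule $\Lambda$ has a projective resolution with terms $P,\,Q',\,P,\,P,\,Q',\,P,\,P,\dots$ in degrees $0,1,2,3,\dots$, augmentation given by multiplication, and successive differentials $\delta,R,k,\delta_\tau,R_\tau,k_\tau,\delta,\dots$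 where $$\delta(e_{i(a)}\otimes e_{t(a)})=a\otimes e_{t(a)}-e_{i(a)}\otimes a,\quad R(e_i\otimes e_i)=\sum_{a:\,i(a)=i}(e_i\otimes\bar a+a\otimes e_i),\quad k(e_i\otimes e_i)=\sum_{x}(-1)^{\deg x}x\otimes x^*.$$ In the last sum $x$ runs over a basis of $e_i\Lambda$ consisting of paths, and for $x\in e_i\Lambda e_j$ the element $x^*\in e_j\Lambda e_i$ is the scalar multiple of a path with $xx^*=\omega_i$. The index $\tau$ means that the automorphism $\tau$ of $\Lambda$ with $\tau(e_i)=e_i$, $\tau(a)=-a$ is applied to the right-hand tensor factors of these images. Let $HH^i(\Lambda)=\operatorname{Ext}^i_{\Lambda\otimes\Lambda^{op}}(\Lambda,\Lambda)$ with the Yoneda product. Let $y\in HH^1(\Lambda)$ and $z_j\in HH^2(\Lambda)$, $t_j\in HH^3(\Lambda)$ $(1\le j\le n)$ be the classes represented, with respect to this resolution, by the bimodule morphisms $$\tilde y(e_{i(a)}\otimes e_{t(a)})=a,\qquad \tilde z_j(e_i\otimes e_i)=\delta_{ij}e_j,\qquad \tilde t_j(e_i\otimes e_i)=\delta_{ij}\omega_j,$$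 which are cocycles. Then $(z_1,\dots,z_n)$ and $(t_1,\dots,t_n)$ are bases of $HH^2(\Lambda)$ and $HH^3(\Lambda)$ (the canonical bases), and the matrix of the map $HH^2(\Lambda)\to HH^3(\Lambda)$, $u\mapsto yu$, with respect to these bases is the image in $K$ of an integer matrix $C=(C_{jk})$, so that $yz_k=\sum_jC_{jk}t_j$, with the following properties. 1. $C$ is symmetric. 2. $C_{jk}=(-1)^{k-j+1}(2j-1)(n-k+1)$ for $1\le j\le k\le n$. 3. $\det C=(-1)^n(2n+1)^{n-1}$. Over $K$, the rank of $C$ is $n$ if $\operatorname{char}K$ does not divide $2n+1$, and it is $1$ if $\operatorname{char}K$ divides $2n+1$. -/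

import Mathlib

open CategoryTheory TensorProduct MulOpposite

universe u

noncomputable section

namespace PrepL

/-! ## The preprojective algebra of type `L_n`

The vertices `1, …, n` are represented by `Fin n`, so vertex `i` of the text is `i - 1` here. -/

/-- There is an arrow `i → j` of the quiver iff `i = j` is the first vertex (the loop `ε`) or
`i`, `j` are neighbours (`a_i` and `ā_i`). There is at most one arrow for each ordered pair. -/
def HasArrow (n : ℕ) (p : Fin n × Fin n) : Prop :=
  (p.1.val = 0 ∧ p.2.val = 0) ∨ p.1.val + 1 = p.2.val ∨ p.2.val + 1 = p.1.val

instance (n : ℕ) : DecidablePred (HasArrow n) := fun _ => by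
  unfold HasArrow; infer_instance

/-- The arrows of the quiver of type `L_n`. -/
abbrev Arrow (n : ℕ) : Type := {p : Fin n × Fin n // HasArrow n p}

/-- The origin `i(a)` of an arrow. -/
def src {n : ℕ} (a : Arrow n) : Fin n := a.1.1

/-- The end `t(a)` of an arrow. -/
def tgt {n : ℕ} (a : Arrow n) : Fin n := a.1.2

/-- The opposite arrow `ā`; the loop is its own opposite. -/
def bar {n : ℕ} (a : Arrow n) : Arrow n :=
  ⟨(a.1.2, a.1.1), by
    rcases a.2 with ⟨h, h'⟩ | h | h
    · exact Or.inl ⟨h', h⟩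
    · exact Or.inr (Or.inr h)
    · exact Or.inr (Or.inl h)⟩

/-- Generators of the path algebra: the vertices (trivial paths) and the arrows. -/
inductive Gen (n : ℕ) : Type
  | vtx (i : Fin n) : Gen n
  | arr (a : Arrow n) : Gen n

/-- The relations: the first five present the path algebra `KQ` (a path is the product of its
arrows written from left to right), and the last one is the preprojective relation
`∑_{i(a) = i} a ā = 0` at each vertex `i`. -/
inductive Rel (n : ℕ) (K : Type u) [Field K] :
    FreeAlgebra K (Gen n) → FreeAlgebra K (Gen n) → Prop
  | idem (i : Fin n) : Rel n K
      (FreeAlgebra.ι K (Gen.vtx i) * FreeAlgebra.ι K (Gen.vtx i)) (FreeAlgebra.ι K (Gen.vtx i))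
  | orth (i j : Fin n) (h : i ≠ j) : Rel n K
      (FreeAlgebra.ι K (Gen.vtx i) * FreeAlgebra.ι K (Gen.vtx j)) 0
  | one : Rel n K (∑ i : Fin n, FreeAlgebra.ι K (Gen.vtx i)) 1
  | left (a : Arrow n) : Rel n K
      (FreeAlgebra.ι K (Gen.vtx (src a)) * FreeAlgebra.ι K (Gen.arr a)) (FreeAlgebra.ι K (Gen.arr a))
  | right (a : Arrow n) : Rel n K
      (FreeAlgebra.ι K (Gen.arr a) * FreeAlgebra.ι K (Gen.vtx (tgt a))) (FreeAlgebra.ι K (Gen.arr a))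
  | preproj (i : Fin n) : Rel n K
      (∑ a : Arrow n with src a = i,
        FreeAlgebra.ι K (Gen.arr a) * FreeAlgebra.ι K (Gen.arr (bar a))) 0

/-- The preprojective algebra `Λ = P(L_n)` over `K`. -/
def Lam (n : ℕ) (K : Type u) [Field K] : Type u := RingQuot (Rel n K)

variable (n : ℕ) (K : Type u) [Field K]

instance : Ring (Lam n K) := inferInstanceAs (Ring (RingQuot (Rel n K)))

instance : Algebra K (Lam n K) := inferInstanceAs (Algebra K (RingQuot (Rel n K)))

/-- The quotient map onto `Λ`. -/
def mk : FreeAlgebra K (Gen n) →ₐ[K] Lam n K := RingQuot.mkAlgHom K (Rel n K)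

theorem mk_rel {a b : FreeAlgebra K (Gen n)} (h : Rel n K a b) : mk n K a = mk n K b :=
  RingQuot.mkAlgHom_rel K h

/-- The idempotent `e_i` of `Λ`. -/
def e (i : Fin n) : Lam n K := mk n K (FreeAlgebra.ι K (Gen.vtx i))

/-- The element of `Λ` given by an arrow. -/
def arrow (a : Arrow n) : Lam n K := mk n K (FreeAlgebra.ι K (Gen.arr a))

/-! ### A basis of paths and its dual basis -/

/-- The trivial path at `i` (zero when `i` is not a vertex). -/
def trivPath (i : ℕ) : Lam n K := if h : i < n then e n K ⟨i, h⟩ else 0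

/-- The arrow `i → j` as an element of `Λ` (zero when there is no such arrow). -/
def step (i j : ℕ) : Lam n K :=
  if h : ∃ (hi : i < n) (hj : j < n), HasArrow n (⟨i, hi⟩, ⟨j, hj⟩) then
    arrow n K ⟨(⟨i, h.1⟩, ⟨j, h.2.1⟩), h.2.2⟩
  else 0

/-- The path `i → i + 1 → ⋯ → i + r`, i.e. a product of `r` consecutive arrows `a`. -/
def upPath (i : ℕ) : ℕ → Lam n K
  | 0 => trivPath n K i
  | r + 1 => upPath i r * step n K (i + r) (i + r + 1)

/-- The path `i + r → ⋯ → i + 1 → i`, i.e. a product of `r` consecutive arrows `ā`. -/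
def downPath (i : ℕ) : ℕ → Lam n K
  | 0 => trivPath n K i
  | r + 1 => step n K (i + r + 1) (i + r) * downPath i r

/-- The path from `i` up to `m` and then down to `j`; it has length `2 m - i - j`. -/
def cPath (i j m : ℕ) : Lam n K := upPath n K i (m - i) * downPath n K j (m - j)

/-- The path that goes down from `i` to the first vertex, then runs
`2 (n - 1 - m) + 1` times through the loop `ε`, and then goes up to `j`. -/
def dPath (i j m : ℕ) : Lam n K :=
  downPath n K 0 i * step n K 0 0 ^ (2 * (n - 1 - m) + 1) * upPath n K 0 j

/-- Index set of a basis of `e_i Λ e_j`: the paths `cPath i j m` (flag `true`) and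
`dPath i j m` (flag `false`) for `max i j ≤ m < n`. -/
abbrev BasisIdx (i j : Fin n) : Type := {m : Fin n // max i j ≤ m} × Bool

variable {n}

/-- The basis path belonging to an index. -/
def elt {i j : Fin n} (b : BasisIdx n i j) : Lam n K :=
  if b.2 then cPath n K i j b.1 else dPath n K i j b.1

/-- The length of the basis path belonging to an index. -/
def deg {i j : Fin n} (b : BasisIdx n i j) : ℕ :=
  if b.2 then 2 * b.1.1.val - i.val - j.val else i.val + j.val + (2 * (n - 1 - b.1.1.val) + 1)

/-- The index of the basis path of `e_j Λ e_i` of complementary length. -/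
def compl {i j : Fin n} (b : BasisIdx n i j) : BasisIdx n j i :=
  (⟨b.1.1, by rw [max_comm]; exact b.1.2⟩, !b.2)

/-- The socle element `ω_i`; in the numbering from `1`, it is
`(-1)^{i(i-1)/2} ā_{i-1} ⋯ ā_1 ε^{2(n-i)+1} a_1 ⋯ a_{i-1}`. -/
def omega (i : Fin n) : Lam n K :=
  (-1 : K) ^ (i.val * (i.val + 1) / 2) • dPath n K i i i

/-- The dual basis element `x^*` of the basis path `x : i → j`: the multiple of the path
`j → i` of complementary length with `x x^* = ω_i` (see `elt_mul_star`). -/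
def star {i j : Fin n} (b : BasisIdx n i j) : Lam n K :=
  (-1 : K) ^ (b.1.1.val * (b.1.1.val + 1) / 2) • elt K (compl b)

/-! ### The relation `x x^* = ω_i` -/

variable (n)

theorem preproj_rel (i : Fin n) :
    ∑ a : Arrow n with src a = i, arrow n K a * arrow n K (bar a) = 0 := by
  have h := mk_rel n K (Rel.preproj (n := n) (K := K) i)
  simpa [arrow] using h

theorem step_coe (i j : Fin n) :
    step n K i j = if h : HasArrow n (i, j) then arrow n K ⟨(i, j), h⟩ else 0 := by
  unfold step
  by_cases h : HasArrow n (i, j)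
  · rw [dif_pos h, dif_pos ⟨i.2, j.2, h⟩]
  · rw [dif_neg h, dif_neg (fun ⟨_, _, h'⟩ => h h')]

theorem sum_step (i : Fin n) : ∑ j : Fin n, step n K i j * step n K j i = 0 := by
  rw [← preproj_rel n K i]
  symm
  refine Finset.sum_of_injOn (fun a => tgt a) ?_ (fun _ _ => Finset.mem_coe.2 (Finset.mem_univ _)) ?_ ?_
  · rintro ⟨⟨a, a'⟩, ha⟩ h ⟨⟨b, b'⟩, hb⟩ h' hab
    obtain rfl : a = i := (Finset.mem_filter.1 (Finset.mem_coe.1 h)).2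
    obtain rfl : b = a := (Finset.mem_filter.1 (Finset.mem_coe.1 h')).2
    obtain rfl : a' = b' := hab
    rfl
  · intro j _ hj
    rw [step_coe, dif_neg, zero_mul]
    intro h
    exact hj ⟨⟨(i, j), h⟩, Finset.mem_coe.2 (Finset.mem_filter.2 ⟨Finset.mem_univ _, rfl⟩), rfl⟩
  · rintro ⟨⟨a, a'⟩, ha⟩ h
    obtain rfl : a = i := (Finset.mem_filter.1 h).2
    rw [step_coe, step_coe, dif_pos (show HasArrow n (a, tgt ⟨(a, a'), ha⟩) from ha),
      dif_pos (show HasArrow n (tgt ⟨(a, a'), ha⟩, a) from (bar ⟨(a, a'), ha⟩).2)]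
    rfl

theorem step_zero_of {i j : ℕ} (h : ¬ ((i = 0 ∧ j = 0) ∨ i + 1 = j ∨ j + 1 = i)) :
    step n K i j = 0 :=
  dif_neg fun ⟨_, _, h'⟩ => h h'

theorem step_zero_of_le {i j : ℕ} (h : n ≤ j) : step n K i j = 0 :=
  dif_neg fun ⟨_, h', _⟩ => absurd h' (by omega)

theorem sum_step_range (i : ℕ) (hi : i < n) :
    ∑ j ∈ Finset.range (n + 1 + i), step n K i j * step n K j i = 0 := by
  rw [← sum_step n K ⟨i, hi⟩, Fin.sum_univ_eq_sum_range
    (fun j => step n K i j * step n K j i) n]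
  symm
  refine Finset.sum_subset (Finset.range_mono (by omega)) fun j _ hj => ?_
  rw [step_zero_of_le n K (by simpa using hj), zero_mul]

theorem rel_zero (h : 0 < n) :
    step n K 0 1 * step n K 1 0 = -(step n K 0 0 * step n K 0 0) := by
  have := sum_step_range n K 0 h
  rw [← Finset.sum_subset (s₁ := {0, 1})
    (by intro j; simp; omega)
    (by
      intro j _ hj
      simp only [Finset.mem_insert, Finset.mem_singleton, not_or] at hj
      rw [step_zero_of n K (by omega), zero_mul])] at this
  rw [Finset.sum_pair (by omega)] at this
  exact eq_neg_of_add_eq_zero_right this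

theorem rel_succ (v : ℕ) (h : v + 1 < n) :
    step n K (v + 1) (v + 2) * step n K (v + 2) (v + 1) =
      -(step n K (v + 1) v * step n K v (v + 1)) := by
  have := sum_step_range n K (v + 1) h
  rw [← Finset.sum_subset (s₁ := {v, v + 2})
    (by intro j; simp; omega)
    (by
      intro j _ hj
      simp only [Finset.mem_insert, Finset.mem_singleton, not_or] at hj
      rw [step_zero_of n K (by omega), zero_mul])] at this
  rw [Finset.sum_pair (by omega)] at this
  exact eq_neg_of_add_eq_zero_right this

theorem step_mul_trivPath (i j : ℕ) : step n K i j * trivPath n K j = step n K i j := by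
  by_cases h : ∃ (hi : i < n) (hj : j < n), HasArrow n (⟨i, hi⟩, ⟨j, hj⟩)
  · rw [step, dif_pos h, trivPath, dif_pos h.2.1]
    have := mk_rel n K (Rel.right (n := n) (K := K) ⟨(⟨i, h.1⟩, ⟨j, h.2.1⟩), h.2.2⟩)
    simpa [arrow, e, tgt] using this
  · rw [step, dif_neg h, zero_mul]

theorem trivPath_mul_step (i j : ℕ) : trivPath n K i * step n K i j = step n K i j := by
  by_cases h : ∃ (hi : i < n) (hj : j < n), HasArrow n (⟨i, hi⟩, ⟨j, hj⟩)
  · rw [step, dif_pos h, trivPath, dif_pos h.1]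
    have := mk_rel n K (Rel.left (n := n) (K := K) ⟨(⟨i, h.1⟩, ⟨j, h.2.1⟩), h.2.2⟩)
    simpa [arrow, e, src] using this
  · rw [step, dif_neg h, mul_zero]

theorem trivPath_mul_self (i : ℕ) : trivPath n K i * trivPath n K i = trivPath n K i := by
  by_cases h : i < n
  · rw [trivPath, dif_pos h]
    have := mk_rel n K (Rel.idem (n := n) (K := K) ⟨i, h⟩)
    simpa [e] using this
  · rw [trivPath, dif_neg h, zero_mul]

theorem upPath_mul_trivPath (i r : ℕ) :
    upPath n K i r * trivPath n K (i + r) = upPath n K i r := by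
  cases r with
  | zero => exact trivPath_mul_self n K i
  | succ r => rw [upPath, mul_assoc, ← add_assoc, step_mul_trivPath]

theorem trivPath_mul_downPath (i r : ℕ) :
    trivPath n K (i + r) * downPath n K i r = downPath n K i r := by
  cases r with
  | zero => exact trivPath_mul_self n K i
  | succ r => rw [downPath, ← mul_assoc, ← add_assoc, trivPath_mul_step]

theorem upPath_mul_upPath (i r : ℕ) :
    upPath n K 0 i * upPath n K i r = upPath n K 0 (i + r) := by
  induction r with
  | zero => simpa [upPath] using upPath_mul_trivPath n K 0 i
  | succ r ih => rw [upPath, ← mul_assoc, ih, ← add_assoc, upPath, zero_add]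

theorem downPath_mul_downPath (i r : ℕ) :
    downPath n K i r * downPath n K 0 i = downPath n K 0 (i + r) := by
  induction r with
  | zero => simpa [downPath] using trivPath_mul_downPath n K 0 i
  | succ r ih => rw [downPath, mul_assoc, ih, ← add_assoc, downPath, zero_add]

theorem cycle_mul_downPath (v : ℕ) (h : v < n) :
    step n K v (v + 1) * step n K (v + 1) v * downPath n K 0 v =
      (-1 : K) ^ (v + 1) • (downPath n K 0 v * step n K 0 0 ^ 2) := by
  induction v with
  | zero =>
    rw [rel_zero n K h]
    simp only [downPath, pow_two, zero_add, pow_one, neg_smul, one_smul, ← mul_assoc,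
      trivPath_mul_step, neg_mul]
    rw [mul_assoc, step_mul_trivPath]
  | succ v ih =>
    have h' := ih (by omega)
    rw [rel_succ n K v h, downPath, zero_add]
    rw [show -(step n K (v + 1) v * step n K v (v + 1)) * (step n K (v + 1) v * downPath n K 0 v) =
      -(step n K (v + 1) v * (step n K v (v + 1) * step n K (v + 1) v * downPath n K 0 v)) by
        noncomm_ring, h', pow_succ (-1 : K) (v + 1)]
    simp [mul_assoc]

theorem upPath_mul_cycle (v : ℕ) (h : v < n) :
    upPath n K 0 v * (step n K v (v + 1) * step n K (v + 1) v) =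
      (-1 : K) ^ (v + 1) • (step n K 0 0 ^ 2 * upPath n K 0 v) := by
  induction v with
  | zero =>
    rw [rel_zero n K h]
    simp only [upPath, pow_two, zero_add, pow_one, neg_smul, one_smul, mul_neg]
    rw [← mul_assoc, trivPath_mul_step, mul_assoc, step_mul_trivPath]
  | succ v ih =>
    have h' := ih (by omega)
    rw [rel_succ n K v h, upPath, zero_add]
    rw [show upPath n K 0 v * step n K v (v + 1) * -(step n K (v + 1) v * step n K v (v + 1)) =
      -(upPath n K 0 v * (step n K v (v + 1) * step n K (v + 1) v) * step n K v (v + 1)) by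
        noncomm_ring, h', pow_succ (-1 : K) (v + 1)]
    simp [mul_assoc]

theorem sign_succ (m : ℕ) : (-1 : K) ^ ((m + 1) * (m + 1 + 1) / 2) =
    (-1) ^ (m * (m + 1) / 2) * (-1) ^ (m + 1) := by
  rw [← pow_add]
  congr 1
  rw [show (m + 1) * (m + 1 + 1) = m * (m + 1) + (m + 1) * 2 by ring,
    Nat.add_mul_div_right _ _ (by norm_num)]

theorem sign_mul_self (m : ℕ) : (-1 : K) ^ m * (-1) ^ m = 1 := by
  rw [← mul_pow]; simp

theorem upPath_mul_downPath_zero (i r : ℕ) (h : i + r < n):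
    (-1 : K) ^ ((i + r) * (i + r + 1) / 2) • (upPath n K i r * downPath n K 0 (i + r)) =
      (-1 : K) ^ (i * (i + 1) / 2) • (downPath n K 0 i * step n K 0 0 ^ (2 * r)) := by
  induction r with
  | zero => 
    have := trivPath_mul_downPath n K 0 i
    simp only [zero_add] at this
    simp [upPath, this]
  | succ r ih =>
    have h' := ih (by omega)
    rw [← add_assoc, upPath, downPath, zero_add]
    rw [show upPath n K i r * step n K (i + r) (i + r + 1) *
      (step n K (i + r + 1) (i + r) * downPath n K 0 (i + r)) = upPath n K i r *
      (step n K (i + r) (i + r + 1) * step n K (i + r + 1) (i + r) * downPath n K 0 (i + r)) by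
        noncomm_ring, cycle_mul_downPath n K (i + r) (by omega), sign_succ, mul_smul_comm, smul_smul,
      mul_assoc, sign_mul_self, mul_one, ← mul_assoc, ← smul_mul_assoc, h', smul_mul_assoc,
      mul_assoc, ← pow_add]
    rfl

theorem upPath_zero_mul_downPath (i r : ℕ) (h : i + r < n) :
    (-1 : K) ^ ((i + r) * (i + r + 1) / 2) • (upPath n K 0 (i + r) * downPath n K i r) =
      (-1 : K) ^ (i * (i + 1) / 2) • (step n K 0 0 ^ (2 * r) * upPath n K 0 i) := by
  induction r with
  | zero => 
    have := upPath_mul_trivPath n K 0 i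
    simp only [zero_add] at this
    simp [downPath, this]
  | succ r ih =>
    have h' := ih (by omega)
    rw [← add_assoc, upPath, downPath, zero_add]
    rw [show upPath n K 0 (i + r) * step n K (i + r) (i + r + 1) *
      (step n K (i + r + 1) (i + r) * downPath n K i r) = upPath n K 0 (i + r) *
      (step n K (i + r) (i + r + 1) * step n K (i + r + 1) (i + r)) * downPath n K i r by
        noncomm_ring, upPath_mul_cycle n K (i + r) (by omega), sign_succ, smul_mul_assoc, smul_smul,
      mul_assoc, sign_mul_self, mul_one, mul_assoc, ← mul_smul_comm, h', mul_smul_comm,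
      ← mul_assoc, ← pow_add, show 2 + 2 * r = 2 * (r + 1) by ring]

variable {n}

/-- The relation that, together with its length, characterizes the dual basis element. -/
theorem elt_mul_star {i j : Fin n} (b : BasisIdx n i j) : elt K b * star K b = omega K i := by
  obtain ⟨⟨m, hm⟩, t⟩ := b
  have hi : i.val ≤ m.val := (le_max_left i j).trans hm
  have hj : j.val ≤ m.val := (le_max_right i j).trans hm
  have hmn := m.2
  have ei : i.val + (m.val - i.val) = m.val := by omega
  have ej : j.val + (m.val - j.val) = m.val := by omega
  have ex : 2 * (m.val - i.val) + (2 * (n - 1 - m.val) + 1) = 2 * (n - 1 - i.val) + 1 := by omega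
  cases t
  · have h1 := upPath_mul_upPath n K j (m - j)
    have h2 := upPath_zero_mul_downPath n K i (m - i) (by omega)
    rw [ej] at h1
    rw [ei] at h2
    simp only [elt, star, compl, omega, cPath, dPath, Bool.not_false, if_true,
      Bool.false_eq_true, if_false]
    rw [mul_smul_comm, show ∀ a b c d f : Lam n K, a * b * c * (d * f) = a * b * (c * d * f) by
      intros; noncomm_ring, h1, ← mul_smul_comm, h2, mul_smul_comm, ← ex,
      add_comm (2 * (m.val - i.val)), pow_add _ (2 * (n - 1 - m.val) + 1)]
    simp only [mul_assoc]
  · have h1 := downPath_mul_downPath n K j (m - j)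
    have h2 := upPath_mul_downPath_zero n K i (m - i) (by omega)
    rw [ej] at h1
    rw [ei] at h2
    simp only [elt, star, compl, omega, cPath, dPath, Bool.not_true, if_true,
      Bool.false_eq_true, if_false]
    rw [mul_smul_comm, show ∀ a b c d f : Lam n K, a * b * (c * d * f) = a * (b * c) * d * f by
      intros; noncomm_ring, h1, ← smul_mul_assoc, ← smul_mul_assoc, h2, ← ex,
      pow_add _ (2 * (m.val - i.val))]
    simp only [mul_assoc, smul_mul_assoc]

variable (n)

/-! ## Bimodules -/

/-- The enveloping algebra `Λ^e = Λ ⊗ Λ^op`; bimodules are left modules over it. -/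
abbrev Env : Type u := Lam n K ⊗[K] (Lam n K)ᵐᵒᵖ

/-- `Λ` as a bimodule: `(a ⊗ b°) x = a x b`. -/
instance : Module (Env n K) (Lam n K) := instModuleTensorProductMop K (Lam n K)

/-- The bimodule `Λ` as an object of the category of bimodules. -/
abbrev bimod : ModuleCat.{u} (Env n K) := ModuleCat.of (Env n K) (Lam n K)

/-- The bimodule `Λ e_i ⊗ e_j Λ`, as the left ideal of `Λ^e` generated by the idempotent
`e_i ⊗ e_j°`: the element `a ⊗ b` of `Λ e_i ⊗ e_j Λ` is `a ⊗ b°`. -/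
abbrev indec (i j : Fin n) : Submodule (Env n K) (Env n K) :=
  Submodule.span (Env n K) {e n K i ⊗ₜ[K] op (e n K j)}

variable {n}

/-- The projective bimodule `⨁_{x ∈ ι} Λ e_{s x} ⊗ e_{t x} Λ`. -/
abbrev ProjBimod {ι : Type} (s t : ι → Fin n) : Type u := ∀ x : ι, indec n K (s x) (t x)

/-- The generator `e_{s x} ⊗ e_{t x}` of the summand indexed by `x`. -/
def gen {ι : Type} [DecidableEq ι] (s t : ι → Fin n) (x : ι) : ProjBimod K s t :=
  Pi.single x ⟨_, Submodule.mem_span_singleton_self _⟩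

/-- The bimodule morphism given on generators by `e_{s x} ⊗ e_{t x} ↦ v x`,
for `v x ∈ e_{s x} M e_{t x}`. -/
def lift {ι : Type} [Fintype ι] (s t : ι → Fin n) {M : Type u} [AddCommGroup M]
    [Module (Env n K) M] (v : ι → M) : ProjBimod K s t →ₗ[Env n K] M :=
  ∑ x : ι, LinearMap.toSpanSingleton (Env n K) M (v x) ∘ₗ
    (indec n K (s x) (t x)).subtype ∘ₗ LinearMap.proj x

variable (n)

/-- `P = ⨁_i Λ e_i ⊗ e_i Λ`. -/
abbrev P : Type u := ProjBimod (n := n) K id id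

/-- `Q = ⨁_a Λ e_{i(a)} ⊗ e_{t(a)} Λ`. -/
abbrev Q : Type u := ProjBimod (n := n) K src tgt

variable {n}

/-- The generator `e_i ⊗ e_i` of `P`. -/
abbrev genP (i : Fin n) : P n K := gen K id id i

/-- The generator `e_{i(a)} ⊗ e_{t(a)}` of the summand of `Q` belonging to `a`. -/
abbrev genQ (a : Arrow n) : Q n K := gen K src tgt a

variable (n)

/-! ## The minimal projective resolution

Let `τ` be the automorphism of `Λ` that fixes the vertices and sends each arrow `a` to `-a`.
The differentials below depend on a sign `s`. For `s = 1` they are `δ`, `R`, `k`, and for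
`s = -1` they are `δ_τ`, `R_τ`, `k_τ`, where `f_τ` is obtained from `f` by
applying `τ` to the right-hand tensor factors of the images of the generators; so a path of length
`d` in such a factor is multiplied by `s ^ d`. -/

/-- `δ (e_{i(a)} ⊗ e_{t(a)}) = a ⊗ e_{t(a)} - e_{i(a)} ⊗ a`. -/
def dDelta (s : K) : Q n K →ₗ[Env n K] P n K :=
  lift K src tgt fun a =>
    (arrow n K a ⊗ₜ[K] (1 : (Lam n K)ᵐᵒᵖ)) • genP K (tgt a)
      - (s • ((1 : Lam n K) ⊗ₜ[K] op (arrow n K a)) : Env n K) • genP K (src a)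

/-- `R (e_i ⊗ e_i) = ∑_{i(a) = i} (e_i ⊗ ā + a ⊗ e_i)`, where `e_i ⊗ ā` lies in the summand of
`a` and `a ⊗ e_i` in the summand of `ā`. -/
def dR (s : K) : P n K →ₗ[Env n K] Q n K :=
  lift K id id fun i => ∑ a : Arrow n with src a = i,
    ((s • ((1 : Lam n K) ⊗ₜ[K] op (arrow n K (bar a))) : Env n K) • genQ K a
      + (arrow n K a ⊗ₜ[K] (1 : (Lam n K)ᵐᵒᵖ)) • genQ K (bar a))

/-- `k (e_i ⊗ e_i) = ∑_{x ∈ e_i B} (-1)^{deg x} x ⊗ x^*`; the term of a basis path `x : i → j`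
lies in the summand `Λ e_j ⊗ e_j Λ`. The term does not change if `x` is replaced by `-x`. -/
def dk (s : K) : P n K →ₗ[Env n K] P n K :=
  lift K id id fun i => ∑ j : Fin n, ∑ b : BasisIdx n i j,
    (((-1) ^ deg b * s ^ deg (compl b)) • (elt K b ⊗ₜ[K] op (star K b)) : Env n K) • genP K j

/-- The terms `P, Q, P, P, Q, P, …` of the resolution. -/
def resObj : ℕ → ModuleCat.{u} (Env n K)
  | 0 => ModuleCat.of (Env n K) (P n K)
  | 1 => ModuleCat.of (Env n K) (Q n K)
  | 2 => ModuleCat.of (Env n K) (P n K)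
  | i + 3 => resObj i

/-- The differentials, starting with the sign `s`; every three steps the sign changes. -/
def resDSign (s : K) : (i : ℕ) → (resObj n K (i + 1) ⟶ resObj n K i)
  | 0 => ModuleCat.ofHom (dDelta n K s)
  | 1 => ModuleCat.ofHom (dR n K s)
  | 2 => ModuleCat.ofHom (dk n K s)
  | i + 3 => resDSign (-s) i

/-- The differentials `δ, R, k, δ_τ, R_τ, k_τ, δ, …` of the resolution; `resD i` goes from the
term of degree `i + 1` to the term of degree `i`. -/
def resD (i : ℕ) : resObj n K (i + 1) ⟶ resObj n K i := resDSign n K 1 i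

/-- The augmentation `u : P ⟶ Λ`, given by multiplication: `e_i ⊗ e_i ↦ e_i`. -/
def resAug : resObj n K 0 ⟶ bimod n K :=
  ModuleCat.ofHom (lift K id id fun i => e n K i)

/-! ## Hochschild cohomology -/

/-- `HH^i(Λ) = Ext^i_{Λ^e}(Λ, Λ)`. -/
abbrev HH (i : ℕ) : Type u := Abelian.Ext (bimod n K) (bimod n K) i

variable {n K}

/-- An isomorphism over `Λ` of (the complex of) a projective resolution of `Λ` with the explicit
sequence `⋯ ⟶ resObj 1 ⟶ resObj 0 ⟶ Λ`. -/
structure Presentation (R : ProjectiveResolution (bimod n K)) where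
  iso : ∀ i, R.complex.X i ≅ resObj n K i
  comm : ∀ i, (iso (i + 1)).hom ≫ resD n K i = R.complex.d (i + 1) i ≫ (iso i).hom
  aug : (iso 0).hom ≫ resAug n K =
    R.π.f 0 ≫ (HomologicalComplex.singleObjXSelf (ComplexShape.down ℕ) 0 (bimod n K)).hom

/-- The class in `HH^i(Λ)` that is represented by a cocycle `resObj i ⟶ Λ`. -/
def Presentation.cls {R : ProjectiveResolution (bimod n K)} (p : Presentation R) {i : ℕ}
    (f : resObj n K i ⟶ bimod n K) (hf : resD n K i ≫ f = 0) : HH n K i :=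
  R.extMk ((p.iso i).hom ≫ f) (i + 1) rfl (by
    rw [← Category.assoc, ← p.comm, Category.assoc, hf, Limits.comp_zero])

variable (n K)

/-- The morphism `ỹ : Q ⟶ Λ`, `e_{i(a)} ⊗ e_{t(a)} ↦ a`. -/
def yRep : resObj n K 1 ⟶ bimod n K :=
  ModuleCat.ofHom (lift K src tgt fun a => arrow n K a)

variable {n}

/-- The morphism `z̃_k : P ⟶ Λ`, `e_i ⊗ e_i ↦ δ_{ik} e_k`. -/
def zRep (k : Fin n) : resObj n K 2 ⟶ bimod n K :=
  ModuleCat.ofHom (lift K id id fun i => if i = k then e n K k else 0)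

/-- The morphism `t̃_k : P ⟶ Λ`, `e_i ⊗ e_i ↦ δ_{ik} ω_k`. -/
def tRep (k : Fin n) : resObj n K 3 ⟶ bimod n K :=
  ModuleCat.ofHom (lift K id id fun i => if i = k then omega K k else 0)

variable {K}

/-- Multiplication by `y ∈ HH^1(Λ)`, from `HH^2(Λ)` to `HH^3(Λ)`: `u ↦ y u` for the Yoneda
product (first `u`, then `y`). -/
def mulBy (y : HH n K 1) : HH n K 2 →ₗ[K] HH n K 3 :=
  Abelian.Ext.postcompOfLinear y K (bimod n K) (show 2 + 1 = 3 from rfl)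

end PrepL

end

/-! The quiver of type `L_n` is folded from the line with positions `0, …, 2n - 1`, and after a
change of signs the preprojective relations say that squares in the unfolded picture commute
(`S_mul_S_comm`). A path is then determined by its starting position `q`, its number `u` of steps up
and its number `d` of steps down; the resulting elements `W q u d` multiply by adding these numbers,
are invariant under the reflection, and vanish as soon as `q + u ≥ 2n` or `d > q`. The remaining
ones, a rectangle of pairs `(u, d)` for each vertex, form a basis (`pathBasis`); their independence
comes from an action of the algebra on functions on the rectangle. The element `ω_i` is the far
corner of the rectangle, and the dual of the path at `(u, d)` is the path to that corner, the signs
of `x` and `x^*` cancelling in `x ⊗ x^*` (`bm_elt_star`). Thus `k` is an alternating sum over a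
rectangle (`diffK_gP`).

In this picture the composites of consecutive differentials vanish by commutativity of squares, by
telescoping, and by shifting a rectangle. For exactness one finds, for each pair of consecutive
maps, a subgroup which together with the image of the first map is everything and on which the
second map is injective (`exists_eq_of_sup_eq_top`). The injectivity is read off from coordinates of
the left-hand factor with respect to the path basis.

For the cohomology, cochains on `P` are families `v_i ∈ e_i Λ e_i`. The coboundaries coming from `R`
are exactly the families without trivial paths (`vtxChar_map_diffR`, `mem_cobR`), the map induced by
`k` is zero (`map_diffK_gP`), and the cocycles for `δ_τ` are exactly the families of multiples of
the `ω_i` (`mem_span_omega_of_cocycle`). Both descriptions divide by two at the loop. This gives the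
two bases.

For the product, `z_k` is lifted by sending `e_k ⊗ e_k` to itself and the other generators to zero.
The next component of the lift must have boundary `∑ (-1)^{deg x} x ⊗ x^*` over the basis paths `x`
from `i` to `k`. These paths come in pairs of opposite parity, so `∑ (-1)^{deg x} = 0` and one may
subtract `e_i ⊗ x x^* = e_i ⊗ ω_i` from each term. The difference `x ⊗ x^* - e_i ⊗ x x^*` is the
boundary of a sum with one term for each arrow of `x`, and `ỹ` maps each of these terms to `x x^* =
ω_i` (`exists_diffD_eq`). Hence the coefficient of `t_i` in `y z_k` is `∑ (-1)^{deg x} deg x`, an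
arithmetic progression (`sum_deg`). The Yoneda product of classes is identified with this composite
of cochains in `extMk_comp_extMk`.

The determinant follows from row operations. When `2n + 1 = 0` in `K`, the factor `n - max` is
proportional to `2 max + 1`, so the matrix becomes an outer product. -/

noncomputable section

namespace PrepL

/-! ## Unfolding the quiver

The quiver of type `L_n` is the quotient of the line with vertices `0, …, 2n - 1` by the
reflection `q ↦ 2n - 1 - q`. The vertex `i` lies below the positions `n + i` and `n - 1 - i`. -/

/-- The vertex below the position `q` (at least `n` if `q` is not in `0, …, 2n - 1`). -/
def fold (n : ℕ) (q : ℤ) : ℕ := if (n : ℤ) ≤ q then (q - n).toNat else (n - 1 - q).toNat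

theorem fold_reflect (n : ℕ) (q : ℤ) : fold n (2 * n - 1 - q) = fold n q := by
  unfold fold; split_ifs <;> omega

theorem fold_lt_iff {n : ℕ} {q : ℤ} : fold n q < n ↔ 0 ≤ q ∧ q < 2 * n := by
  unfold fold; split_ifs <;> omega

theorem fold_add (n i : ℕ) : fold n (n + i) = i := by
  unfold fold; split_ifs <;> omega

section Grid

variable (n : ℕ) (K : Type u) [Field K]

/-- The sign which turns the preprojective relations into commutativity relations. -/
def sgn (i j : ℕ) : K := if j < i then (-1) ^ i else 1

theorem sgn_mul_self (i j : ℕ) : sgn K i j * sgn K i j = 1 := by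
  unfold sgn; split_ifs
  · exact sign_mul_self K i
  · simp

/-- The signed arrow between (the vertices below) two neighbouring positions. -/
def S (q q' : ℤ) : Lam n K := sgn K (fold n q) (fold n q') • step n K (fold n q) (fold n q')

/-- The trivial path at a position. -/
def E (q : ℤ) : Lam n K := trivPath n K (fold n q)

theorem S_reflect (q q' : ℤ) : S n K (2 * n - 1 - q) (2 * n - 1 - q') = S n K q q' := by
  simp only [S, fold_reflect]

theorem E_reflect (q : ℤ) : E n K (2 * n - 1 - q) = E n K q := by
  simp only [E, fold_reflect]

theorem step_of_le {i j : ℕ} (h : n ≤ i) : step n K i j = 0 :=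
  dif_neg fun ⟨h', _, _⟩ => absurd h' (by omega)

theorem S_eq_zero_left {q q' : ℤ} (h : ¬ (0 ≤ q ∧ q < 2 * n)) : S n K q q' = 0 := by
  rw [S, step_of_le _ _ (by rw [← fold_lt_iff] at h; omega), smul_zero]

theorem S_eq_zero_right {q q' : ℤ} (h : ¬ (0 ≤ q' ∧ q' < 2 * n)) : S n K q q' = 0 := by
  rw [S, step_zero_of_le _ _ (by rw [← fold_lt_iff] at h; omega), smul_zero]

theorem E_eq_zero {q : ℤ} (h : ¬ (0 ≤ q ∧ q < 2 * n)) : E n K q = 0 :=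
  dif_neg (by rwa [fold_lt_iff])

theorem S_mul_E (q q' : ℤ) : S n K q q' * E n K q' = S n K q q' := by
  rw [S, E, smul_mul_assoc, step_mul_trivPath]

theorem E_mul_S (q q' : ℤ) : E n K q * S n K q q' = S n K q q' := by
  rw [S, E, mul_smul_comm, trivPath_mul_step]

theorem E_mul_E (q : ℤ) : E n K q * E n K q = E n K q := trivPath_mul_self n K _

/-- Going up and back carries the sign `(-1) ^ (i + 1)`, going down and back carries `(-1) ^ i`; at
the first vertex two loops carry no sign. These signs absorb the minus sign in the preprojective
relation. Beyond the strip both sides vanish. -/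
theorem S_mul_S_comm_aux (i : ℕ) :
    S n K (n + i) (n + i + 1) * S n K (n + i + 1) (n + i) =
      S n K (n + i) (n + i - 1) * S n K (n + i - 1) (n + i) := by
  by_cases hi : i < n
  swap
  · rw [S_eq_zero_left n K (q := n + i) (q' := n + i + 1) (by omega),
      S_eq_zero_right n K (q := n + i - 1) (q' := n + i) (by omega), zero_mul, mul_zero]
  have e1 : fold n (n + i) = i := fold_add n i
  have e2 : fold n (n + i + 1) = i + 1 := by have := fold_add n (i + 1); push_cast at this; rwa [add_assoc]
  cases i with
  | zero =>
    have e3 : fold n (n + (0 : ℕ) - 1) = 0 := by unfold fold; split_ifs <;> omega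
    simp only [S, e1, e2, e3, zero_add, smul_mul_smul_comm]
    rw [rel_zero n K hi]
    simp [sgn]
  | succ v =>
    have e3 : fold n (n + (v + 1 : ℕ) - 1) = v := by unfold fold; split_ifs <;> omega
    simp only [S, e1, e2, e3, smul_mul_smul_comm]
    rw [rel_succ n K v hi]
    simp [sgn, pow_succ]

theorem S_mul_S_comm (q : ℤ) :
    S n K q (q + 1) * S n K (q + 1) q = S n K q (q - 1) * S n K (q - 1) q := by
  by_cases h : (n : ℤ) ≤ q
  · obtain ⟨i, rfl⟩ : ∃ i : ℕ, q = n + i := ⟨(q - n).toNat, by omega⟩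
    exact S_mul_S_comm_aux n K i
  · obtain ⟨i, rfl⟩ : ∃ i : ℕ, q = 2 * n - 1 - (n + i) := ⟨(n - 1 - q).toNat, by omega⟩
    have := S_mul_S_comm_aux n K i
    rw [← S_reflect n K, ← S_reflect n K (n + i + 1), ← S_reflect n K _ (n + i - 1),
      ← S_reflect n K (n + i - 1)] at this
    convert this.symm using 3 <;> ring

/-- The signed path that starts at the position `q`, goes `u` steps up and then `d` steps down. -/
def W (q : ℤ) (u : ℕ) : ℕ → Lam n K
  | 0 => u.rec (E n K q) fun v x => x * S n K (q + v) (q + v + 1)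
  | d + 1 => W q u d * S n K (q + u - d) (q + u - d - 1)

theorem W_zero_zero (q : ℤ) : W n K q 0 0 = E n K q := rfl

theorem W_succ_zero (q : ℤ) (u : ℕ) :
    W n K q (u + 1) 0 = W n K q u 0 * S n K (q + u) (q + u + 1) := rfl

theorem W_mul_down (q : ℤ) (u d : ℕ) :
    W n K q u d * S n K (q + u - d) (q + u - d - 1) = W n K q u (d + 1) := rfl

/-- Commutativity of squares carries the step up past the `d` steps down, one at a time. -/
theorem W_mul_up (q : ℤ) (u d : ℕ) :
    W n K q u d * S n K (q + u - d) (q + u - d + 1) = W n K q (u + 1) d := by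
  induction d with
  | zero => simpa using (W_succ_zero n K q u).symm
  | succ d ih =>
    have h := S_mul_S_comm n K (q + u - d)
    rw [← W_mul_down, mul_assoc]
    rw [show q + u - (d + 1 : ℕ) = q + u - d - 1 by push_cast; ring, sub_add_cancel, ← h,
      ← mul_assoc, ih, ← W_mul_down]
    congr 2 <;> push_cast <;> ring

theorem E_mul_W (q : ℤ) (u d : ℕ) : E n K q * W n K q u d = W n K q u d := by
  induction d with
  | zero =>
    induction u with
    | zero => exact E_mul_E n K q
    | succ u ih => rw [W_succ_zero, ← mul_assoc, ih]
  | succ d ih => rw [← W_mul_down, ← mul_assoc, ih]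

theorem W_mul_E (q : ℤ) (u d : ℕ) : W n K q u d * E n K (q + u - d) = W n K q u d := by
  cases d with
  | zero =>
    cases u with
    | zero => simpa [W_zero_zero] using E_mul_E n K q
    | succ u =>
      rw [W_succ_zero, mul_assoc]
      congr 1
      convert S_mul_E n K (q + u) (q + u + 1) using 3
      push_cast; ring
  | succ d =>
    rw [← W_mul_down, mul_assoc]
    congr 1
    convert S_mul_E n K (q + u - d) (q + u - d - 1) using 3
    push_cast; ring

theorem W_mul_W' {q q' : ℤ} {u d : ℕ} (h : q + u - d = q') (u' d' : ℕ) :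
    W n K q u d * W n K q' u' d' = W n K q (u + u') (d + d') := by
  subst h
  induction d' with
  | zero =>
    induction u' with
    | zero => exact W_mul_E n K q u d
    | succ v ih =>
      rw [W_succ_zero, ← mul_assoc, ih, ← add_assoc, add_zero, ← W_mul_up]
      congr 2 <;> push_cast <;> ring_nf
  | succ d' ih =>
    rw [← W_mul_down, ← mul_assoc, ih, ← add_assoc, ← W_mul_down]
    congr 2 <;> push_cast <;> ring

/-- The reflection turns steps up into steps down, and by `W_mul_up` the order of the steps is
immaterial. The loop needs no separate treatment afterwards: it is a step between `n` and `n - 1`.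
-/
theorem W_reflect (q : ℤ) (u d : ℕ) : W n K (2 * n - 1 - q) d u = W n K q u d := by
  induction d with
  | zero =>
    induction u with
    | zero => exact E_reflect n K q
    | succ u ih =>
      rw [← W_mul_down, ih, W_succ_zero, ← S_reflect n K (q + u)]
      congr 2 <;> push_cast <;> ring
  | succ d ih =>
    rw [← W_mul_up, ih, ← W_mul_down, ← S_reflect n K (q + u - d)]
    congr 2 <;> ring

/-- The steps up come first, and they leave the strip. -/
theorem W_eq_zero_up {q : ℤ} {u : ℕ} (d : ℕ) (h : 2 * n ≤ q + u) : W n K q u d = 0 := by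
  induction d with
  | zero =>
    cases u with
    | zero => exact E_eq_zero n K (by omega)
    | succ u => rw [W_succ_zero, S_eq_zero_right n K (by push_cast at h; omega), mul_zero]
  | succ d ih => rw [← W_mul_down, ih, zero_mul]

theorem W_eq_zero_down {q : ℤ} (u : ℕ) {d : ℕ} (h : q < d) : W n K q u d = 0 := by
  rw [← W_reflect]
  exact W_eq_zero_up n K u (by omega)

theorem S_up (q : ℤ) : S n K q (q + 1) = W n K q 1 0 := by
  have := W_mul_up n K q 0 0
  simp only [Nat.cast_zero, add_zero, sub_zero, zero_add] at this
  rw [← this, W_zero_zero, E_mul_S]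

theorem S_down (q : ℤ) : S n K q (q - 1) = W n K q 0 1 := by
  have := W_mul_down n K q 0 0
  simp only [Nat.cast_zero, add_zero, sub_zero, zero_add] at this
  rw [← this, W_zero_zero, E_mul_S]

theorem e_eq_E (i : Fin n) : e n K i = E n K (n + i.val) := by
  rw [E, fold_add, trivPath, dif_pos i.2]

theorem e_mul_e_of_ne {i j : Fin n} (h : i ≠ j) : e n K i * e n K j = 0 := by
  have := mk_rel n K (Rel.orth (n := n) (K := K) i j h)
  simpa [e] using this

theorem sum_e : ∑ i : Fin n, e n K i = 1 := by
  have := mk_rel n K (Rel.one (n := n) (K := K))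
  simpa [e] using this

theorem e_mul_e (i : Fin n) : e n K i * e n K i = e n K i := by
  rw [e_eq_E, E_mul_E]

theorem E_eq_e {q : ℤ} (h : fold n q < n) : E n K q = e n K ⟨fold n q, h⟩ := dif_pos h

theorem e_src_mul_arrow (a : Arrow n) : e n K (src a) * arrow n K a = arrow n K a := by
  have := mk_rel n K (Rel.left (n := n) (K := K) a)
  simpa [arrow, e] using this

theorem arrow_mul_e_tgt (a : Arrow n) : arrow n K a * e n K (tgt a) = arrow n K a := by
  have := mk_rel n K (Rel.right (n := n) (K := K) a)
  simpa [arrow, e] using this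

end Grid

/-! ### Arrows between positions -/

section Arrows

variable {n : ℕ}

theorem hasArrow_fold {q q' : ℤ} (h : fold n q < n) (h' : fold n q' < n)
    (hq : q' = q + 1 ∨ q' = q - 1) : HasArrow n (⟨fold n q, h⟩, ⟨fold n q', h'⟩) := by
  unfold HasArrow
  simp only
  unfold fold at *
  split_ifs at * <;> omega

/-- Covering property: an arrow lifts to a step from any position above its origin. -/
theorem arrow_lift (a : Arrow n) {q : ℤ} (h : fold n q = (src a).val) :
    fold n (q + 1) = (tgt a).val ∨ fold n (q - 1) = (tgt a).val := by
  obtain ⟨⟨i, j⟩, ha⟩ := a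
  have hi := i.2
  have hj := j.2
  simp only [src, tgt] at h ⊢
  simp only [HasArrow] at ha
  unfold fold at *
  split_ifs at * <;> omega

/-- Positions with the same vertex are equal or add up to the odd number `2n - 1`, whereas these add
up to `2q`. So lifts of arrows are unique. -/
theorem fold_succ_ne {q : ℤ} : fold n (q + 1) ≠ fold n (q - 1) := by
  unfold fold
  split_ifs <;> omega

/-- A function on arrows, evaluated at the arrow between two positions. -/
def atPos {M : Type*} [Zero M] (f : Arrow n → M) (q q' : ℤ) : M :=
  if h : ∃ (hi : fold n q < n) (hj : fold n q' < n),
    HasArrow n (⟨fold n q, hi⟩, ⟨fold n q', hj⟩) then f ⟨_, h.2.2⟩ else 0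

theorem atPos_of {M : Type*} [Zero M] (f : Arrow n → M) {q q' : ℤ} {a : Arrow n}
    (h : fold n q = (src a).val) (h' : fold n q' = (tgt a).val) : atPos f q q' = f a := by
  obtain ⟨⟨i, j⟩, ha⟩ := a
  simp only [src, tgt] at h h'
  have hi : (⟨fold n q, h ▸ i.2⟩ : Fin n) = i := Fin.ext h
  have hj : (⟨fold n q', h' ▸ j.2⟩ : Fin n) = j := Fin.ext h'
  rw [atPos, dif_pos ⟨h ▸ i.2, h' ▸ j.2, by rw [hi, hj]; exact ha⟩]
  congr

/-- By unique lifting, the arrows out of a vertex are the two steps out of a position above it; a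
step out of the strip contributes zero. -/
theorem sum_arrows_eq {M : Type*} [AddCommMonoid M] (f : Arrow n → M) {q : ℤ} {i : Fin n}
    (hq : fold n q = i) :
    ∑ a : Arrow n with src a = i, f a = atPos f q (q + 1) + atPos f q (q - 1) := by
  have key : ∀ q', (q' = q + 1 ∨ q' = q - 1) →
      (∑ a : Arrow n with src a = i, if fold n q' = (tgt a).val then f a else 0) =
        atPos f q q' := by
    intro q' hq'
    by_cases h' : fold n q' < n
    · have hi : fold n q < n := hq ▸ i.2
      rw [Finset.sum_eq_single ⟨_, hasArrow_fold hi h' hq'⟩]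
      · rw [if_pos (by rfl), atPos_of f (a := ⟨_, hasArrow_fold hi h' hq'⟩) rfl rfl]
      · rintro ⟨⟨a, b⟩, hab⟩ h1 h2
        refine if_neg fun h3 => h2 ?_
        obtain rfl : a = i := (Finset.mem_filter.1 h1).2
        refine Subtype.ext (Prod.ext (Fin.ext hq.symm) (Fin.ext h3.symm))
      · intro h1
        exact (h1 (Finset.mem_filter.2 ⟨Finset.mem_univ _, Fin.ext hq⟩)).elim
    · rw [atPos, dif_neg fun h => h' h.2.1]
      refine Finset.sum_eq_zero fun a _ => if_neg fun h => h' (by rw [h]; exact (tgt a).2)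
  rw [← key _ (Or.inl rfl), ← key _ (Or.inr rfl), ← Finset.sum_add_distrib]
  refine Finset.sum_congr rfl fun a ha => ?_
  have h := arrow_lift a (q := q) (by rw [hq, (Finset.mem_filter.1 ha).2])
  have hne := fold_succ_ne (n := n) (q := q)
  rcases h with h | h
  · rw [if_pos h, if_neg (by rw [← h]; exact hne.symm), add_zero]
  · rw [if_pos h, if_neg (by rw [← h]; exact hne), zero_add]

variable (K : Type u) [Field K]

theorem S_eq_smul_arrow {q q' : ℤ} {a : Arrow n} (h : fold n q = (src a).val)
    (h' : fold n q' = (tgt a).val) :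
    S n K q q' = sgn K (src a) (tgt a) • arrow n K a := by
  rw [S, h, h', step_coe, dif_pos (show HasArrow n (src a, tgt a) from a.2)]
  rfl

theorem arrow_eq_smul_S {q q' : ℤ} {a : Arrow n} (h : fold n q = (src a).val)
    (h' : fold n q' = (tgt a).val) :
    arrow n K a = sgn K (src a) (tgt a) • S n K q q' := by
  rw [S_eq_smul_arrow K h h', smul_smul, sgn_mul_self, one_smul]

end Arrows

/-! ## A basis of `Λ` -/

section Rep

variable (n : ℕ) (K : Type u) [Field K]

/-- The sign of a step between two positions. -/
def sgnPos (q q' : ℤ) : K := sgn K (fold n q) (fold n q')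

/-- The product of the signs of the step up from a position and of its opposite. -/
def chi (q : ℤ) : K := sgnPos n K q (q + 1) * sgnPos n K (q + 1) q

theorem chi_mul_self (q : ℤ) : chi n K q * chi n K q = 1 := by
  rw [chi, mul_mul_mul_comm, sgnPos, sgnPos, sgn_mul_self, sgn_mul_self, one_mul]

/-- At `n + i` the value is `-(-1) ^ i`, at `n - 1` it is `1`, and the reflection gives the
positions below. The alternation encodes the sign in the preprojective relation. -/
theorem chi_add_one (q : ℤ) : chi n K (q + 1) = - chi n K q := by
  have key : ∀ i : ℕ, chi n K (n + i) = - (-1) ^ i := by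
    intro i
    have e2 : fold n (n + i + 1) = i + 1 := by
      have := fold_add n (i + 1); push_cast at this; rwa [add_assoc]
    rw [chi, sgnPos, sgnPos, fold_add, e2]
    simp [sgn, pow_succ]
  have refl : ∀ q, chi n K (2 * n - 1 - q) = chi n K (q - 1) := by
    intro q
    simp only [chi, sgnPos]
    rw [show (2 * n - 1 - q + 1 : ℤ) = 2 * n - 1 - (q - 1) by ring, fold_reflect, fold_reflect,
      sub_add_cancel, mul_comm]
  have key' : chi n K (n - 1) = 1 := by
    have e1 : fold n (n - 1) = 0 := by unfold fold; split_ifs <;> omega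
    have e2 : fold n n = 0 := by unfold fold; split_ifs <;> omega
    rw [chi, sgnPos, sgnPos, sub_add_cancel, e1, e2]
    simp [sgn]
  by_cases h : (n : ℤ) ≤ q
  · obtain ⟨i, rfl⟩ : ∃ i : ℕ, q = n + i := ⟨(q - n).toNat, by omega⟩
    have := key (i + 1)
    push_cast at this
    rw [add_assoc, this, key, pow_succ]
    ring
  · by_cases h1 : q = n - 1
    · subst h1
      have := key 0
      simp only [Nat.cast_zero, add_zero, pow_zero] at this
      rw [sub_add_cancel, this, key']
    · obtain ⟨i, rfl⟩ : ∃ i : ℕ, q = 2 * n - 1 - (n + i + 1) :=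
        ⟨(n - 2 - q).toNat, by omega⟩
      rw [show (2 * n - 1 - (n + i + 1) + 1 : ℤ) = 2 * n - 1 - (n + i) by ring, refl, refl,
        add_sub_cancel_right]
      cases i with
      | zero =>
        rw [key 0, Nat.cast_zero, add_zero, key']
        simp
      | succ i =>
        rw [show (n + (i + 1 : ℕ) - 1 : ℤ) = n + i by push_cast; ring, key, key, pow_succ]
        ring

/-- The steps up and down for which the path starting at `q` is not zero. -/
abbrev Rect (q : ℤ) : Type := {x : ℕ × ℕ // (0 ≤ q ∧ q + x.1 < 2 * n) ∧ (x.2 : ℤ) ≤ q}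

variable {n K}

/-- Extension of a function by zero. -/
def ext0 {q : ℤ} (F : Rect n q → K) (u d : ℕ) : K :=
  if h : (0 ≤ q ∧ q + (u, d).1 < 2 * n) ∧ ((u, d).2 : ℤ) ≤ q then F ⟨(u, d), h⟩ else 0

theorem ext0_coe {q : ℤ} (F : Rect n q → K) (x : Rect n q) : ext0 F x.1.1 x.1.2 = F x :=
  dif_pos x.2

theorem ext0_of_not {q : ℤ} (F : Rect n q → K) {u d : ℕ}
    (h : ¬ ((0 ≤ q ∧ q + u < 2 * n) ∧ (d : ℤ) ≤ q)) : ext0 F u d = 0 := dif_neg h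

theorem ext0_add {q : ℤ} (F G : Rect n q → K) (u d : ℕ) :
    ext0 (F + G) u d = ext0 F u d + ext0 G u d := by
  unfold ext0; split_ifs <;> simp

theorem ext0_smul {q : ℤ} (c : K) (F : Rect n q → K) (u d : ℕ) :
    ext0 (c • F) u d = c * ext0 F u d := by
  unfold ext0; split_ifs <;> simp

/-- The end of the path belonging to an element of `Rect n q`. -/
def Rect.pos {q : ℤ} (x : Rect n q) : ℤ := q + x.1.1 - x.1.2

variable (K)

/-- The operator of a vertex on functions on paths starting at `q`. -/
def repE (q : ℤ) (i : Fin n) : Module.End K (Rect n q → K) where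
  toFun F x := if fold n x.pos = i then F x else 0
  map_add' F G := by ext x; simp only [Pi.add_apply]; split_ifs <;> simp
  map_smul' c F := by ext x; simp

/-- The operator of an arrow on functions on paths starting at `q`. -/
def repA (q : ℤ) (a : Arrow n) : Module.End K (Rect n q → K) where
  toFun F x := if fold n x.pos = src a then sgn K (src a) (tgt a) *
    ((if fold n (x.pos + 1) = tgt a then ext0 F (x.1.1 + 1) x.1.2 else 0) +
      (if fold n (x.pos - 1) = tgt a then ext0 F x.1.1 (x.1.2 + 1) else 0)) else 0
  map_add' F G := by
    ext x; simp only [Pi.add_apply, ext0_add]; split_ifs <;> ring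
  map_smul' c F := by
    ext x
    simp only [ext0_smul, RingHom.id_apply, Pi.smul_apply, smul_eq_mul]
    split_ifs <;> ring

theorem repA_up {q : ℤ} {a : Arrow n} (F : Rect n q → K) (x : Rect n q)
    (h : fold n x.pos = src a) (h' : fold n (x.pos + 1) = tgt a) :
    repA K q a F x = sgn K (src a) (tgt a) * ext0 F (x.1.1 + 1) x.1.2 := by
  have hne := fold_succ_ne (n := n) (q := x.pos)
  simp only [repA, LinearMap.coe_mk, AddHom.coe_mk]
  rw [if_pos h, if_pos h', if_neg (by rw [← h']; exact hne.symm), add_zero]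

theorem repA_down {q : ℤ} {a : Arrow n} (F : Rect n q → K) (x : Rect n q)
    (h : fold n x.pos = src a) (h' : fold n (x.pos - 1) = tgt a) :
    repA K q a F x = sgn K (src a) (tgt a) * ext0 F x.1.1 (x.1.2 + 1) := by
  have hne := fold_succ_ne (n := n) (q := x.pos)
  simp only [repA, LinearMap.coe_mk, AddHom.coe_mk]
  rw [if_pos h, if_pos h', if_neg (by rw [← h']; exact hne), zero_add]

theorem repA_of_ne {q : ℤ} {a : Arrow n} (F : Rect n q → K) (x : Rect n q)
    (h : fold n x.pos ≠ src a) : repA K q a F x = 0 := by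
  simp only [repA, LinearMap.coe_mk, AddHom.coe_mk]
  rw [if_neg h]

theorem Rect.fold_pos_lt {q : ℤ} (x : Rect n q) : fold n x.pos < n := by
  obtain ⟨⟨u, d⟩, h⟩ := x
  rw [fold_lt_iff]
  simp only [Rect.pos] at *
  omega

theorem repA_repA_up {q : ℤ} (F : Rect n q → K) (x : Rect n q) :
    atPos (fun a => repA K q a (repA K q (bar a) F) x) x.pos (x.pos + 1) =
      chi n K x.pos * ext0 F (x.1.1 + 1) (x.1.2 + 1) := by
  by_cases h : fold n (x.pos + 1) < n
  · have hA := hasArrow_fold x.fold_pos_lt h (Or.inl rfl)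
    set a : Arrow n := ⟨_, hA⟩ with ha
    rw [atPos_of _ (a := a) rfl rfl, repA_up K _ _ rfl rfl, chi, mul_assoc]
    congr 1
    by_cases h2 : (0 ≤ q ∧ q + (x.1.1 + 1 : ℕ) < 2 * n) ∧ (x.1.2 : ℤ) ≤ q
    · have hp : Rect.pos (⟨(x.1.1 + 1, x.1.2), h2⟩ : Rect n q) = x.pos + 1 := by
        simp only [Rect.pos]; push_cast; ring
      have := repA_down K (a := bar a) F ⟨(x.1.1 + 1, x.1.2), h2⟩ (by rw [hp]; rfl)
        (by rw [hp, add_sub_cancel_right]; rfl)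
      rw [ext0, dif_pos h2, this]
      rfl
    · rw [ext0_of_not _ h2, ext0_of_not, mul_zero]
      push_cast at *
      omega
  · rw [atPos, dif_neg fun h' => h h'.2.1, ext0_of_not, mul_zero]
    have := x.2
    rw [fold_lt_iff] at h
    simp only [Rect.pos] at h
    push_cast
    omega

theorem repA_repA_down {q : ℤ} (F : Rect n q → K) (x : Rect n q) :
    atPos (fun a => repA K q a (repA K q (bar a) F) x) x.pos (x.pos - 1) =
      - chi n K x.pos * ext0 F (x.1.1 + 1) (x.1.2 + 1) := by
  by_cases h : fold n (x.pos - 1) < n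
  · have hA := hasArrow_fold x.fold_pos_lt h (Or.inr rfl)
    set a : Arrow n := ⟨_, hA⟩ with ha
    have hc := chi_add_one n K (x.pos - 1)
    rw [sub_add_cancel] at hc
    rw [atPos_of _ (a := a) rfl rfl, repA_down K _ _ rfl rfl, hc, neg_neg, chi, sub_add_cancel,
      mul_comm (sgnPos _ _ _ _), mul_assoc]
    congr 1
    by_cases h2 : (0 ≤ q ∧ q + (x.1.1 : ℕ) < 2 * n) ∧ ((x.1.2 + 1 : ℕ) : ℤ) ≤ q
    · have hp : Rect.pos (⟨(x.1.1, x.1.2 + 1), h2⟩ : Rect n q) = x.pos - 1 := by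
        simp only [Rect.pos]; push_cast; ring
      have := repA_up K (a := bar a) F ⟨(x.1.1, x.1.2 + 1), h2⟩ (by rw [hp]; rfl)
        (by rw [hp, sub_add_cancel]; rfl)
      rw [ext0, dif_pos h2, this]
      rfl
    · rw [ext0_of_not _ h2, ext0_of_not, mul_zero]
      push_cast at *
      omega
  · rw [atPos, dif_neg fun h' => h h'.2.1, ext0_of_not, mul_zero]
    have := x.2
    rw [fold_lt_iff] at h
    simp only [Rect.pos] at h
    push_cast
    omega

/-- The operators of the generators on functions on paths starting at `q`. -/
def repGen (q : ℤ) : Gen n → Module.End K (Rect n q → K)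
  | .vtx i => repE K q i
  | .arr a => repA K q a

/-- The preprojective relation is the one with content: both round trips read the value of `F` at
`(u + 1, d + 1)`, with coefficients `chi` and `-chi`. -/
theorem repGen_rel (q : ℤ) {x y : FreeAlgebra K (Gen n)} (h : Rel n K x y) :
    FreeAlgebra.lift K (repGen K q) x = FreeAlgebra.lift K (repGen K q) y := by
  induction h with
  | idem i =>
    ext F x
    simp only [map_mul, FreeAlgebra.lift_ι_apply, repGen, Module.End.mul_apply]
    simp only [repE, LinearMap.coe_mk, AddHom.coe_mk]
    split_ifs <;> rfl
  | orth i j hij =>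
    ext F x
    simp only [map_mul, FreeAlgebra.lift_ι_apply, repGen, Module.End.mul_apply, map_zero]
    simp only [repE, LinearMap.coe_mk, AddHom.coe_mk, LinearMap.zero_apply, Pi.zero_apply]
    split_ifs with h1 h2
    · exact absurd (Fin.ext (h1.symm.trans h2)) hij
    all_goals rfl
  | one =>
    ext F x
    simp only [map_sum, FreeAlgebra.lift_ι_apply, repGen, map_one, LinearMap.sum_apply,
      Finset.sum_apply, Module.End.one_apply]
    rw [Finset.sum_eq_single ⟨_, x.fold_pos_lt⟩]
    · simp [repE]
    · intro i _ hi
      simp only [repE, LinearMap.coe_mk, AddHom.coe_mk]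
      exact if_neg fun h => hi (Fin.ext h.symm)
    · simp
  | left a =>
    ext F x
    simp only [map_mul, FreeAlgebra.lift_ι_apply, repGen, Module.End.mul_apply]
    simp only [repE, LinearMap.coe_mk, AddHom.coe_mk]
    split_ifs with h
    · rfl
    · rw [repA_of_ne K F x h]
  | right a =>
    ext F x
    simp only [map_mul, FreeAlgebra.lift_ι_apply, repGen, Module.End.mul_apply]
    by_cases h : fold n x.pos = src a
    swap
    · rw [repA_of_ne K _ x h, repA_of_ne K _ x h]
    rcases arrow_lift a h with h' | h'
    · rw [repA_up K _ x h h', repA_up K _ x h h']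
      unfold ext0
      split_ifs with h2
      · congr 1
        refine if_pos ?_
        rw [← h']
        congr 1
        simp only [Rect.pos]; push_cast; ring
      · rfl
    · rw [repA_down K _ x h h', repA_down K _ x h h']
      unfold ext0
      split_ifs with h2
      · congr 1
        refine if_pos ?_
        rw [← h']
        congr 1
        simp only [Rect.pos]; push_cast; ring
      · rfl
  | preproj i =>
    ext F x
    simp only [map_sum, map_mul, FreeAlgebra.lift_ι_apply, repGen, map_zero, LinearMap.sum_apply,
      Finset.sum_apply, Module.End.mul_apply, LinearMap.zero_apply, Pi.zero_apply]
    by_cases h : fold n x.pos = i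
    · rw [sum_arrows_eq _ h, repA_repA_up, repA_repA_down]
      ring
    · refine Finset.sum_eq_zero fun a ha => repA_of_ne K _ x ?_
      rw [(Finset.mem_filter.1 ha).2]
      exact h

/-- The operation of `Λ` on functions on paths starting at `q`, by `(λ F)(x) = F (x λ)`. -/
def rep (q : ℤ) : Lam n K →ₐ[K] Module.End K (Rect n q → K) :=
  RingQuot.liftAlgHom K ⟨FreeAlgebra.lift K (repGen K q), fun _ _ h => repGen_rel K q h⟩

theorem rep_mk (q : ℤ) (x : FreeAlgebra K (Gen n)) :
    rep K q (mk n K x) = FreeAlgebra.lift K (repGen K q) x :=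
  RingQuot.liftAlgHom_mkAlgHom_apply _ _ _ _

theorem rep_e (q : ℤ) (i : Fin n) : rep K q (e n K i) = repE K q i := by
  rw [e, rep_mk, FreeAlgebra.lift_ι_apply]
  rfl

theorem rep_arrow (q : ℤ) (a : Arrow n) : rep K q (arrow n K a) = repA K q a := by
  rw [arrow, rep_mk, FreeAlgebra.lift_ι_apply]
  rfl

theorem rep_E {q : ℤ} (F : Rect n q → K) (x : Rect n q) : rep K q (E n K x.pos) F x = F x := by
  rw [E_eq_e n K x.fold_pos_lt, rep_e]
  simp [repE]

theorem rep_E_of_ne {q q' : ℤ} (F : Rect n q → K) (x : Rect n q) (h : fold n x.pos ≠ fold n q') :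
    rep K q (E n K q') F x = 0 := by
  by_cases h' : fold n q' < n
  · rw [E_eq_e n K h', rep_e]
    exact if_neg h
  · rw [E_eq_zero n K (by rwa [← fold_lt_iff])]
    simp

theorem rep_up {q : ℤ} (F : Rect n q → K) (x : Rect n q) :
    rep K q (S n K x.pos (x.pos + 1)) F x = ext0 F (x.1.1 + 1) x.1.2 := by
  by_cases h : fold n (x.pos + 1) < n
  · have hA := hasArrow_fold x.fold_pos_lt h (Or.inl rfl)
    set a : Arrow n := ⟨_, hA⟩ with ha
    rw [S_eq_smul_arrow K (a := a) rfl rfl, map_smul, rep_arrow, LinearMap.smul_apply,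
      Pi.smul_apply, repA_up K _ _ rfl rfl, smul_eq_mul, ← mul_assoc, sgn_mul_self, one_mul]
  · rw [S_eq_zero_right n K (by rwa [← fold_lt_iff]), map_zero, ext0_of_not]
    · rfl
    have := x.2
    rw [fold_lt_iff] at h
    simp only [Rect.pos] at h
    push_cast
    omega

theorem rep_down {q : ℤ} (F : Rect n q → K) (x : Rect n q) :
    rep K q (S n K x.pos (x.pos - 1)) F x = ext0 F x.1.1 (x.1.2 + 1) := by
  by_cases h : fold n (x.pos - 1) < n
  · have hA := hasArrow_fold x.fold_pos_lt h (Or.inr rfl)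
    set a : Arrow n := ⟨_, hA⟩ with ha
    rw [S_eq_smul_arrow K (a := a) rfl rfl, map_smul, rep_arrow, LinearMap.smul_apply,
      Pi.smul_apply, repA_down K _ _ rfl rfl, smul_eq_mul, ← mul_assoc, sgn_mul_self, one_mul]
  · rw [S_eq_zero_right n K (by rwa [← fold_lt_iff]), map_zero, ext0_of_not]
    · rfl
    have := x.2
    rw [fold_lt_iff] at h
    simp only [Rect.pos] at h
    push_cast
    omega

theorem ext0_rep_up {q : ℤ} (F : Rect n q → K) (u d : ℕ) :
    ext0 (rep K q (S n K (q + u - d) (q + u - d + 1)) F) u d = ext0 F (u + 1) d := by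
  by_cases h : (0 ≤ q ∧ q + (u, d).1 < 2 * n) ∧ ((u, d).2 : ℤ) ≤ q
  · rw [ext0, dif_pos h]
    exact rep_up K F ⟨(u, d), h⟩
  · rw [ext0_of_not _ h, ext0_of_not]
    simp only at h
    push_cast
    omega

theorem ext0_rep_down {q : ℤ} (F : Rect n q → K) (u d : ℕ) :
    ext0 (rep K q (S n K (q + u - d) (q + u - d - 1)) F) u d = ext0 F u (d + 1) := by
  by_cases h : (0 ≤ q ∧ q + (u, d).1 < 2 * n) ∧ ((u, d).2 : ℤ) ≤ q
  · rw [ext0, dif_pos h]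
    exact rep_down K F ⟨(u, d), h⟩
  · rw [ext0_of_not _ h, ext0_of_not]
    simp only at h
    push_cast
    omega

/-- Since `(λ F)(x) = F (x λ)`, evaluating at the trivial path reads off the value at the path
itself. This separates the paths and gives their independence. -/
theorem ext0_rep_W {q : ℤ} (F : Rect n q → K) (u d : ℕ) :
    ext0 (rep K q (W n K q u d) F) 0 0 = ext0 F u d := by
  induction d generalizing F with
  | zero =>
    induction u generalizing F with
    | zero =>
      rw [W_zero_zero]
      by_cases h : (0 ≤ q ∧ q + ((0, 0) : ℕ × ℕ).1 < 2 * n) ∧ (((0, 0) : ℕ × ℕ).2 : ℤ) ≤ q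
      · rw [ext0, dif_pos h]
        have hp : Rect.pos (⟨(0, 0), h⟩ : Rect n q) = q := by simp [Rect.pos]
        have := rep_E K F ⟨(0, 0), h⟩
        rw [hp] at this
        rw [this]
        exact (ext0_coe F ⟨(0, 0), h⟩).symm
      · rw [ext0_of_not _ h, ext0_of_not _ h]
    | succ u ih =>
      rw [W_succ_zero, map_mul, Module.End.mul_apply, ih, ← ext0_rep_up]
      simp
  | succ d ih => rw [← W_mul_down, map_mul, Module.End.mul_apply, ih, ext0_rep_down]

/-- The coefficient of a path in an element of `Λ`. -/
def coef (q : ℤ) (u d : ℕ) : Lam n K →ₗ[K] K where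
  toFun x := ext0 (rep K q x fun y => if y.1 = (u, d) then 1 else 0) 0 0
  map_add' x y := by rw [map_add, LinearMap.add_apply, ext0_add]
  map_smul' c x := by rw [map_smul, LinearMap.smul_apply, ext0_smul]; rfl

theorem coef_W {q : ℤ} {u d : ℕ} (h : (0 ≤ q ∧ q + u < 2 * n) ∧ (d : ℤ) ≤ q) (u' d' : ℕ) :
    coef K q u d (W n K q u' d') = if (u', d') = (u, d) then 1 else 0 := by
  simp only [coef, LinearMap.coe_mk, AddHom.coe_mk]
  rw [ext0_rep_W]
  split_ifs with h'
  · obtain ⟨rfl, rfl⟩ := Prod.mk.inj h'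
    rw [ext0, dif_pos h]
    simp
  · unfold ext0
    split_ifs with h2
    · simp only
      rw [if_neg h']
    · rfl

theorem coef_W_of_ne {q q' : ℤ} (h : fold n q ≠ fold n q') (u d u' d' : ℕ) :
    coef K q u d (W n K q' u' d') = 0 := by
  simp only [coef, LinearMap.coe_mk, AddHom.coe_mk]
  rw [← E_mul_W, map_mul, Module.End.mul_apply]
  unfold ext0
  split_ifs with h2
  · refine rep_E_of_ne K _ _ ?_
    simpa [Rect.pos] using h
  · rfl

end Rep

/-- The index set of a basis of `Λ`: the starting vertex, and the numbers of steps up and down. -/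
abbrev PathIdx (n : ℕ) : Type := Σ i : Fin n, Fin (n - i) × Fin (n + i + 1)

namespace PathIdx

variable {n : ℕ}

/-- The starting position of a path. -/
def start (x : PathIdx n) : ℤ := n + x.1.val

/-- The number of steps up. -/
def up (x : PathIdx n) : ℕ := x.2.1

/-- The number of steps down. -/
def down (x : PathIdx n) : ℕ := x.2.2

/-- The final position of a path. -/
def pos (x : PathIdx n) : ℤ := x.start + x.up - x.down

theorem up_lt (x : PathIdx n) : x.start + x.up < 2 * n := by
  have := x.2.1.2
  simp only [start, up]
  omega

theorem down_le (x : PathIdx n) : (x.down : ℤ) ≤ x.start := by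
  have := x.2.2.2
  simp only [start, down]
  omega

theorem le_start (x : PathIdx n) : (n : ℤ) ≤ x.start := by
  simp only [start]
  omega

theorem fold_start (x : PathIdx n) : fold n x.start = x.1 := fold_add n _

theorem pos_bounds (x : PathIdx n) : 0 ≤ x.pos ∧ x.pos < 2 * n := by
  have := x.up_lt
  have := x.down_le
  simp only [pos]
  omega

theorem fold_pos_lt (x : PathIdx n) : fold n x.pos < n := fold_lt_iff.2 x.pos_bounds

/-- The final vertex of a path. -/
def tgt (x : PathIdx n) : Fin n := ⟨fold n x.pos, x.fold_pos_lt⟩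

theorem ext' {x y : PathIdx n} (h : x.start = y.start) (hu : x.up = y.up) (hd : x.down = y.down) :
    x = y := by
  obtain ⟨i, u, d⟩ := x
  obtain ⟨j, u', d'⟩ := y
  obtain rfl : i = j := by
    simp only [start] at h
    exact Fin.ext (by omega)
  obtain rfl : u = u' := Fin.ext hu
  obtain rfl : d = d' := Fin.ext hd
  rfl

/-- The path with given start and given numbers of steps. -/
def of (q : ℤ) (u d : ℕ) (hq : (n : ℤ) ≤ q) (hu : q + u < 2 * n) (hd : (d : ℤ) ≤ q) : PathIdx n :=
  ⟨⟨(q - n).toNat, by omega⟩, ⟨u, by simp only; omega⟩, ⟨d, by simp only; omega⟩⟩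

theorem start_of {q : ℤ} {u d : ℕ} (hq : (n : ℤ) ≤ q) (hu : q + u < 2 * n) (hd : (d : ℤ) ≤ q) :
    (of q u d hq hu hd).start = q := by
  simp only [start, of]
  omega

end PathIdx

variable {n : ℕ} (K : Type u) [Field K]

/-- The element of `Λ` belonging to a path. -/
def path (x : PathIdx n) : Lam n K := W n K x.start x.up x.down

theorem coef_path (x y : PathIdx n) :
    coef K x.start x.up x.down (path K y) = if y = x then 1 else 0 := by
  unfold path
  by_cases h : x.start = y.start
  · rw [← h, coef_W K ⟨⟨by have := x.le_start; omega, x.up_lt⟩, x.down_le⟩]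
    refine if_congr ⟨fun h' => ?_, fun h' => by rw [h']⟩ rfl rfl
    obtain ⟨h1, h2⟩ := Prod.mk.inj h'
    exact PathIdx.ext' h.symm h1 h2
  · rw [coef_W_of_ne, if_neg (by rintro rfl; exact h rfl)]
    rw [x.fold_start, y.fold_start]
    intro h'
    exact h (by simp only [PathIdx.start, h'])

theorem linearIndependent_path : LinearIndependent K (path K : PathIdx n → Lam n K) := by
  rw [Fintype.linearIndependent_iff]
  intro g hg x
  have := congrArg (coef K x.start x.up x.down) hg
  simpa [coef_path] using this

theorem W_mem_span {q : ℤ} (hq : (n : ℤ) ≤ q) (u d : ℕ) :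
    W n K q u d ∈ Submodule.span K (Set.range (path K : PathIdx n → Lam n K)) := by
  by_cases hu : q + u < 2 * n
  swap
  · rw [W_eq_zero_up n K d (by omega)]
    exact zero_mem _
  by_cases hd : (d : ℤ) ≤ q
  swap
  · rw [W_eq_zero_down n K u (by omega)]
    exact zero_mem _
  refine Submodule.subset_span ⟨PathIdx.of q u d hq hu hd, ?_⟩
  rw [path, PathIdx.start_of]
  rfl

theorem E_mul_E_of_ne {q q' : ℤ} (h : fold n q ≠ fold n q') : E n K q * E n K q' = 0 := by
  by_cases h1 : fold n q < n
  swap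
  · rw [E_eq_zero n K (by rwa [← fold_lt_iff]), zero_mul]
  by_cases h2 : fold n q' < n
  swap
  · rw [E_eq_zero n K (q := q') (by rwa [← fold_lt_iff]), mul_zero]
  rw [E_eq_e n K h1, E_eq_e n K h2, e_mul_e_of_ne]
  simpa using h

theorem W_mul_arrow {q : ℤ} {u d : ℕ} {a : Arrow n} (h : fold n (q + u - d) = src a) :
    W n K q u d * arrow n K a = sgn K (src a) (tgt a) •
      if fold n (q + u - d + 1) = tgt a then W n K q (u + 1) d else W n K q u (d + 1) := by
  split_ifs with h'
  · rw [arrow_eq_smul_S K h h', mul_smul_comm, W_mul_up]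
  · rw [arrow_eq_smul_S K h ((arrow_lift a h).resolve_left h'), mul_smul_comm, W_mul_down]

theorem W_mul_arrow_of_ne {q : ℤ} {u d : ℕ} {a : Arrow n} (h : fold n (q + u - d) ≠ src a) :
    W n K q u d * arrow n K a = 0 := by
  rw [← W_mul_E, ← e_src_mul_arrow, mul_assoc, ← mul_assoc (E n K _), e_eq_E,
    E_mul_E_of_ne K (by rwa [fold_add]), zero_mul, mul_zero]

theorem W_mul_e {q : ℤ} {u d : ℕ} (i : Fin n) :
    W n K q u d * e n K i = if fold n (q + u - d) = i then W n K q u d else 0 := by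
  split_ifs with h
  · rw [e_eq_E, E, fold_add, ← h]
    exact W_mul_E n K q u d
  · rw [← W_mul_E, mul_assoc, e_eq_E, E_mul_E_of_ne K (by rwa [fold_add]), mul_zero]

/-- A path times a generator is zero or a multiple of a path, so the span is a right ideal. It
contains `1 = ∑ e_i`, hence is everything. -/
theorem mul_mem_span_path (y x : Lam n K)
    (hx : x ∈ Submodule.span K (Set.range (path K : PathIdx n → Lam n K))) :
    x * y ∈ Submodule.span K (Set.range (path K : PathIdx n → Lam n K)) := by
  obtain ⟨y, rfl⟩ := RingQuot.mkAlgHom_surjective K (Rel n K) y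
  change x * mk n K y ∈ _
  induction y generalizing x with
  | grade0 c =>
    rw [AlgHom.commutes, ← Algebra.commutes, ← Algebra.smul_def]
    exact Submodule.smul_mem _ c hx
  | grade1 g =>
    induction hx using Submodule.span_induction with
    | mem x hx =>
      obtain ⟨x, rfl⟩ := hx
      unfold path
      cases g with
      | vtx i =>
        have := W_mul_e K (q := x.start) (u := x.up) (d := x.down) i
        rw [e] at this
        rw [this]
        split_ifs
        · exact W_mem_span K x.le_start _ _
        · exact zero_mem _
      | arr a =>
        by_cases h : fold n (x.start + x.up - x.down) = src a
        · have := W_mul_arrow K (q := x.start) (u := x.up) (d := x.down) h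
          rw [arrow] at this
          rw [this]
          refine Submodule.smul_mem _ _ ?_
          split_ifs <;> exact W_mem_span K x.le_start _ _
        · have := W_mul_arrow_of_ne K (q := x.start) (u := x.up) (d := x.down) h
          rw [arrow] at this
          rw [this]
          exact zero_mem _
    | zero => rw [zero_mul]; exact zero_mem _
    | add x y _ _ hx hy => rw [add_mul]; exact add_mem hx hy
    | smul c x _ hx => rw [smul_mul_assoc]; exact Submodule.smul_mem _ _ hx
  | mul a b ha hb =>
    rw [map_mul, ← mul_assoc]
    exact hb _ (ha _ hx)
  | add a b ha hb =>
    rw [map_add, mul_add]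
    exact add_mem (ha _ hx) (hb _ hx)

theorem span_path : ⊤ ≤ Submodule.span K (Set.range (path K : PathIdx n → Lam n K)) := by
  intro x _
  rw [← one_mul x]
  refine mul_mem_span_path K x 1 ?_
  rw [← sum_e]
  refine Submodule.sum_mem _ fun i _ => ?_
  rw [e_eq_E, ← W_zero_zero]
  exact W_mem_span K (by omega) 0 0

/-- The basis of `Λ` that consists of (signed) paths. -/
def pathBasis : Module.Basis (PathIdx n) K (Lam n K) :=
  Module.Basis.mk (linearIndependent_path K) (span_path K)

theorem pathBasis_apply (x : PathIdx n) : pathBasis K x = path K x := by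
  simp [pathBasis]

/-! ## Elements of the projective bimodules -/

/-- The action of the enveloping algebra on a bimodule. -/
def act {n : ℕ} {K : Type u} [Field K] {M : Type*} [AddCommGroup M] [Module (Env n K) M]
    (r : Env n K) (m : M) : M := r • m

infixr:73 " ⊳ " => act

section Bimodules

variable {n : ℕ} {K : Type u} [Field K]

instance : IsScalarTower K (Env n K) (Lam n K) where
  smul_assoc r ab a := by
    change TensorProduct.Algebra.moduleAux _ _ = _ • TensorProduct.Algebra.moduleAux _ _
    simp

/-- The element `a ⊗ b°` of the enveloping algebra. -/
def bm (a b : Lam n K) : Env n K := a ⊗ₜ[K] op b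

theorem bm_smul_lam (a b x : Lam n K) : bm a b • x = a * x * b := by
  change TensorProduct.Algebra.moduleAux _ _ = _
  simp [bm, TensorProduct.Algebra.moduleAux, ← mul_assoc]

theorem bm_mul_bm (a b c d : Lam n K) : bm a b * bm c d = bm (a * c) (d * b) := by
  simp [bm, Algebra.TensorProduct.tmul_mul_tmul]

theorem bm_one_one : (bm 1 1 : Env n K) = 1 := rfl

theorem bm_add_right (a b b' : Lam n K) : bm a (b + b') = bm a b + bm a b' := by
  simp [bm, TensorProduct.tmul_add]

theorem bm_smul_left (c : K) (a b : Lam n K) : bm (c • a) b = c • bm a b := by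
  simp [bm, TensorProduct.smul_tmul']

theorem bm_smul_right (c : K) (a b : Lam n K) : bm a (c • b) = c • bm a b := by
  simp [bm]

theorem bm_zero_left (b : Lam n K) : bm 0 b = 0 := by simp [bm]

theorem bm_zero_right (a : Lam n K) : bm a 0 = 0 := by simp [bm]

theorem bm_neg_left (a b : Lam n K) : bm (-a) b = -bm a b := by
  simp [bm, TensorProduct.neg_tmul]

theorem bm_sum_left {ι : Type*} (t : Finset ι) (a : ι → Lam n K) (b : Lam n K) :
    bm (∑ i ∈ t, a i) b = ∑ i ∈ t, bm (a i) b := by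
  simp [bm, TensorProduct.sum_tmul]

section Act

variable {M : Type*} [AddCommGroup M] [Module (Env n K) M]

theorem one_act (m : M) : (1 : Env n K) ⊳ m = m := one_smul _ m

theorem zero_act (m : M) : (0 : Env n K) ⊳ m = 0 := zero_smul (Env n K) m

theorem act_zero (r : Env n K) : r ⊳ (0 : M) = 0 := smul_zero r

theorem add_act (r r' : Env n K) (m : M) : (r + r') ⊳ m = r ⊳ m + r' ⊳ m := add_smul r r' m

theorem neg_act (r : Env n K) (m : M) : (-r) ⊳ m = -(r ⊳ m) := neg_smul r m

theorem neg_smul_act (c : K) (r : Env n K) (m : M) : (-c • r) ⊳ m = -((c • r) ⊳ m) := by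
  rw [eq_neg_iff_add_eq_zero, ← add_act, ← add_smul, neg_add_cancel, zero_smul, zero_act]

theorem act_add (r : Env n K) (m m' : M) : r ⊳ (m + m') = r ⊳ m + r ⊳ m' := smul_add r m m'

theorem act_sub (r : Env n K) (m m' : M) : r ⊳ (m - m') = r ⊳ m - r ⊳ m' := smul_sub r m m'

theorem act_act (r r' : Env n K) (m : M) : r ⊳ r' ⊳ m = (r * r') ⊳ m := smul_smul r r' m

theorem sum_act {ι : Type*} (t : Finset ι) (r : ι → Env n K) (m : M) :
    (∑ i ∈ t, r i) ⊳ m = ∑ i ∈ t, r i ⊳ m := Finset.sum_smul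

theorem act_sum {ι : Type*} (t : Finset ι) (r : Env n K) (m : ι → M) :
    r ⊳ (∑ i ∈ t, m i) = ∑ i ∈ t, r ⊳ m i := Finset.smul_sum

theorem map_act {N : Type*} [AddCommGroup N] [Module (Env n K) N] (f : M →ₗ[Env n K] N)
    (r : Env n K) (m : M) : f (r ⊳ m) = r ⊳ f m := map_smul f r m

end Act

theorem bm_act_lam (a b x : Lam n K) : bm a b ⊳ x = a * x * b := bm_smul_lam a b x

/-- The projective bimodule `ProjBimod K s t` with its structure of a module over the
enveloping algebra as the only structure. -/
def PB (K : Type u) [Field K] {ι : Type} (s t : ι → Fin n) : Type u := ProjBimod K s t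

instance {ι : Type} (s t : ι → Fin n) : AddCommGroup (PB K s t) :=
  inferInstanceAs (AddCommGroup (ProjBimod K s t))

instance {ι : Type} (s t : ι → Fin n) : Module (Env n K) (PB K s t) :=
  inferInstanceAs (Module (Env n K) (ProjBimod K s t))

section Proj

variable {ι : Type} {s t : ι → Fin n}

/-- The components of an element of `PB K s t`. -/
def comp (x : ι) : PB K s t →ₗ[Env n K] Env n K :=
  (indec n K (s x) (t x)).subtype ∘ₗ (LinearMap.proj x : ProjBimod K s t →ₗ[Env n K] _)

theorem comp_act (r : Env n K) (v : PB K s t) (x : ι) : comp x (r ⊳ v) = r * comp x v :=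
  map_smul (comp x) r v

theorem comp_ext {v w : PB K s t} (h : ∀ x, comp x v = comp x w) : v = w :=
  funext fun x => Subtype.ext (h x)

variable [DecidableEq ι]

variable (K s t) in
/-- The generators of `PB K s t`. -/
def gn (x : ι) : PB K s t := gen K s t x

theorem comp_gn (x y : ι) : comp y (gn K s t x) = if y = x then bm (e n K (s x)) (e n K (t x)) else 0 := by
  change ((gen K s t x y : indec n K _ _) : Env n K) = _
  unfold gen
  split_ifs with h
  · subst h
    rw [Pi.single_eq_same]
    rfl
  · rw [Pi.single_eq_of_ne h]
    rfl

theorem bm_e_act_gen (x : ι) : bm (e n K (s x)) (e n K (t x)) ⊳ gn K s t x = gn K s t x := by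
  refine comp_ext fun y => ?_
  rw [comp_act, comp_gn]
  split_ifs
  · rw [bm_mul_bm, e_mul_e, e_mul_e]
  · exact mul_zero _

theorem bm_act_gen (a b : Lam n K) (x : ι) :
    bm (a * e n K (s x)) (e n K (t x) * b) ⊳ gn K s t x = bm a b ⊳ gn K s t x := by
  conv_rhs => rw [← bm_e_act_gen, act_act, bm_mul_bm]

/-- Right multiplication by an idempotent fixes the left ideal that it generates. Both the expansion
in generators and the projectivity rest on this. -/
theorem coe_mul_bm_e (i j : Fin n) (w : indec n K i j) :
    (w : Env n K) * bm (e n K i) (e n K j) = w := by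
  obtain ⟨r, hr⟩ := Submodule.mem_span_singleton.1 w.2
  rw [← hr]
  change r * bm _ _ * bm _ _ = r * bm _ _
  rw [mul_assoc, bm_mul_bm, e_mul_e, e_mul_e]

variable [Fintype ι]

theorem lift_gen {M : Type u} [AddCommGroup M] [Module (Env n K) M] (v : ι → M) (x : ι) :
    lift K s t v (gen K s t x) = bm (e n K (s x)) (e n K (t x)) ⊳ v x := by
  simp only [lift, LinearMap.sum_apply, LinearMap.comp_apply, LinearMap.proj_apply,
    Submodule.subtype_apply, LinearMap.toSpanSingleton_apply, gen]
  rw [Finset.sum_eq_single x]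
  · rw [Pi.single_eq_same]
    rfl
  · intro y _ hy
    rw [Pi.single_eq_of_ne hy]
    exact zero_act (v y)
  · simp

theorem eq_sum_act_gen (v : PB K s t) : v = ∑ x, comp x v ⊳ gn K s t x := by
  refine comp_ext fun y => ?_
  rw [map_sum, Finset.sum_eq_single y]
  · rw [comp_act, comp_gn, if_pos rfl]
    exact (coe_mul_bm_e _ _ ((v : ProjBimod K s t) y)).symm
  · intro x _ hx
    rw [comp_act, comp_gn, if_neg hx.symm]
    exact mul_zero _
  · simp

theorem proj_ext {M : Type*} [AddCommGroup M] [Module (Env n K) M]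
    {f g : PB K s t →ₗ[Env n K] M} (h : ∀ x, f (gn K s t x) = g (gn K s t x)) : f = g := by
  ext1 v
  rw [eq_sum_act_gen v, map_sum, map_sum]
  simp only [map_act, h]

end Proj

/-! ### Expansions in left-hand paths, and generators attached to positions. -/

variable (K)

/-- The coefficient of a path in the left-hand tensor factor. -/
def leftCoef (x : PathIdx n) : Env n K →ₗ[K] Lam n K :=
  (opLinearEquiv K).symm.toLinearMap ∘ₗ Finsupp.lapply x ∘ₗ
    (TensorProduct.equivFinsuppOfBasisLeft (pathBasis K)).toLinearMap

theorem leftCoef_bm (x y : PathIdx n) (b : Lam n K) :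
    leftCoef K x (bm (path K y) b) = if y = x then b else 0 := by
  simp only [leftCoef, bm, LinearMap.comp_apply, LinearEquiv.coe_coe,
    TensorProduct.equivFinsuppOfBasisLeft_apply_tmul, ← pathBasis_apply]
  simp [Finsupp.single_apply]
  split_ifs <;> simp

theorem sum_bm_leftCoef (w : Env n K) : w = ∑ x, bm (path K x) (leftCoef K x w) := by
  have := (TensorProduct.equivFinsuppOfBasisLeft (N := (Lam n K)ᵐᵒᵖ) (pathBasis K)).symm_apply_apply w
  rw [TensorProduct.equivFinsuppOfBasisLeft_symm_apply, Finsupp.sum_fintype _ _ (by simp)] at this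
  conv_lhs => rw [← this]
  refine Finset.sum_congr rfl fun x _ => ?_
  rw [pathBasis_apply]
  rfl

variable (n) in
/-- The bimodule `P`. -/
abbrev PP : Type u := PB (n := n) K id id

variable (n) in
/-- The bimodule `Q`. -/
abbrev QQ : Type u := PB (n := n) K src tgt

/-- The generators of `P`. -/
abbrev gP (i : Fin n) : PP n K := gn K id id i

/-- The generators of `Q`. -/
abbrev gQ (a : Arrow n) : QQ n K := gn K src tgt a

/-- The generator of `P` at a position. -/
def g0 (n : ℕ) (q : ℤ) : PP n K := if h : fold n q < n then gP K ⟨fold n q, h⟩ else 0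

/-- The signed generator of `Q` belonging to the arrow between two positions. -/
def g1 (n : ℕ) (q q' : ℤ) : QQ n K :=
  atPos (fun a => bm (sgn K (src a) (tgt a) • (1 : Lam n K)) 1 ⊳ gQ K a) q q'

theorem g0_eq {q : ℤ} {i : Fin n} (h : fold n q = i) : g0 K n q = gP K i := by
  rw [g0, dif_pos (by rw [h]; exact i.2)]
  congr 1
  exact Fin.ext h

theorem g0_of_not {q : ℤ} (h : ¬ (0 ≤ q ∧ q < 2 * n)) : g0 K n q = 0 :=
  dif_neg (by rwa [fold_lt_iff])

theorem g1_eq {q q' : ℤ} {a : Arrow n} (h : fold n q = (src a).val)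
    (h' : fold n q' = (tgt a).val) :
    g1 K n q q' = bm (sgn K (src a) (tgt a) • (1 : Lam n K)) 1 ⊳ gQ K a := by
  rw [g1, atPos_of _ h h']

theorem g1_of_not_left {q q' : ℤ} (h : ¬ (0 ≤ q ∧ q < 2 * n)) : g1 K n q q' = 0 := by
  refine dif_neg fun h' => h (by rw [← fold_lt_iff]; exact h'.1)

theorem g1_of_not_right {q q' : ℤ} (h : ¬ (0 ≤ q' ∧ q' < 2 * n)) : g1 K n q q' = 0 := by
  refine dif_neg fun h' => h (by rw [← fold_lt_iff]; exact h'.2.1)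

theorem bm_act_g0 (a b : Lam n K) (q : ℤ) :
    bm (a * E n K q) (E n K q * b) ⊳ g0 K n q = bm a b ⊳ g0 K n q := by
  by_cases h : fold n q < n
  · rw [g0, dif_pos h, E_eq_e n K h]
    exact bm_act_gen (s := id) (t := id) a b _
  · rw [g0, dif_neg h, act_zero, act_zero]

theorem bm_E_left_act_g0 (b : Lam n K) (q : ℤ) :
    bm (E n K q) b ⊳ g0 K n q = bm 1 b ⊳ g0 K n q := by
  rw [← bm_act_g0, ← bm_act_g0 K 1, E_mul_E, one_mul]

theorem bm_E_right_act_g0 (a b : Lam n K) (q : ℤ) :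
    bm a (E n K q * b) ⊳ g0 K n q = bm a b ⊳ g0 K n q := by
  rw [← bm_act_g0, ← mul_assoc, E_mul_E, bm_act_g0]

theorem bm_act_g1 (a b : Lam n K) (q q' : ℤ) :
    bm (a * E n K q) (E n K q' * b) ⊳ g1 K n q q' = bm a b ⊳ g1 K n q q' := by
  by_cases h : ∃ (hi : fold n q < n) (hj : fold n q' < n),
    HasArrow n (⟨fold n q, hi⟩, ⟨fold n q', hj⟩)
  · have := bm_act_gen (ι := Arrow n) (s := src) (t := tgt)
      (sgn K (fold n q) (fold n q') • a) b ⟨_, h.2.2⟩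
    rw [g1, atPos_of _ (a := ⟨_, h.2.2⟩) rfl rfl, E_eq_e n K h.1, E_eq_e n K h.2.1,
      act_act, act_act, bm_mul_bm, bm_mul_bm, one_mul, one_mul, mul_smul_comm, mul_smul_comm,
      mul_one, mul_one, ← smul_mul_assoc]
    exact this
  · rw [g1, show atPos _ _ _ = _ from dif_neg h, act_zero, act_zero]

theorem path_mul_E (x : PathIdx n) : path K x * E n K x.pos = path K x := W_mul_E n K _ _ _

theorem path_mul_e_of_ne {x : PathIdx n} {i : Fin n} (h : i ≠ x.tgt) : path K x * e n K i = 0 := by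
  rw [path, W_mul_e, if_neg]
  intro h'
  exact h (Fin.ext h'.symm)

theorem bm_path_act_genP_of_ne {x : PathIdx n} {i : Fin n} (h : i ≠ x.tgt) (b : Lam n K) :
    bm (path K x) b ⊳ gP K i = 0 := by
  rw [← bm_act_gen (s := id) (t := id), id, path_mul_e_of_ne K h, bm_zero_left, zero_act]

theorem bm_path_act_genQ_of_ne {x : PathIdx n} {a : Arrow n} (h : src a ≠ x.tgt) (b : Lam n K) :
    bm (path K x) b ⊳ gQ K a = 0 := by
  rw [← bm_act_gen (s := src) (t := tgt), path_mul_e_of_ne K h, bm_zero_left, zero_act]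

/-- Expanding the left-hand factor in paths, only those ending at the vertex of the generator
survive, so one right-hand coefficient per path suffices. -/
theorem P_eq_sum (v : PP n K) :
    v = ∑ x : PathIdx n, bm (path K x) (leftCoef K x (comp x.tgt v)) ⊳ g0 K n x.pos := by
  conv_lhs => rw [eq_sum_act_gen (s := id) (t := id) v]
  have : ∀ i, comp i v ⊳ gP K i =
      ∑ x : PathIdx n, bm (path K x) (leftCoef K x (comp i v)) ⊳ gP K i := by
    intro i
    rw [← sum_act, ← sum_bm_leftCoef]
  simp only [this]
  rw [Finset.sum_comm]
  refine Finset.sum_congr rfl fun x _ => ?_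
  rw [Finset.sum_eq_single x.tgt, g0_eq K (i := x.tgt) rfl]
  · intro i _ hi
    exact bm_path_act_genP_of_ne K hi _
  · simp

/-- As for `P`; the arrows that can follow a path are the two steps out of its final position. -/
theorem Q_eq_sum (v : QQ n K) : ∃ y y' : PathIdx n → Lam n K,
    v = ∑ x : PathIdx n, (bm (path K x) (y x) ⊳ g1 K n x.pos (x.pos + 1) +
      bm (path K x) (y' x) ⊳ g1 K n x.pos (x.pos - 1)) := by
  let f (x : PathIdx n) (a : Arrow n) : QQ n K := bm (path K x) (leftCoef K x (comp a v)) ⊳ gQ K a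
  have h1 : v = ∑ x : PathIdx n, ∑ a : Arrow n with src a = x.tgt, f x a := by
    conv_lhs => rw [eq_sum_act_gen (s := src) (t := tgt) v]
    have : ∀ a, comp a v ⊳ gQ K a = ∑ x : PathIdx n, f x a := by
      intro a
      rw [← sum_act, ← sum_bm_leftCoef]
    simp only [this]
    rw [Finset.sum_comm]
    refine Finset.sum_congr rfl fun x _ => (Finset.sum_filter_of_ne fun a _ ha => ?_).symm
    by_contra h
    exact ha (bm_path_act_genQ_of_ne K h _)
  have h2 : ∀ (x : PathIdx n) (q' : ℤ), ∃ y, atPos (f x) x.pos q' =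
      bm (path K x) y ⊳ g1 K n x.pos q' := by
    intro x q'
    unfold g1 atPos
    split_ifs with h
    · set a : Arrow n := ⟨_, h.2.2⟩ with ha
      refine ⟨sgn K (src a) (tgt a) • leftCoef K x (comp a v), ?_⟩
      rw [bm_smul_right, act_act, smul_mul_assoc, bm_mul_bm, one_mul, mul_smul_comm, mul_one,
        bm_smul_left, smul_smul, sgn_mul_self, one_smul]
    · exact ⟨0, by rw [act_zero]⟩
  choose y hy using h2
  refine ⟨fun x => y x (x.pos + 1), fun x => y x (x.pos - 1), ?_⟩
  conv_lhs => rw [h1]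
  refine Finset.sum_congr rfl fun x _ => ?_
  rw [sum_arrows_eq (f x) (q := x.pos) rfl, hy, hy]

theorem leftCoef_g0 (x y : PathIdx n) (b : Lam n K) (q : ℤ) (hq : y.pos = q) :
    leftCoef K x (comp x.tgt (bm (path K y) b ⊳ g0 K n q)) = if y = x then E n K q * b else 0 := by
  subst hq
  rw [← bm_act_g0, path_mul_E, g0_eq K (i := y.tgt) rfl, comp_act]
  by_cases h : x.tgt = y.tgt
  · rw [h]
    have : bm (path K y) (E n K y.pos * b) * comp y.tgt (gP K y.tgt) =
        bm (path K y) (E n K y.pos * b) := by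
      rw [comp_gn, if_pos rfl]
      have : e n K (id y.tgt) = E n K y.pos := (E_eq_e n K y.fold_pos_lt).symm
      rw [bm_mul_bm, ← mul_assoc, this, path_mul_E, E_mul_E]
    rw [this, leftCoef_bm]
  · rw [comp_gn, if_neg h, if_neg (by rintro rfl; exact h rfl), mul_zero, map_zero]

theorem leftCoef_g1 (x y : PathIdx n) (b : Lam n K) (q q' : ℤ) (hq : y.pos = q) (a : Arrow n) :
    leftCoef K x (comp a (bm (path K y) b ⊳ g1 K n q q')) =
      if y = x ∧ fold n q = src a ∧ fold n q' = tgt a then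
        sgn K (src a) (tgt a) • (E n K q' * b) else 0 := by
  subst hq
  rw [← bm_act_g1, path_mul_E]
  by_cases h : fold n y.pos = src a ∧ fold n q' = tgt a
  · have : bm (path K y) (E n K q' * b) * comp a (gQ K a) =
        bm (path K y) (E n K q' * b) := by
      rw [comp_gn, if_pos rfl]
      have h1 : e n K (src a) = E n K y.pos := by
        rw [E_eq_e n K y.fold_pos_lt]
        congr 1
        exact Fin.ext h.1.symm
      have h2 : e n K (tgt a) = E n K q' := by
        rw [E_eq_e n K (by rw [h.2]; exact (tgt a).2)]
        congr 1
        exact Fin.ext h.2.symm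
      rw [bm_mul_bm, ← mul_assoc, h1, h2, path_mul_E, E_mul_E]
    rw [g1_eq K h.1 h.2, act_act, bm_mul_bm, one_mul, mul_smul_comm, mul_one, bm_smul_left,
      comp_act, smul_mul_assoc, this, map_smul, leftCoef_bm]
    by_cases hxy : y = x
    · rw [if_pos hxy, if_pos ⟨hxy, h⟩]
    · rw [if_neg hxy, if_neg fun h' => hxy h'.1, smul_zero]
  · rw [if_neg fun h' => h h'.2]
    unfold g1 atPos
    split_ifs with h'
    · have hne : a ≠ ⟨_, h'.2.2⟩ := by
        rintro rfl
        exact h ⟨rfl, rfl⟩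
      rw [act_act, comp_act]
      rw [comp_gn, if_neg hne, mul_zero, map_zero]
    · rw [act_zero, map_zero, map_zero]

end Bimodules

/-! ## The basis paths as paths in the unfolded quiver -/

section BasisPaths

variable (n : ℕ) (K : Type u) [Field K]

/-- The sign `(-1)^{m (m + 1) / 2}`. -/
def sg (m : ℕ) : K := (-1) ^ (m * (m + 1) / 2)

theorem sg_mul_self (m : ℕ) : sg K m * sg K m = 1 := sign_mul_self K _

theorem sg_zero : sg K 0 = 1 := by simp [sg]

theorem fold_n : fold n n = 0 := fold_add n 0

theorem fold_pred : fold n (n - 1) = 0 := by unfold fold; split_ifs <;> omega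

theorem step_up (i : ℕ) : step n K i (i + 1) = S n K (n + i) (n + i + 1) := by
  have e2 : fold n (n + i + 1) = i + 1 := by
    have := fold_add n (i + 1); push_cast at this; rwa [add_assoc]
  rw [S, fold_add, e2]
  simp [sgn]

theorem step_down (i : ℕ) :
    step n K (i + 1) i = (-1 : K) ^ (i + 1) • S n K (n + i + 1) (n + i + 1 - 1) := by
  have e2 : fold n (n + i + 1) = i + 1 := by
    have := fold_add n (i + 1); push_cast at this; rwa [add_assoc]
  rw [S, add_sub_cancel_right, fold_add, e2, smul_smul, sgn, if_pos (by omega), sign_mul_self,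
    one_smul]

theorem step_loop : step n K 0 0 = S n K n (n - 1) := by
  rw [S, fold_n, fold_pred]
  simp [sgn]

theorem step_loop' : step n K 0 0 = S n K (n - 1) n := by
  rw [S, fold_n, fold_pred]
  simp [sgn]

theorem upPath_eq (i r : ℕ) : upPath n K i r = W n K (n + i) r 0 := by
  induction r with
  | zero => rw [upPath, W_zero_zero, E, fold_add]
  | succ r ih =>
    rw [upPath, ih, step_up, W_succ_zero]
    congr 2 <;> push_cast <;> ring

/-- The signs of the steps multiply to `(-1)` to the power `(j + 1) + ⋯ + (j + r)`, a difference of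
triangular numbers. -/
theorem downPath_eq (j r : ℕ) :
    downPath n K j r = (sg K j * sg K (j + r)) • W n K (n + j + r) 0 r := by
  induction r with
  | zero =>
    rw [downPath, add_zero, sg_mul_self, one_smul, W_zero_zero]
    simp [E, fold_add]
  | succ r ih =>
    rw [downPath, ih, step_down, smul_mul_smul_comm, S_down, W_mul_W' n K (by push_cast; ring),
      ← add_assoc, sg, sg, sg, sign_succ]
    congr 1
    · ring
    · congr 1
      · push_cast; ring
      · ring

theorem cPath_eq {i j m : ℕ} (hi : i ≤ m) (hj : j ≤ m) :
    cPath n K i j m = (sg K j * sg K m) • W n K (n + i) (m - i) (m - j) := by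
  rw [cPath, upPath_eq, downPath_eq, mul_smul_comm, W_mul_W' n K (by push_cast [hi, hj]; ring),
    add_zero, zero_add, Nat.add_sub_cancel' hj]

/-- In the unfolded line the loops alternate between the steps `n → n - 1` and `n - 1 → n`; an odd
number `2 r + 1` of them makes `r + 1` steps down and `r` steps up. -/
theorem W_mul_loop_pow {q : ℤ} {u d : ℕ} (h : q + u - d = n) (r : ℕ) :
    W n K q u d * step n K 0 0 ^ (2 * r + 1) = W n K q (u + r) (d + r + 1) := by
  induction r with
  | zero =>
    rw [mul_zero, zero_add, pow_one, step_loop, ← h, W_mul_down]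
    rfl
  | succ r ih =>
    rw [show 2 * (r + 1) + 1 = 2 * r + 1 + 1 + 1 by ring, pow_succ, pow_succ, ← mul_assoc,
      ← mul_assoc, ih]
    nth_rw 1 [step_loop']
    have e1 : q + (u + r : ℕ) - (d + r + 1 : ℕ) = n - 1 := by push_cast; linarith
    have e2 : q + (u + r + 1 : ℕ) - (d + r + 1 : ℕ) = n := by push_cast; linarith
    have h1 := W_mul_up n K q (u + r) (d + r + 1)
    rw [e1, sub_add_cancel] at h1
    have h2 := W_mul_down n K q (u + r + 1) (d + r + 1)
    rw [e2] at h2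
    rw [h1, step_loop, h2]
    rfl

theorem dPath_eq (i j m : ℕ) : dPath n K i j m =
    sg K i • W n K (n + i) (n - 1 - m) (i + (n - 1 - m) + 1 + j) := by
  have h := W_mul_loop_pow n K (q := n + i) (u := 0) (d := i) (by push_cast; ring) (n - 1 - m)
  -- After an odd number of loops the path stands at `n - 1`, the other position of the first
  -- vertex, from which reaching the vertex `j` takes `j` steps down.
  have h' := W_reflect n K n j 0
  rw [dPath, downPath_eq, sg_zero, one_mul, zero_add, smul_mul_assoc, smul_mul_assoc,
    Nat.cast_zero, add_zero, h, upPath_eq, Nat.cast_zero, add_zero, ← h', zero_add,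
    W_mul_W' n K (by push_cast; ring), add_zero]

theorem omega_eq (i : Fin n) : omega K i = W n K (n + i.val) (n - 1 - i) (n + i) := by
  rw [omega, dPath_eq, smul_smul]
  change (sg K i * sg K i) • _ = _
  rw [sg_mul_self, one_smul]
  congr 1
  omega

end BasisPaths

section Duality

variable {n : ℕ} (K : Type u) [Field K]

/-- The number of steps up of a basis path. -/
def upIdx {i j : Fin n} (b : BasisIdx n i j) : ℕ := if b.2 then b.1.1 - i else n - 1 - b.1.1

/-- The number of steps down of a basis path. -/
def downIdx {i j : Fin n} (b : BasisIdx n i j) : ℕ :=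
  if b.2 then b.1.1 - j else i + (n - 1 - b.1.1) + 1 + j

theorem upIdx_lt {i j : Fin n} (b : BasisIdx n i j) : upIdx b < n - i := by
  obtain ⟨⟨m, hm⟩, t⟩ := b
  have hi : i.val ≤ m.val := (le_max_left i j).trans hm
  have := m.2
  unfold upIdx
  split_ifs <;> simp only <;> omega

theorem downIdx_lt {i j : Fin n} (b : BasisIdx n i j) : downIdx b < n + i + 1 := by
  obtain ⟨⟨m, hm⟩, t⟩ := b
  have hi : i.val ≤ m.val := (le_max_left i j).trans hm
  have hj : j.val ≤ m.val := (le_max_right i j).trans hm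
  have := m.2
  unfold downIdx
  split_ifs <;> simp only <;> omega

theorem deg_eq {i j : Fin n} (b : BasisIdx n i j) : deg b = upIdx b + downIdx b := by
  obtain ⟨⟨m, hm⟩, t⟩ := b
  have hi : i.val ≤ m.val := (le_max_left i j).trans hm
  have hj : j.val ≤ m.val := (le_max_right i j).trans hm
  unfold deg upIdx downIdx
  split_ifs <;> simp only <;> omega

theorem deg_compl {i j : Fin n} (b : BasisIdx n i j) : deg b + deg (compl b) = 2 * n - 1 := by
  obtain ⟨⟨m, hm⟩, t⟩ := b
  have hi : i.val ≤ m.val := (le_max_left i j).trans hm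
  have hj : j.val ≤ m.val := (le_max_right i j).trans hm
  have := m.2
  cases t <;> simp [deg, compl] <;> omega

theorem fold_idx {i j : Fin n} (b : BasisIdx n i j) :
    fold n (n + i.val + upIdx b - downIdx b) = j := by
  obtain ⟨⟨m, hm⟩, t⟩ := b
  have hi : i.val ≤ m.val := (le_max_left i j).trans hm
  have hj : j.val ≤ m.val := (le_max_right i j).trans hm
  have := m.2
  unfold upIdx downIdx fold
  split_ifs <;> simp_all <;> omega

/-- The signs relating `elt` and `star` to signed paths are the same product of values of `sg`, so
they cancel in the tensor product. The dual path uses up the steps that are missing to the corner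
`(n - 1 - i, n + i)`. -/
theorem bm_elt_star {i j : Fin n} (b : BasisIdx n i j) : bm (elt K b) (star K b) =
    bm (W n K (n + i.val) (upIdx b) (downIdx b)) (W n K (n + i.val + upIdx b - downIdx b)
      (n - 1 - i - upIdx b) (n + i - downIdx b)) := by
  obtain ⟨⟨m, hm⟩, t⟩ := b
  have hi : i.val ≤ m.val := (le_max_left i j).trans hm
  have hj : j.val ≤ m.val := (le_max_right i j).trans hm
  have hmn := m.2
  cases t
  · simp only [elt, star, compl, upIdx, downIdx, Bool.not_false, if_true,
      Bool.false_eq_true, if_false]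
    rw [dPath_eq, cPath_eq n K hj hi, smul_smul, bm_smul_left, bm_smul_right, smul_smul]
    change (sg K i * (sg K m * (sg K i * sg K m))) • _ = _
    rw [show sg K i * (sg K m * (sg K i * sg K m)) = (sg K i * sg K i) * (sg K m * sg K m) by ring,
      sg_mul_self, sg_mul_self, one_mul, one_smul, ← W_reflect n K (n + j)]
    congr 2 <;> push_cast [show m.val ≤ n - 1 by omega, show 1 ≤ n by omega] <;> omega
  · simp only [elt, star, compl, upIdx, downIdx, Bool.not_true, if_true,
      Bool.false_eq_true, if_false]
    rw [dPath_eq, cPath_eq n K hi hj, smul_smul, bm_smul_left, bm_smul_right, smul_smul]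
    change (sg K j * sg K m * (sg K m * sg K j)) • _ = _
    rw [show sg K j * sg K m * (sg K m * sg K j) = (sg K j * sg K j) * (sg K m * sg K m) by ring,
      sg_mul_self, sg_mul_self, one_mul, one_smul]
    congr 2
    · push_cast [hi, hj]; ring
    · omega
    · omega

/-- The rectangle is cut along `d ≤ i + u`: pairs satisfying this end at a position `≥ n` and give
the paths with flag `true`, the others end below `n` and give those with flag `false`. -/
theorem sum_basisIdx {M : Type*} [AddCommMonoid M] (i : Fin n) (f : ℕ → ℕ → M) :
    ∑ j : Fin n, ∑ b : BasisIdx n i j, f (upIdx b) (downIdx b) =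
      ∑ u ∈ Finset.range (n - i), ∑ d ∈ Finset.range (n + i + 1), f u d := by
  rw [← Finset.sum_product', ← Fintype.sum_sigma']
  refine Finset.sum_bij (fun x _ => (upIdx x.2, downIdx x.2)) ?_ ?_ ?_ ?_
  · rintro ⟨j, b⟩ _
    simp only [Finset.mem_product, Finset.mem_range]
    exact ⟨upIdx_lt b, downIdx_lt b⟩
  · rintro ⟨j, ⟨m, hm⟩, t⟩ _ ⟨j', ⟨m', hm'⟩, t'⟩ _ h
    have hi : i.val ≤ m.val := (le_max_left i j).trans hm
    have hj : j.val ≤ m.val := (le_max_right i j).trans hm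
    have hi' : i.val ≤ m'.val := (le_max_left i j').trans hm'
    have hj' : j'.val ≤ m'.val := (le_max_right i j').trans hm'
    have hmn := m.2
    have hmn' := m'.2
    obtain ⟨h1, h2⟩ := Prod.mk.inj h
    unfold upIdx at h1
    unfold downIdx at h2
    have : j.val = j'.val ∧ m.val = m'.val ∧ t = t' := by
      cases t <;> cases t' <;> simp at h1 h2 ⊢ <;> omega
    obtain ⟨e1, e2, rfl⟩ := this
    obtain rfl : j = j' := Fin.ext e1
    obtain rfl : m = m' := Fin.ext e2
    rfl
  · rintro ⟨u, d⟩ h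
    simp only [Finset.mem_product, Finset.mem_range] at h
    by_cases hd : d ≤ i.val + u
    · refine ⟨⟨⟨i + u - d, by omega⟩, ⟨⟨i + u, by omega⟩, ?_⟩, true⟩, Finset.mem_univ _, ?_⟩
      · rw [max_le_iff, Fin.le_def, Fin.le_def]
        simp only
        omega
      · simp only [upIdx, downIdx, if_true]
        rw [Prod.mk.injEq]
        omega
    · refine ⟨⟨⟨d - i - u - 1, by omega⟩, ⟨⟨n - 1 - u, by omega⟩, ?_⟩, false⟩,
        Finset.mem_univ _, ?_⟩
      · rw [max_le_iff, Fin.le_def, Fin.le_def]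
        simp only
        omega
      · simp only [upIdx, downIdx, Bool.false_eq_true, if_false]
        rw [Prod.mk.injEq]
        omega
  · intro x _
    rfl

end Duality

/-! ## The differentials in the unfolded quiver -/

section Differentials

variable (n : ℕ) {K : Type u} [Field K] (s : K)

/-- The differential `δ` (or `δ_τ`). -/
def diffD : QQ n K →ₗ[Env n K] PP n K := dDelta n K s

/-- The differential `R` (or `R_τ`). -/
def diffR : PP n K →ₗ[Env n K] QQ n K := dR n K s

/-- The differential `k` (or `k_τ`). -/
def diffK : PP n K →ₗ[Env n K] PP n K := dk n K s

/-- The augmentation. -/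
def aug : PP n K →ₗ[Env n K] Lam n K := lift K id id fun i => e n K i

/-- The part of `R` that belongs to an arrow and its opposite. -/
def edge (q q' : ℤ) : QQ n K :=
  bm (s • 1) (S n K q' q) ⊳ g1 K n q q' + bm (S n K q q') 1 ⊳ g1 K n q' q

theorem diffD_gQ (a : Arrow n) : diffD n s (gQ K a) =
    bm (arrow n K a) 1 ⊳ gP K (tgt a) - bm (s • 1) (arrow n K a) ⊳ gP K (src a) := by
  have h : diffD n s (gQ K a) = bm (e n K (src a)) (e n K (tgt a)) ⊳
      (bm (arrow n K a) 1 ⊳ gP K (tgt a) - (s • bm 1 (arrow n K a)) ⊳ gP K (src a)) :=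
    lift_gen _ a
  have h1 := bm_act_gen (s := id) (t := id) (arrow n K a) 1 (tgt a)
  have h2 := bm_act_gen (s := id) (t := id) (s • 1) (arrow n K a) (src a)
  rw [h, act_sub, act_act, act_act, mul_smul_comm, bm_mul_bm, bm_mul_bm, e_src_mul_arrow,
    arrow_mul_e_tgt, ← bm_smul_left, mul_one, one_mul, ← h1, ← h2, smul_mul_assoc, one_mul]
  simp only [id, arrow_mul_e_tgt, e_src_mul_arrow, mul_one]

theorem diffD_g1 {q q' : ℤ} (hq : q' = q + 1 ∨ q' = q - 1) : diffD n s (g1 K n q q') =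
    bm (S n K q q') 1 ⊳ g0 K n q' - bm (s • 1) (S n K q q') ⊳ g0 K n q := by
  by_cases h : 0 ≤ q ∧ q < 2 * n
  swap
  · rw [g1_of_not_left K h, S_eq_zero_left n K h, bm_zero_left, bm_zero_right, map_zero, zero_act,
      zero_act, sub_zero]
  by_cases h' : 0 ≤ q' ∧ q' < 2 * n
  swap
  · rw [g1_of_not_right K h', S_eq_zero_right n K h', bm_zero_left, bm_zero_right, map_zero,
      zero_act, zero_act, sub_zero]
  rw [← fold_lt_iff] at h h'
  set a : Arrow n := ⟨_, hasArrow_fold h h' hq⟩ with ha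
  rw [g1_eq K (a := a) rfl rfl, g0_eq K (i := tgt a) rfl, g0_eq K (i := src a) rfl,
    S_eq_smul_arrow K (a := a) rfl rfl, map_act, diffD_gQ, act_sub, act_act, act_act, bm_mul_bm,
    bm_mul_bm, one_mul, mul_one, smul_mul_assoc, smul_mul_assoc, one_mul, one_mul, bm_smul_right,
    bm_smul_left _ (s • 1)]

theorem edge_of_not_left {q q' : ℤ} (h : ¬ (0 ≤ q ∧ q < 2 * n)) : edge n s q q' = 0 := by
  rw [edge, g1_of_not_left K h, g1_of_not_right K h, act_zero, act_zero, add_zero]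

theorem edge_of_not_right {q q' : ℤ} (h : ¬ (0 ≤ q' ∧ q' < 2 * n)) : edge n s q q' = 0 := by
  rw [edge, g1_of_not_right K h, g1_of_not_left K h, act_zero, act_zero, add_zero]

theorem bm_act_edge (q q' : ℤ) : bm (E n K q) (E n K q) ⊳ edge n s q q' = edge n s q q' := by
  have h1 := bm_act_g1 K (s • 1) (S n K q' q) q q'
  have h2 := bm_act_g1 K (S n K q q') 1 q' q
  rw [edge, act_add, act_act, act_act, bm_mul_bm, bm_mul_bm, S_mul_E, E_mul_S, one_mul,
    ← h1, ← h2, smul_mul_assoc, one_mul, E_mul_S, S_mul_E, mul_smul_comm, mul_one]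

/-- Each arrow together with its opposite contributes one `edge`; the sign of the step up is `chi q`
and, by `chi_add_one`, that of the step down is its negative. So the sum in `R` becomes a
difference. -/
theorem diffR_g0 (q : ℤ) : diffR n s (g0 K n q) =
    bm (chi n K q • (1 : Lam n K)) 1 ⊳ (edge n s q (q + 1) - edge n s q (q - 1)) := by
  by_cases h : 0 ≤ q ∧ q < 2 * n
  swap
  · rw [g0_of_not K h, map_zero, edge_of_not_left n s h, edge_of_not_left n s h, sub_zero, act_zero]
  have hq := fold_lt_iff.2 h
  have h0 : diffR n s (g0 K n q) = bm (e n K ⟨_, hq⟩) (e n K ⟨_, hq⟩) ⊳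
      ∑ a : Arrow n with src a = ⟨_, hq⟩, ((s • bm 1 (arrow n K (bar a))) ⊳ gQ K a +
        bm (arrow n K a) 1 ⊳ gQ K (bar a)) := by
    rw [g0_eq K (i := ⟨_, hq⟩) rfl]
    exact lift_gen (s := id) (t := id) (M := QQ n K) (fun i => ∑ a : Arrow n with src a = i,
      ((s • bm 1 (arrow n K (bar a))) ⊳ gQ K a + bm (arrow n K a) 1 ⊳ gQ K (bar a))) ⟨_, hq⟩
  have key : ∀ q', (q' = q + 1 ∨ q' = q - 1) →
      atPos (fun a : Arrow n => (s • bm 1 (arrow n K (bar a))) ⊳ gQ K a +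
        bm (arrow n K a) 1 ⊳ gQ K (bar a)) q q' =
      bm ((sgnPos n K q q' * sgnPos n K q' q) • (1 : Lam n K)) 1 ⊳ edge n s q q' := by
    intro q' hq'
    by_cases h' : 0 ≤ q' ∧ q' < 2 * n
    swap
    · rw [edge_of_not_right n s h', act_zero]
      exact dif_neg fun h => h' (fold_lt_iff.1 h.2.1)
    rw [← fold_lt_iff] at h'
    set a : Arrow n := ⟨_, hasArrow_fold hq h' hq'⟩ with ha
    rw [atPos_of _ (a := a) rfl rfl, edge, g1_eq K (a := a) rfl rfl, g1_eq K (a := bar a) rfl rfl,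
      S_eq_smul_arrow K (a := a) rfl rfl, S_eq_smul_arrow K (a := bar a) rfl rfl, act_add]
    simp only [act_act, bm_mul_bm, bm_smul_left, bm_smul_right, one_mul, mul_one, smul_mul_assoc,
      mul_smul_comm, smul_smul]
    have e1 : sgnPos n K q q' = sgn K (src a) (tgt a) := rfl
    have e2 : sgnPos n K q' q = sgn K (src (bar a)) (tgt (bar a)) := rfl
    have h1 := sgn_mul_self K (src a) (tgt a)
    have h2 := sgn_mul_self K (src (bar a)) (tgt (bar a))
    rw [e1, e2]
    congr 2
    · congr 1
      linear_combination -s * sgn K (src (bar a)) (tgt (bar a)) * sgn K (src (bar a)) (tgt (bar a)) * h1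
        - s * h2
    · rw [show sgn K (src (bar a)) (tgt (bar a)) * sgn K (src a) (tgt a) *
        (sgn K (src a) (tgt a) * sgn K (src (bar a)) (tgt (bar a))) = 1 by
          linear_combination sgn K (src (bar a)) (tgt (bar a)) * sgn K (src (bar a)) (tgt (bar a)) * h1
            + h2, one_smul]
  have hc : sgnPos n K q (q - 1) * sgnPos n K (q - 1) q = - chi n K q := by
    have := chi_add_one n K (q - 1)
    rw [sub_add_cancel] at this
    rw [this, neg_neg, chi, sub_add_cancel, mul_comm]
  rw [h0, sum_arrows_eq _ (q := q) rfl, key _ (Or.inl rfl), key _ (Or.inr rfl), hc,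
    show sgnPos n K q (q + 1) * sgnPos n K (q + 1) q = chi n K q from rfl, ← bm_act_edge n s q (q + 1), ← bm_act_edge n s q (q - 1), E_eq_e n K hq]
  rw [neg_smul, bm_neg_left, neg_act, ← sub_eq_add_neg, ← act_sub, ← act_sub]
  simp only [act_act, bm_mul_bm, smul_mul_assoc, mul_smul_comm, one_mul, mul_one, e_mul_e]

theorem aug_g0 (q : ℤ) : aug n (g0 K n q) = E n K q := by
  by_cases h : 0 ≤ q ∧ q < 2 * n
  swap
  · rw [g0_of_not K h, E_eq_zero n K h, map_zero]
  rw [g0_eq K (i := ⟨_, fold_lt_iff.2 h⟩) rfl, E_eq_e n K (fold_lt_iff.2 h)]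
  have := lift_gen (K := K) (s := id) (t := id) (fun i => e n K i) ⟨fold n q, fold_lt_iff.2 h⟩
  refine this.trans ?_
  rw [bm_act_lam, id, e_mul_e, e_mul_e]

/-- The value of `k` at the generator at the position `B`, up to the sign `s`. -/
def casimir (A B : ℕ) : PP n K := ∑ u ∈ Finset.range (A + 1), ∑ d ∈ Finset.range (B + 1),
  bm ((-s) ^ (u + d) • W n K B u d) (W n K (B + u - d) (A - u) (B - d)) ⊳ g0 K n (B + u - d)

theorem pow_eq_of_mul_self {s : K} (hs : s * s = 1) {a b : ℕ} (h : (a + b) % 2 = 1) :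
    s ^ b = s * s ^ a := by
  have h2 : s ^ 2 = 1 := by rw [pow_two, hs]
  rw [← pow_succ', ← Nat.div_add_mod b 2, ← Nat.div_add_mod (a + 1) 2, pow_add, pow_add, pow_mul,
    pow_mul, h2, one_pow, one_pow, show (a + 1) % 2 = b % 2 by omega]

variable {n s}

/-- The lengths of `x` and `x^*` add up to the odd number `2n - 1`, so `s ^ deg x^* = s * s ^ deg
x`, and the sum over basis paths is a sum over the rectangle. -/
theorem diffK_gP (hs : s * s = 1) (i : Fin n) :
    diffK n s (gP K i) = bm (s • (1 : Lam n K)) 1 ⊳ casimir n s (n - 1 - i) (n + i) := by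
  have h : diffK n s (gP K i) = bm (e n K i) (e n K i) ⊳ ∑ j : Fin n, ∑ b : BasisIdx n i j,
      (((-1) ^ deg b * s ^ deg (compl b)) • bm (elt K b) (star K b)) ⊳ gP K j := lift_gen _ i
  let f (u d : ℕ) : PP n K := bm ((s * (-s) ^ (u + d)) • W n K (n + i.val) u d)
    (W n K (n + i.val + u - d) (n - 1 - i - u) (n + i - d)) ⊳ g0 K n (n + i.val + u - d)
  have h' : ∀ (j : Fin n) (b : BasisIdx n i j),
      (((-1) ^ deg b * s ^ deg (compl b)) • bm (elt K b) (star K b)) ⊳ gP K j =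
        f (upIdx b) (downIdx b) := by
    intro j b
    have hd := deg_compl b
    have hi := i.2
    simp only [f]
    rw [← g0_eq K (fold_idx b), bm_elt_star, ← bm_smul_left, ← deg_eq,
      pow_eq_of_mul_self hs (a := deg b) (by omega), ← neg_one_mul s, mul_pow]
    congr 3
    ring
  simp only [h'] at h
  rw [h, sum_basisIdx i f, casimir, show n - 1 - i.val + 1 = n - i by have := i.2; omega, act_sum,
    act_sum]
  refine Finset.sum_congr rfl fun u hu => ?_
  rw [act_sum, act_sum]
  refine Finset.sum_congr rfl fun d hd => ?_
  simp only [Finset.mem_range] at hu hd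
  simp only [f]
  have h1 := E_mul_W n K (n + i.val) u d
  have h2 := W_mul_E n K (n + i.val + u - d) (n - 1 - i - u) (n + i - d)
  rw [show (n + i.val + u - d : ℤ) + (n - 1 - i - u : ℕ) - (n + i - d : ℕ) =
    2 * n - 1 - (n + i) by omega, E_reflect] at h2
  rw [act_act, act_act, bm_mul_bm, bm_mul_bm, e_eq_E, mul_smul_comm, h1, h2, mul_one,
    smul_mul_assoc, one_mul, smul_smul]
  push_cast
  rfl

/-- The reflection transposes the rectangle. Thus the formula for `k` holds at all positions, and
later arguments need not single out the first vertex. -/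
theorem casimir_reflect {A B : ℕ} (h : A + B + 1 = 2 * n) :
    casimir n s A B = casimir n s B A := by
  rw [casimir, Finset.sum_comm, casimir]
  refine Finset.sum_congr rfl fun u hu => Finset.sum_congr rfl fun d hd => ?_
  simp only [Finset.mem_range] at hu hd
  have e1 : (2 * n - 1 - B : ℤ) = A := by omega
  have h1 := W_reflect n K B d u
  have h2 := W_reflect n K (B + d - u) (A - d) (B - u)
  have h3 : g0 K n (B + d - u) = g0 K n (A + u - d) := by
    unfold g0
    have := fold_reflect n (B + d - u)
    rw [show (2 * n - 1 - (B + d - u) : ℤ) = A + u - d by omega] at this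
    simp only [this]
  rw [e1] at h1
  rw [show (2 * n - 1 - (B + d - u) : ℤ) = A + u - d by omega] at h2
  rw [← h1, ← h2, h3, add_comm d u]

theorem diffK_g0 (hs : s * s = 1) {A B : ℕ} (h : A + B + 1 = 2 * n) :
    diffK n s (g0 K n B) = bm (s • (1 : Lam n K)) 1 ⊳ casimir n s A B := by
  by_cases hB : n ≤ B
  · have h0 := diffK_gP (K := K) hs (⟨B - n, by omega⟩ : Fin n)
    have hf : fold n B = B - n := by
      have := fold_add n (B - n)
      rwa [show (n + (B - n : ℕ) : ℤ) = B by omega] at this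
    rw [g0_eq K (i := ⟨B - n, by omega⟩) hf, h0]
    simp only
    congr 2 <;> omega
  · have h0 := diffK_gP (K := K) hs (⟨A - n, by omega⟩ : Fin n)
    have hf : fold n B = A - n := by
      have := fold_add n (A - n)
      rwa [show (n + (A - n : ℕ) : ℤ) = 2 * n - 1 - B by omega, fold_reflect] at this
    rw [g0_eq K (i := ⟨A - n, by omega⟩) hf, h0, casimir_reflect h]
    simp only
    congr 2 <;> omega

end Differentials

/-! ## The sequence is a complex -/

section Complex

variable {n : ℕ} {K : Type u} [Field K] {s : K}

theorem P_hom_ext {M : Type*} [AddCommGroup M] [Module (Env n K) M] {f g : PP n K →ₗ[Env n K] M}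
    (h : ∀ A B : ℕ, A + B + 1 = 2 * n → f (g0 K n B) = g (g0 K n B)) : f = g := by
  refine proj_ext (s := id) (t := id) fun i => ?_
  have := h (n - 1 - i) (n + i) (by have := i.2; omega)
  rwa [g0_eq K (i := i) (by push_cast; exact fold_add n i)] at this

theorem g1_reflect (q q' : ℤ) : g1 K n (2 * n - 1 - q) (2 * n - 1 - q') = g1 K n q q' := by
  unfold g1 atPos
  simp only [fold_reflect]

theorem Q_hom_ext {M : Type*} [AddCommGroup M] [Module (Env n K) M] {f g : QQ n K →ₗ[Env n K] M}
    (h : ∀ A B : ℕ, A + B + 2 = 2 * n → f (g1 K n B (B + 1)) = g (g1 K n B (B + 1))) : f = g := by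
  have key : ∀ q q' : ℤ, (0 ≤ q ∧ q < 2 * n) → (0 ≤ q' ∧ q' < 2 * n) → (q' = q + 1 ∨ q' = q - 1) →
      f (g1 K n q q') = g (g1 K n q q') := by
    intro q q' hq hq' h'
    rcases h' with rfl | rfl
    · have := h (2 * n - 2 - q).toNat q.toNat (by omega)
      rwa [Int.toNat_of_nonneg hq.1] at this
    · have := h (q - 1).toNat (2 * n - 1 - q).toNat (by omega)
      rw [Int.toNat_of_nonneg (by omega)] at this
      rwa [← g1_reflect q, show (2 * n - 1 - (q - 1) : ℤ) = 2 * n - 1 - q + 1 by ring]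
  refine proj_ext (s := src) (t := tgt) fun a => ?_
  have ha : fold n (n + (src a).val) = (src a).val := fold_add n _
  obtain ⟨q', hq', h'⟩ : ∃ q' : ℤ, (q' = n + (src a).val + 1 ∨ q' = n + (src a).val - 1) ∧
      fold n q' = tgt a := by
    rcases arrow_lift a ha with h' | h'
    · exact ⟨_, Or.inl rfl, h'⟩
    · exact ⟨_, Or.inr rfl, h'⟩
  have hg : gQ K a = bm (sgn K (src a) (tgt a) • (1 : Lam n K)) 1 ⊳ g1 K n (n + (src a).val) q' := by
    rw [g1_eq K ha h', act_act, bm_mul_bm, smul_mul_smul_comm, sgn_mul_self, one_smul, one_mul,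
      bm_one_one, one_act]
  change f (gQ K a) = g (gQ K a)
  rw [hg, map_act, map_act, key _ _ (fold_lt_iff.1 (by rw [ha]; exact (src a).2))
    (fold_lt_iff.1 (by rw [h']; exact (tgt a).2)) hq']

/-- The two terms at `q'` cancel and leave the round trip through `q'`. Commutativity of squares
makes it the same for both neighbours, whence `δ R = 0`. -/
theorem diffD_edge (hs : s * s = 1) {q q' : ℤ} (hq : q' = q + 1 ∨ q' = q - 1) :
    diffD n s (edge n s q q') = bm (S n K q q' * S n K q' q) 1 ⊳ g0 K n q -
      bm 1 (S n K q q' * S n K q' q) ⊳ g0 K n q := by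
  rw [edge, map_add, map_act, map_act, diffD_g1 n s hq, diffD_g1 n s (by omega)]
  simp only [act_sub, act_act, bm_mul_bm, bm_smul_left, smul_mul_assoc,
    mul_smul_comm, one_mul, mul_one, smul_smul, hs, one_smul]
  abel

theorem diffD_comp_diffR (hs : s * s = 1) : diffD n s ∘ₗ diffR n s = 0 := by
  refine P_hom_ext fun A B _ => ?_
  rw [LinearMap.comp_apply, diffR_g0, map_act, map_sub, diffD_edge hs (Or.inl rfl),
    diffD_edge hs (Or.inr rfl), S_mul_S_comm, sub_self, act_zero, LinearMap.zero_apply]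

theorem aug_comp_diffD : aug n ∘ₗ diffD n (1 : K) = 0 := by
  refine Q_hom_ext fun A B _ => ?_
  rw [LinearMap.comp_apply, diffD_g1 n 1 (Or.inl rfl), map_sub, map_act, map_act, aug_g0, aug_g0,
    bm_act_lam, bm_act_lam, S_mul_E, mul_one, one_smul, one_mul, E_mul_S, sub_self,
    LinearMap.zero_apply]

theorem chi_sub_add (q : ℤ) (u d : ℕ) : chi n K (q + u - d) = (-1) ^ (u + d) * chi n K q := by
  induction d with
  | zero =>
    induction u with
    | zero => simp
    | succ u ih =>
      rw [show (q + (u + 1 : ℕ) - (0 : ℕ) : ℤ) = q + u - (0 : ℕ) + 1 by push_cast; ring,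
        chi_add_one, ih]
      ring
  | succ d ih =>
    have := chi_add_one n K (q + u - (d + 1 : ℕ))
    rw [show (q + u - (d + 1 : ℕ) + 1 : ℤ) = q + u - d by push_cast; ring, ih] at this
    rw [← add_assoc, pow_succ]
    linear_combination this

/-- A double telescoping sum over the rectangle. The boundary terms vanish because one of their two
paths leaves the strip. -/
theorem diffR_comp_diffK (hs : s * s = 1) : diffR n s ∘ₗ diffK n s = 0 := by
  refine P_hom_ext fun A B h => ?_
  rw [LinearMap.comp_apply, diffK_g0 hs h, map_act, casimir, LinearMap.zero_apply]
  -- The terms `a` and `c` belong to the step up and the step down out of the end of the path at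
  -- `(u, d)`. Besides these, the image of the term at `(u, d)` contains the steps back from `(u, d
  -- + 1)` and from `(u + 1, d)`.
  let a (u d : ℕ) : QQ n K := ((chi n K B * s ^ (u + d + 1)) •
    bm (W n K B u d) (W n K (B + u - d + 1) (A - u) (B + 1 - d))) ⊳
      g1 K n (B + u - d) (B + u - d + 1)
  let c (u d : ℕ) : QQ n K := ((chi n K B * s ^ (u + d + 1)) •
    bm (W n K B u d) (W n K (B + u - d - 1) (A + 1 - u) (B - d))) ⊳
      g1 K n (B + u - d) (B + u - d - 1)
  have key : ∀ u ∈ Finset.range (A + 1), ∀ d ∈ Finset.range (B + 1),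
      diffR n s (bm ((-s) ^ (u + d) • W n K B u d) (W n K (B + u - d) (A - u) (B - d)) ⊳
        g0 K n (B + u - d)) = (a u d - a u (d + 1)) - (c u d - c (u + 1) d) := by
    intro u hu d hd
    simp only [Finset.mem_range] at hu hd
    have hc : chi n K (B + u - d) * (-s) ^ (u + d) = chi n K B * s ^ (u + d) := by
      rw [chi_sub_add, ← neg_one_mul s, mul_pow]
      linear_combination s ^ (u + d) * chi n K B * sign_mul_self K (u + d)
    have hc' : s * chi n K (B + u - d) * (-s) ^ (u + d) = chi n K B * s ^ (u + d + 1) := by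
      rw [mul_assoc, hc, pow_succ]
      ring
    have e1 : s ^ (u + d + 1 + 1) = s ^ (u + d) := by
      rw [pow_succ, pow_succ, mul_assoc, hs, mul_one]
    have w1 : S n K (B + u - d + 1) (B + u - d) * W n K (B + u - d) (A - u) (B - d) =
        W n K (B + u - d + 1) (A - u) (B + 1 - d) := by
      have := S_down n K (B + u - d + 1)
      rw [add_sub_cancel_right] at this
      rw [this, W_mul_W' n K (by push_cast; ring)]
      congr 1 <;> omega
    have w2 : S n K (B + u - d - 1) (B + u - d) * W n K (B + u - d) (A - u) (B - d) =
        W n K (B + u - d - 1) (A + 1 - u) (B - d) := by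
      have := S_up n K (B + u - d - 1)
      rw [sub_add_cancel] at this
      rw [this, W_mul_W' n K (by push_cast; ring)]
      congr 1 <;> omega
    rw [map_act, diffR_g0, edge, edge]
    simp only [act_sub, act_add, act_act, bm_mul_bm, bm_smul_left, smul_mul_assoc,
      mul_smul_comm, one_mul, mul_one, smul_smul, W_mul_up, W_mul_down, w1, w2]
    simp only [a, c]
    rw [show A + 1 - (u + 1) = A - u by omega, show B + 1 - (d + 1) = B - d by omega,
      show (B + u - (d + 1 : ℕ) + 1 : ℤ) = B + u - d by push_cast; ring,
      show (B + u - (d + 1 : ℕ) : ℤ) = B + u - d - 1 by push_cast; ring,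
      show (B + (u + 1 : ℕ) - d - 1 : ℤ) = B + u - d by push_cast; ring,
      show (B + (u + 1 : ℕ) - d : ℤ) = B + u - d + 1 by push_cast; ring,
      show u + (d + 1) + 1 = u + d + 1 + 1 by ring, show u + 1 + d + 1 = u + d + 1 + 1 by ring, e1,
      hc, hc']
    abel
  simp only [map_sum]
  rw [Finset.sum_congr rfl fun u hu => Finset.sum_congr rfl (key u hu)]
  simp only [Finset.sum_sub_distrib]
  have ha : ∑ u ∈ Finset.range (A + 1), (∑ d ∈ Finset.range (B + 1), a u d -
      ∑ d ∈ Finset.range (B + 1), a u (d + 1)) = 0 := by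
    refine Finset.sum_eq_zero fun u hu => ?_
    simp only [Finset.mem_range] at hu
    rw [← Finset.sum_sub_distrib, Finset.sum_range_sub']
    simp only [a]
    rw [W_eq_zero_up n K (q := B + u - (0 : ℕ) + 1) (u := A - u) (B + 1 - 0) (by omega), W_eq_zero_down n K (q := B) (d := B + 1) u (by omega),
      bm_zero_left, bm_zero_right, smul_zero, smul_zero, zero_act, zero_act, sub_zero]
  have hc : ∑ d ∈ Finset.range (B + 1), (∑ u ∈ Finset.range (A + 1), c u d -
      ∑ u ∈ Finset.range (A + 1), c (u + 1) d) = 0 := by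
    refine Finset.sum_eq_zero fun d hd => ?_
    simp only [Finset.mem_range] at hd
    rw [← Finset.sum_sub_distrib, Finset.sum_range_sub' (fun u => c u d)]
    simp only [c]
    rw [W_eq_zero_down n K (q := B + (0 : ℕ) - d - 1) (d := B - d) (A + 1 - 0) (by omega),
      W_eq_zero_up n K (q := B) (u := A + 1) d (by omega),
      bm_zero_left, bm_zero_right, smul_zero, smul_zero, zero_act, zero_act, sub_zero]
  rw [Finset.sum_sub_distrib] at ha hc
  rw [ha, Finset.sum_comm, Finset.sum_comm (f := fun u d => c (u + 1) d), hc, sub_zero, act_zero]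

/-- Multiplying the rectangle sum at `B + 1` by the arrow from the left, and that at `B` by the
arrow from the right, gives the same terms, up to a row and a column of zeros. The step added on the
left shifts the length by one, which is why the next `δ` carries the opposite sign. -/
theorem diffK_comp_diffD (hs : s * s = 1) : diffK n s ∘ₗ diffD n (-s) = 0 := by
  refine Q_hom_ext fun A B h => ?_
  rw [LinearMap.comp_apply, diffD_g1 n _ (Or.inl rfl), map_sub, map_act, map_act,
    diffK_g0 hs (A := A + 1) (B := B) (by omega), LinearMap.zero_apply]
  have := diffK_g0 (K := K) hs (A := A) (B := B + 1) (by omega)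
  push_cast at this
  rw [this, casimir, casimir]
  -- The common terms, indexed by the rectangle with sides `A + 1` and `B + 1`. The two products
  -- cover `u ≥ 1` and `d ≤ B`; outside, `G 0 d` and `G (u + 1) (B + 1)` contain a path with too
  -- many steps down.
  let G (u d : ℕ) : PP n K := ((-s) ^ (u + d) •
    bm (W n K B u d) (W n K (B + u - d) (A + 1 - u) (B + 1 - d))) ⊳ g0 K n (B + u - d)
  have h1 : ∀ u d : ℕ, bm (S n K B (B + 1)) 1 ⊳ bm (s • (1 : Lam n K)) 1 ⊳
      bm ((-s) ^ (u + d) • W n K (B + 1) u d) (W n K (B + 1 + u - d) (A - u) (B + 1 - d)) ⊳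
        g0 K n (B + 1 + u - d) = -G (u + 1) d := by
    intro u d
    rw [S_up]
    simp only [G, act_act, bm_mul_bm, bm_smul_left, smul_mul_assoc, mul_smul_comm, one_mul,
      mul_one, smul_smul]
    rw [W_mul_W' n K (by push_cast; ring), show A + 1 - (u + 1) = A - u by omega,
      show (B + (u + 1 : ℕ) - d : ℤ) = B + 1 + u - d by push_cast; ring, add_right_comm u 1 d,
      pow_succ, mul_neg, neg_smul_act, neg_neg, add_comm 1 u, zero_add]
  have h2 : ∀ u ∈ Finset.range (A + 1 + 1), ∀ d ∈ Finset.range (B + 1),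
      bm (-s • (1 : Lam n K)) (S n K B (B + 1)) ⊳ bm (s • (1 : Lam n K)) 1 ⊳
      bm ((-s) ^ (u + d) • W n K B u d) (W n K (B + u - d) (A + 1 - u) (B - d)) ⊳
        g0 K n (B + u - d) = -G u d := by
    intro u hu d hd
    simp only [Finset.mem_range] at hu hd
    have hS : S n K B (B + 1) = W n K (A + 1) 0 1 := by
      rw [← S_down, ← S_reflect]
      congr 1 <;> omega
    rw [hS]
    simp only [G, act_act, bm_mul_bm, bm_smul_left, smul_mul_assoc, mul_smul_comm, one_mul,
      mul_one, smul_smul]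
    rw [W_mul_W' n K (by omega), show B - d + 1 = B + 1 - d by omega, mul_neg, mul_assoc, hs, mul_one,
      neg_smul_act, add_zero]
  simp only [act_sum]
  rw [Finset.sum_congr rfl fun u hu => Finset.sum_congr rfl (h2 u hu)]
  simp only [Nat.cast_add, Nat.cast_one, h1, Finset.sum_neg_distrib]
  rw [Finset.sum_range_succ' (fun u => ∑ d ∈ Finset.range (B + 1), G u d)]
  simp only [Finset.sum_range_succ _ (B + 1)]
  have h3 : ∀ u, G (u + 1) (B + 1) = 0 := by
    intro u
    simp only [G]
    rw [W_eq_zero_down n K (q := B) (u + 1) (by omega), bm_zero_left, smul_zero, zero_act]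
  have h4 : ∀ d ∈ Finset.range (B + 1), G 0 d = 0 := by
    intro d hd
    simp only [Finset.mem_range] at hd
    simp only [G]
    rw [W_eq_zero_down n K (q := B + (0 : ℕ) - d) (d := B + 1 - d) (A + 1 - 0) (by omega), bm_zero_right, smul_zero, zero_act]
  rw [Finset.sum_eq_zero h4]
  simp only [h3, add_zero]
  abel

end Complex

/-! ## Exactness -/

section Exactness

/-! ### Criteria for exactness. -/

section Generic

/-- Modulo the image of `f` an element of the kernel of `g` may be moved into `V`, where `g` is
injective. In each use `V` is spanned by a chosen set of left-hand paths with arbitrary right-hand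
factors. -/
theorem exists_eq_of_sup_eq_top {A B C : Type*} [AddCommGroup A] [AddCommGroup B] [AddCommGroup C]
    (f : A →+ B) (g : B →+ C) (hfg : ∀ a, g (f a) = 0) (V : AddSubgroup B)
    (hV : ∀ v, v ∈ f.range ⊔ V) (hg : ∀ v ∈ V, g v = 0 → v = 0) (b : B) (hb : g b = 0) :
    ∃ a, f a = b := by
  obtain ⟨_, ⟨a, rfl⟩, v, hv, rfl⟩ := AddSubgroup.mem_sup.1 (hV b)
  rw [map_add, hfg, zero_add] at hb
  exact ⟨a, by rw [hg v hv hb, add_zero]⟩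

variable {ι : Type*} [Fintype ι] {L M N : Type*} [AddCommGroup L] [AddCommGroup M] [AddCommGroup N]

/-- A sum of elements vanishes if its image vanishes and the images of the summands are in
triangular form with respect to some coordinates. -/
theorem sum_eq_zero_of_triangular (t : ι → M) (g : M →+ N) (c : ι → N →+ L) (l : ι → ℕ)
    (h : ∀ x x', x' ≠ x → l x' ≤ l x → c x (g (t x')) = 0)
    (h' : ∀ x, c x (g (t x)) = 0 → t x = 0) (hg : g (∑ x, t x) = 0) : ∑ x, t x = 0 := by
  classical
  by_contra hne
  -- A nonzero summand of maximal level is the only one seen by its own coordinate.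
  obtain ⟨x, hx, hmax⟩ := (Finset.univ.filter fun x => t x ≠ 0).exists_max_image l (by
    obtain ⟨x, _, hx⟩ := Finset.exists_ne_zero_of_sum_ne_zero hne
    exact ⟨x, by simpa using hx⟩)
  refine (Finset.mem_filter.1 hx).2 (h' x ?_)
  have := congrArg (c x) hg
  rw [map_sum, map_sum, map_zero, Finset.sum_eq_single x] at this
  · exact this
  · intro x' _ hx'
    by_cases h0 : t x' = 0
    · rw [h0, map_zero, map_zero]
    · exact h x x' hx' (hmax x' (by simpa using h0))
  · simp

/-- The elements `∑ x, T x (y x)`. -/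
def sumRange (T : ι → L →+ M) : AddSubgroup M :=
  (∑ x, (T x).comp (Pi.evalAddMonoidHom (fun _ => L) x)).range

theorem mem_sumRange {T : ι → L →+ M} {v : M} : v ∈ sumRange T ↔ ∃ y : ι → L, ∑ x, T x (y x) = v := by
  simp [sumRange]

theorem apply_mem_sumRange (T : ι → L →+ M) (x : ι) (y : L) : T x y ∈ sumRange T := by
  classical
  refine mem_sumRange.2 ⟨Pi.single x y, ?_⟩
  rw [Finset.sum_eq_single x, Pi.single_eq_same]
  · intro x' _ h
    rw [Pi.single_eq_of_ne h, map_zero]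
  · simp

end Generic

variable {n : ℕ} {K : Type u} [Field K] {s : K}

/-- The map `y ↦ (a ⊗ y) m`. -/
def bmHom {M : Type*} [AddCommGroup M] [Module (Env n K) M] (a : Lam n K) (m : M) :
    Lam n K →+ M where
  toFun y := bm a y ⊳ m
  map_zero' := by rw [bm_zero_right, zero_act]
  map_add' y y' := by rw [bm_add_right, add_act]

theorem bmHom_apply {M : Type*} [AddCommGroup M] [Module (Env n K) M] (a : Lam n K) (m : M)
    (y : Lam n K) : bmHom a m y = bm a y ⊳ m := rfl

section Coefficients

theorem leftCoef_W_g0_of_ne (x : PathIdx n) {q : ℤ} (hq : n ≤ q) (u d : ℕ) (b : Lam n K)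
    (h : ¬ (q = x.start ∧ u = x.up ∧ d = x.down)) :
    leftCoef K x (PrepL.comp x.tgt (bm (W n K q u d) b ⊳ g0 K n (q + u - d))) = 0 := by
  by_cases hu : q + u < 2 * n
  swap
  · rw [W_eq_zero_up n K d (by omega), bm_zero_left, zero_act, map_zero, map_zero]
  by_cases hd : d ≤ q
  swap
  · rw [W_eq_zero_down n K u (by omega), bm_zero_left, zero_act, map_zero, map_zero]
  have h1 := PathIdx.start_of hq hu hd
  have := leftCoef_g0 K x (PathIdx.of q u d hq hu hd) b (q + u - d)
    (by unfold PathIdx.pos; rw [h1]; rfl)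
  rw [path, h1] at this
  refine this.trans (if_neg ?_)
  rintro rfl
  exact h ⟨h1.symm, rfl, rfl⟩

theorem leftCoef_W_g1_of_ne (x : PathIdx n) (a : Arrow n) {q : ℤ} (hq : n ≤ q) (u d : ℕ)
    (q' : ℤ) (b : Lam n K)
    (h : ¬ (q = x.start ∧ u = x.up ∧ d = x.down ∧ fold n q' = tgt a)) :
    leftCoef K x (PrepL.comp a (bm (W n K q u d) b ⊳ g1 K n (q + u - d) q')) = 0 := by
  by_cases hu : q + u < 2 * n
  swap
  · rw [W_eq_zero_up n K d (by omega), bm_zero_left, zero_act, map_zero, map_zero]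
  by_cases hd : d ≤ q
  swap
  · rw [W_eq_zero_down n K u (by omega), bm_zero_left, zero_act, map_zero, map_zero]
  have h1 := PathIdx.start_of hq hu hd
  have := leftCoef_g1 K x (PathIdx.of q u d hq hu hd) b (q + u - d) q'
    (by unfold PathIdx.pos; rw [h1]; rfl) a
  rw [path, h1] at this
  refine this.trans (if_neg ?_)
  rintro ⟨rfl, h2, h3⟩
  exact h ⟨h1.symm, rfl, rfl, h3⟩

/-- The coordinate of a path in `P`. -/
def coordP (x : PathIdx n) : PP n K →+ Lam n K :=
  (leftCoef K x).toAddMonoidHom.comp (PrepL.comp (s := id) (t := id) x.tgt).toAddMonoidHom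

/-- The coordinate of a path and an arrow in `Q`. -/
def coordQ (x : PathIdx n) (a : Arrow n) : QQ n K →+ Lam n K :=
  (leftCoef K x).toAddMonoidHom.comp (PrepL.comp (s := src) (t := PrepL.tgt) a).toAddMonoidHom

end Coefficients

/-! ### Reduction modulo the image of `δ`, and exactness at the augmentation. -/

section TermZero

/-- The part `e_i ⊗ Λ` of `P`. -/
def leftTriv (i : Fin n) : Lam n K →+ PP n K := bmHom 1 (gP K i)

/-- Modulo the image of `δ` the last arrow of the left-hand path moves to the right-hand factor, up
to the sign `s`; this is repeated until the left-hand path is trivial. -/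
theorem W_act_g0_mem (q : ℤ) (hq : fold n q < n) (u d : ℕ) (y : Lam n K) :
    bm (W n K q u d) y ⊳ g0 K n (q + u - d) ∈
      (diffD n s).toAddMonoidHom.range ⊔ sumRange (leftTriv (n := n) (K := K)) := by
  induction d generalizing y with
  | zero =>
    induction u generalizing y with
    | zero =>
      refine AddSubgroup.mem_sup_right ?_
      rw [W_zero_zero, Nat.cast_zero, add_zero, sub_zero, bm_E_left_act_g0]
      rw [g0_eq K (i := ⟨_, hq⟩) rfl]
      exact apply_mem_sumRange _ _ _
    | succ u ih =>
      have h := diffD_g1 n s (q := q + u) (q' := q + u + 1) (Or.inl rfl)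
      have h' : bm (W n K q (u + 1) 0) y ⊳ g0 K n (q + u + 1) =
          diffD n s (bm (W n K q u 0) y ⊳ g1 K n (q + u) (q + u + 1)) +
            bm (W n K q u 0) (S n K (q + u) (q + u + 1) * (s • y)) ⊳ g0 K n (q + u) := by
        rw [map_act, h]
        simp only [act_sub, act_act, bm_mul_bm, mul_smul_comm, one_mul, mul_one, W_succ_zero,
          bm_smul_left, bm_smul_right]
        abel
      have := ih (S n K (q + u) (q + u + 1) * (s • y))
      rw [Nat.cast_zero, sub_zero] at this ⊢
      rw [show (q + (u + 1 : ℕ) : ℤ) = q + u + 1 by push_cast; ring, h']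
      exact add_mem (AddSubgroup.mem_sup_left ⟨_, rfl⟩) this
  | succ d ih =>
    have h := diffD_g1 n s (q := q + u - d) (q' := q + u - d - 1) (Or.inr rfl)
    have h' : bm (W n K q u (d + 1)) y ⊳ g0 K n (q + u - d - 1) =
        diffD n s (bm (W n K q u d) y ⊳ g1 K n (q + u - d) (q + u - d - 1)) +
          bm (W n K q u d) (S n K (q + u - d) (q + u - d - 1) * (s • y)) ⊳ g0 K n (q + u - d) := by
      rw [map_act, h]
      simp only [act_sub, act_act, bm_mul_bm, mul_smul_comm, one_mul, mul_one, W_mul_down,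
        bm_smul_left, bm_smul_right]
      abel
    rw [show (q + u - (d + 1 : ℕ) : ℤ) = q + u - d - 1 by push_cast; ring, h']
    exact add_mem (AddSubgroup.mem_sup_left ⟨_, rfl⟩) (ih _)

theorem mem_range_diffD_sup (v : PP n K) :
    v ∈ (diffD n s).toAddMonoidHom.range ⊔ sumRange (leftTriv (n := n) (K := K)) := by
  rw [P_eq_sum K v]
  exact sum_mem fun x _ => W_act_g0_mem _ (by rw [x.fold_start]; exact x.1.2) _ _ _

theorem leftTriv_eq_zero {i : Fin n} {y : Lam n K} (h : e n K i * y = 0) : leftTriv i y = 0 := by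
  have := bm_act_gen (s := id) (t := id) 1 y i
  rw [leftTriv, bmHom_apply, ← this, id, h, bm_zero_right, zero_act]

theorem aug_leftTriv (i : Fin n) (y : Lam n K) : aug n (leftTriv i y) = e n K i * y := by
  rw [leftTriv, bmHom_apply, map_act, ← g0_eq K (q := n + i.val) (fold_add n i), aug_g0, bm_act_lam,
    one_mul, e_eq_E]

theorem exact_aug_diffD (v : PP n K) (hv : aug n v = 0) : ∃ w, diffD n (1 : K) w = v := by
  refine exists_eq_of_sup_eq_top (diffD n (1 : K)).toAddMonoidHom (aug n).toAddMonoidHom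
    (fun a => LinearMap.congr_fun aug_comp_diffD a) (sumRange leftTriv) mem_range_diffD_sup ?_ v hv
  intro v hv h
  obtain ⟨y, rfl⟩ := mem_sumRange.1 hv
  refine Finset.sum_eq_zero fun i _ => leftTriv_eq_zero ?_
  have h' : ∑ i, e n K i * y i = 0 := by
    rw [← h, map_sum]
    exact Finset.sum_congr rfl fun i _ => (aug_leftTriv i (y i)).symm
  have := congrArg (e n K i * ·) h'
  simp only [mul_zero, Finset.mul_sum] at this
  rwa [Finset.sum_eq_single i, ← mul_assoc, e_mul_e] at this
  · intro j _ hj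
    rw [← mul_assoc, e_mul_e_of_ne n K hj.symm, zero_mul]
  · simp

theorem aug_surjective (y : Lam n K) : ∃ v, aug n v = y := by
  refine ⟨∑ i, leftTriv i y, ?_⟩
  rw [map_sum]
  simp only [aug_leftTriv, ← Finset.sum_mul, sum_e, one_mul]

end TermZero

end Exactness

/-! ### Longest paths: exactness at the source of `k`, and reduction modulo the image of `k`. -/

section Socle

variable {n : ℕ} {K : Type u} [Field K] {s : K}

/-- The path to the socle that starts at a vertex. -/
def topIdx (i : Fin n) : PathIdx n :=
  ⟨i, ⟨n - 1 - i, by have := i.2; omega⟩, ⟨n + i, by omega⟩⟩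

theorem pos_topIdx (i : Fin n) : (topIdx i).pos = 2 * n - 1 - (n + i.val) := by
  have := i.2
  simp only [PathIdx.pos, PathIdx.start, PathIdx.up, PathIdx.down, topIdx]
  omega

theorem coordP_bm (x y : PathIdx n) (b : Lam n K) :
    coordP x (bm (path K y) b ⊳ g0 K n y.pos) = if y = x then E n K y.pos * b else 0 :=
  leftCoef_g0 K x y b _ rfl

variable (s) in
/-- The sign of the term of a path in the image of a generator under `k`. -/
def kSign (x : PathIdx n) : K := s * (-s) ^ (x.up + x.down)

theorem kSign_mul_self (hs : s * s = 1) (x : PathIdx n) : kSign s x * kSign s x = 1 := by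
  rw [kSign, mul_mul_mul_comm, ← mul_pow, neg_mul_neg, hs, one_pow, one_mul]

/-- The path complementary to a path. -/
def coPath (K : Type u) [Field K] (x : PathIdx n) : Lam n K :=
  W n K x.pos (n - 1 - x.1 - x.up) (n + x.1 - x.down)

theorem coPath_topIdx (i : Fin n) : coPath K (topIdx i) = e n K i := by
  rw [coPath, pos_topIdx]
  simp only [topIdx, PathIdx.up, PathIdx.down, Nat.sub_self]
  rw [W_zero_zero, E_reflect, e_eq_E]

theorem bm_act_diffK_gP (hs : s * s = 1) (i : Fin n) (y : Lam n K) :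
    bm 1 y ⊳ diffK n s (gP K i) = ∑ p : Fin (n - i) × Fin (n + i + 1),
      bm (path K ⟨i, p⟩) (kSign s ⟨i, p⟩ • (coPath K ⟨i, p⟩ * y)) ⊳ g0 K n (PathIdx.pos ⟨i, p⟩) := by
  rw [diffK_gP hs, casimir, Fintype.sum_prod_type, show n - 1 - i.val + 1 = n - i by
    have := i.2; omega, Finset.sum_range, act_sum, act_sum]
  refine Finset.sum_congr rfl fun u _ => ?_
  rw [Finset.sum_range, act_sum, act_sum]
  refine Finset.sum_congr rfl fun d _ => ?_
  simp only [act_act, bm_mul_bm, bm_smul_left, bm_smul_right, smul_mul_assoc,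
    mul_smul_comm, one_mul, mul_one, smul_smul]
  rw [mul_comm]
  push_cast
  rfl

theorem diffK_sum_leftTriv (hs : s * s = 1) (y : Fin n → Lam n K) :
    diffK n s (∑ i, leftTriv i (y i)) = ∑ x : PathIdx n,
      bm (path K x) (kSign s x • (coPath K x * y x.1)) ⊳ g0 K n x.pos := by
  rw [map_sum, Fintype.sum_sigma]
  refine Finset.sum_congr rfl fun i _ => ?_
  rw [leftTriv, bmHom_apply, map_act, bm_act_diffK_gP hs]

/-- The path complementary to the longest path from `i` is `e_i`. So the coordinate of `k (e_i ⊗ y)`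
at the longest path is `e_i y` up to sign, and `k` is injective on the elements with trivial
left-hand path. -/
theorem exact_diffK_diffD (hs : s * s = 1) (v : PP n K) (hv : diffK n s v = 0) :
    ∃ w, diffD n (-s) w = v := by
  refine exists_eq_of_sup_eq_top (diffD n (-s)).toAddMonoidHom (diffK n s).toAddMonoidHom
    (fun a => LinearMap.congr_fun (diffK_comp_diffD hs) a) (sumRange leftTriv) mem_range_diffD_sup
    ?_ v hv
  intro v hv h
  obtain ⟨y, rfl⟩ := mem_sumRange.1 hv
  refine Finset.sum_eq_zero fun i _ => leftTriv_eq_zero ?_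
  have h' := congrArg (coordP (topIdx i)) ((diffK_sum_leftTriv hs y).symm.trans h)
  simp only [map_sum, map_zero, coordP_bm] at h'
  rw [Finset.sum_ite_eq' Finset.univ (topIdx i), if_pos (Finset.mem_univ _), coPath_topIdx,
    pos_topIdx, E_reflect, ← e_eq_E, mul_smul_comm, ← mul_assoc, e_mul_e] at h'
  have := congrArg (kSign s (topIdx i) • ·) h'
  simp only [smul_smul, kSign_mul_self hs, one_smul, smul_zero] at this
  exact this

/-- The part of `P` with left-hand factor a path, where the longest paths are omitted. -/
def leftNonTop (x : PathIdx n) : Lam n K →+ PP n K :=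
  if x = topIdx x.1 then 0 else bmHom (path K x) (g0 K n x.pos)

/-- The longest path occurs in `k (e_i ⊗ e_i)` with right-hand factor a sign times `e_i`, so
subtracting a multiple of this image eliminates it. -/
theorem mem_range_diffK_sup (hs : s * s = 1) (v : PP n K) :
    v ∈ (diffK n s).toAddMonoidHom.range ⊔ sumRange (leftNonTop (n := n) (K := K)) := by
  have h0 : ∀ (x : PathIdx n) (y : Lam n K), x ≠ topIdx x.1 → bm (path K x) y ⊳ g0 K n x.pos ∈
      sumRange (leftNonTop (n := n) (K := K)) := by
    intro x y hx
    have := apply_mem_sumRange (leftNonTop (n := n) (K := K)) x y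
    rwa [leftNonTop, if_neg hx] at this
  rw [P_eq_sum K v]
  refine sum_mem fun x _ => ?_
  generalize leftCoef K x (PrepL.comp x.tgt v) = y
  by_cases hx : x = topIdx x.1
  swap
  · exact AddSubgroup.mem_sup_right (h0 x y hx)
  obtain ⟨i, rfl⟩ : ∃ i, x = topIdx i := ⟨_, hx⟩
  have h := bm_act_diffK_gP hs i (kSign s (topIdx i) • y)
  let p₀ : Fin (n - i) × Fin (n + i + 1) := (topIdx i).2
  rw [← map_act, ← Finset.add_sum_erase _ _ (Finset.mem_univ p₀)] at h
  have e : (⟨i, p₀⟩ : PathIdx n) = topIdx i := rfl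
  rw [e, coPath_topIdx, mul_smul_comm, smul_smul, kSign_mul_self hs, one_smul, e_eq_E,
    ← E_reflect, ← pos_topIdx, bm_E_right_act_g0] at h
  rw [← sub_eq_iff_eq_add.2 h]
  refine sub_mem (AddSubgroup.mem_sup_left ⟨_, rfl⟩) (AddSubgroup.mem_sup_right
    (sum_mem fun p hp => h0 _ _ ?_))
  rintro h1
  have h2 : p = p₀ := eq_of_heq (Sigma.mk.inj_iff.1 h1).2
  simp [h2] at hp

end Socle

/-! ### Exactness at `Q` and at the source of `R`. -/

section MiddleTerms

variable {n : ℕ} {K : Type u} [Field K] {s : K}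

/-- The elements `W ⊗ y` in the summand of `Q` belonging to the step up after `W`. -/
def termUp (q : ℤ) (u d : ℕ) : Lam n K →+ QQ n K :=
  bmHom (W n K q u d) (g1 K n (q + u - d) (q + u - d + 1))

/-- The elements `W ⊗ y` in the summand of `Q` belonging to the step down after `W`. -/
def termDown (q : ℤ) (u d : ℕ) : Lam n K →+ QQ n K :=
  bmHom (W n K q u d) (g1 K n (q + u - d) (q + u - d - 1))

theorem termUp_eq_zero_down {q : ℤ} (u : ℕ) {d : ℕ} (h : q < d) (y : Lam n K) :
    termUp q u d y = 0 := by
  rw [termUp, bmHom_apply, W_eq_zero_down n K u h, bm_zero_left, zero_act]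

theorem termDown_eq_zero_up {q : ℤ} {u : ℕ} (d : ℕ) (h : 2 * n ≤ q + u) (y : Lam n K) :
    termDown q u d y = 0 := by
  rw [termDown, bmHom_apply, W_eq_zero_up n K d h, bm_zero_left, zero_act]

/-- The scalar `chi` cancels the one in `diffR_g0`. Two terms keep the left-hand path and multiply
`y` by a step; the other two lengthen the path and leave `y` unchanged, and these serve as leading
terms. -/
theorem diffR_W (q : ℤ) (u d : ℕ) (y : Lam n K) :
    diffR n s (bm (W n K q u d) (chi n K (q + u - d) • y) ⊳ g0 K n (q + u - d)) =
      termUp q u d (S n K (q + u - d + 1) (q + u - d) * (s • y)) + termDown q (u + 1) d y -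
      (termDown q u d (S n K (q + u - d - 1) (q + u - d) * (s • y)) + termUp q u (d + 1) y) := by
  have e1 : (q + (u + 1 : ℕ) - d : ℤ) = q + u - d + 1 := by push_cast; ring
  have e2 : (q + u - (d + 1 : ℕ) : ℤ) = q + u - d - 1 := by push_cast; ring
  rw [map_act, diffR_g0, edge, edge]
  simp only [termUp, termDown, bmHom_apply, e1, e2, add_sub_cancel_right, sub_add_cancel]
  simp only [act_sub, act_add, act_act, bm_mul_bm, bm_smul_left, bm_smul_right, smul_mul_assoc,
    mul_smul_comm, one_mul, mul_one, smul_smul, W_mul_up, W_mul_down, mul_assoc, chi_mul_self,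
    one_smul]

theorem coordQ_termUp_of_ne (x : PathIdx n) (a : Arrow n) {q : ℤ} (hq : n ≤ q) (u d : ℕ)
    (y : Lam n K)
    (h : ¬ (q = x.start ∧ u = x.up ∧ d = x.down ∧ fold n (q + u - d + 1) = tgt a)) :
    coordQ x a (termUp q u d y) = 0 :=
  leftCoef_W_g1_of_ne x a hq u d _ y h

theorem coordQ_termDown_of_ne (x : PathIdx n) (a : Arrow n) {q : ℤ} (hq : n ≤ q) (u d : ℕ)
    (y : Lam n K)
    (h : ¬ (q = x.start ∧ u = x.up ∧ d = x.down ∧ fold n (q + u - d - 1) = tgt a)) :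
    coordQ x a (termDown q u d y) = 0 :=
  leftCoef_W_g1_of_ne x a hq u d _ y h

theorem coordQ_termUp (x : PathIdx n) (a : Arrow n) (y : Lam n K) (h : fold n x.pos = src a)
    (h' : fold n (x.pos + 1) = tgt a) :
    coordQ x a (termUp x.start x.up x.down y) = sgn K (src a) (tgt a) • (E n K (x.pos + 1) * y) :=
  (leftCoef_g1 K x x y _ _ rfl a).trans (if_pos ⟨rfl, h, h'⟩)

theorem coordQ_termDown (x : PathIdx n) (a : Arrow n) (y : Lam n K) (h : fold n x.pos = src a)
    (h' : fold n (x.pos - 1) = tgt a) :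
    coordQ x a (termDown x.start x.up x.down y) = sgn K (src a) (tgt a) • (E n K (x.pos - 1) * y) :=
  (leftCoef_g1 K x x y _ _ rfl a).trans (if_pos ⟨rfl, h, h'⟩)

/-- The part of `Q` with one summand for each nontrivial path: a path is extended by the step
from its predecessor, which is obtained by removing a step down, if possible. -/
def leftTree (x : PathIdx n) : Lam n K →+ QQ n K :=
  if x.down = 0 then if x.up = 0 then 0 else termUp x.start (x.up - 1) 0
  else termDown x.start x.up (x.down - 1)

theorem coordP_W_of_ne (x : PathIdx n) {q : ℤ} (hq : n ≤ q) (u d : ℕ) (b : Lam n K)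
    (h : ¬ (q = x.start ∧ u = x.up ∧ d = x.down)) :
    coordP x (bm (W n K q u d) b ⊳ g0 K n (q + u - d)) = 0 :=
  leftCoef_W_g0_of_ne x hq u d b h

theorem diffD_termUp (q : ℤ) (u : ℕ) (y : Lam n K) : diffD n s (termUp q u 0 y) =
    bm (W n K q (u + 1) 0) y ⊳ g0 K n (q + (u + 1 : ℕ) - (0 : ℕ)) -
      bm (W n K q u 0) (S n K (q + u - (0 : ℕ)) (q + u - (0 : ℕ) + 1) * (s • y)) ⊳
        g0 K n (q + u - (0 : ℕ)) := by
  have e1 : (q + (u + 1 : ℕ) - (0 : ℕ) : ℤ) = q + u - (0 : ℕ) + 1 := by push_cast; ring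
  rw [termUp, bmHom_apply, map_act, diffD_g1 n s (Or.inl rfl), e1, ← W_mul_up]
  simp only [act_sub, act_act, bm_mul_bm, mul_smul_comm, one_mul, mul_one, bm_smul_left,
    bm_smul_right]

theorem diffD_termDown (q : ℤ) (u d : ℕ) (y : Lam n K) : diffD n s (termDown q u d y) =
    bm (W n K q u (d + 1)) y ⊳ g0 K n (q + u - (d + 1 : ℕ)) -
      bm (W n K q u d) (S n K (q + u - d) (q + u - d - 1) * (s • y)) ⊳ g0 K n (q + u - d) := by
  have e1 : (q + u - (d + 1 : ℕ) : ℤ) = q + u - d - 1 := by push_cast; ring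
  rw [termDown, bmHom_apply, map_act, diffD_g1 n s (Or.inr rfl), e1, ← W_mul_down]
  simp only [act_sub, act_act, bm_mul_bm, mul_smul_comm, one_mul, mul_one, bm_smul_left,
    bm_smul_right]

/-- The image under `δ` of the tree edge ending at `x'` involves `x'` and its predecessor, which is
shorter. So the images are triangular with respect to length. -/
theorem coordP_diffD_leftTree_of_ne {x x' : PathIdx n} (h : x' ≠ x)
    (hl : x'.up + x'.down ≤ x.up + x.down) (y : Lam n K) :
    coordP x (diffD n s (leftTree x' y)) = 0 := by
  have hne : ¬ (x'.start = x.start ∧ x'.up = x.up ∧ x'.down = x.down) := fun ⟨h1, h2, h3⟩ =>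
    h (PathIdx.ext' h1 h2 h3)
  unfold leftTree
  split_ifs with hd hu
  · rw [AddMonoidHom.zero_apply, map_zero, map_zero]
  · rw [diffD_termUp, map_sub, coordP_W_of_ne x x'.le_start, coordP_W_of_ne x x'.le_start, sub_zero]
    · omega
    · omega
  · rw [diffD_termDown, map_sub, coordP_W_of_ne x x'.le_start, coordP_W_of_ne x x'.le_start,
      sub_zero]
    · omega
    · omega

theorem leftTree_eq_zero {x : PathIdx n} {y : Lam n K} (h : E n K x.pos * y = 0) :
    leftTree x y = 0 := by
  have hp : x.pos = x.start + x.up - x.down := rfl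
  unfold leftTree
  split_ifs with hd hu
  · rfl
  · rw [termUp, bmHom_apply, ← bm_act_g1,
      show x.start + (x.up - 1 : ℕ) - (0 : ℕ) + 1 = x.pos by omega, h, bm_zero_right, zero_act]
  · rw [termDown, bmHom_apply, ← bm_act_g1,
      show x.start + x.up - (x.down - 1 : ℕ) - 1 = x.pos by omega, h, bm_zero_right, zero_act]

theorem coordP_diffD_leftTree {x : PathIdx n} {y : Lam n K}
    (h : coordP x (diffD n s (leftTree x y)) = 0) : leftTree x y = 0 := by
  by_cases h0 : x.up = 0 ∧ x.down = 0
  · rw [leftTree, if_pos h0.2, if_pos h0.1, AddMonoidHom.zero_apply]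
  refine leftTree_eq_zero ?_
  have own := coordP_bm x x y
  rw [if_pos rfl, path] at own
  have hp : x.pos = x.start + x.up - x.down := rfl
  unfold leftTree at h
  split_ifs at h with hd hu
  · exact absurd ⟨hu, hd⟩ h0
  · rw [diffD_termUp, map_sub, coordP_W_of_ne x x.le_start (x.up - 1), sub_zero] at h
    · rw [← own, ← h, hp, hd, Nat.sub_add_cancel (Nat.pos_of_ne_zero hu)]
    · omega
  · rw [diffD_termDown, map_sub, coordP_W_of_ne x x.le_start _ (x.down - 1), sub_zero] at h
    · rw [← own, ← h, hp, Nat.sub_add_cancel (Nat.pos_of_ne_zero hd)]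
    · omega

theorem leftTree_of_termDown {q : ℤ} {u d : ℕ} (hq : n ≤ q) (hu : q + u < 2 * n)
    (hd : (d + 1 : ℕ) ≤ q) :
    leftTree (PathIdx.of q u (d + 1) hq hu hd) = (termDown q u d : Lam n K →+ QQ n K) := by
  rw [leftTree, if_neg (by exact Nat.succ_ne_zero d), PathIdx.start_of]
  rfl

theorem leftTree_of_termUp {q : ℤ} {u : ℕ} (hq : n ≤ q) (hu : q + (u + 1 : ℕ) < 2 * n)
    (hd : (0 : ℕ) ≤ q) :
    leftTree (PathIdx.of q (u + 1) 0 hq hu hd) = (termUp q u 0 : Lam n K →+ QQ n K) := by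
  rw [leftTree, if_pos (by rfl), if_neg (by exact Nat.succ_ne_zero u), PathIdx.start_of]
  rfl

/-- By `diffR_W`, a step up after `(u, d + 1)` equals a step down after `(u + 1, d)` modulo the
image of `R` and shorter terms. Steps down, and steps up after no step down, are edges of the tree
inside the rectangle. -/
theorem term_mem {q : ℤ} (hq : n ≤ q) (N : ℕ) : ∀ u d, u + d = N → ∀ y : Lam n K,
    termDown q u d y ∈ (diffR n s).toAddMonoidHom.range ⊔ sumRange (leftTree (n := n) (K := K)) ∧
    termUp q u d y ∈ (diffR n s).toAddMonoidHom.range ⊔ sumRange (leftTree (n := n) (K := K)) := by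
  induction N using Nat.strong_induction_on with
  | _ N ih =>
  have hD : ∀ u d, u + d = N → ∀ y : Lam n K, termDown q u d y ∈
      (diffR n s).toAddMonoidHom.range ⊔ sumRange (leftTree (n := n) (K := K)) := by
    intro u d h y
    by_cases hu : q + u < 2 * n
    swap
    · rw [termDown_eq_zero_up d (by omega)]
      exact zero_mem _
    by_cases hd : (d + 1 : ℕ) ≤ q
    · rw [← leftTree_of_termDown hq hu hd]
      exact AddSubgroup.mem_sup_right (apply_mem_sumRange _ _ _)
    -- Here the step down leaves the rectangle. For `u = 0` it leaves the strip; otherwise the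
    -- partner of the term in `diffR_W` has a zero path, so the term reduces to shorter ones.
    cases u with
    | zero =>
      rw [termDown, bmHom_apply, g1_of_not_right K (by push_cast at *; omega), act_zero]
      exact zero_mem _
    | succ u =>
      have := diffR_W (s := s) q u d y
      rw [termUp_eq_zero_down u (d := d + 1) (by omega), add_zero, eq_sub_iff_add_eq, add_comm,
        ← sub_eq_iff_eq_add'] at this
      rw [← this]
      have h' := ih (u + d) (by omega) u d rfl
      exact sub_mem (add_mem (h' _).1 (AddSubgroup.mem_sup_left ⟨_, rfl⟩)) (h' _).2
  intro u d h y
  refine ⟨hD u d h y, ?_⟩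
  cases d with
  | zero =>
    by_cases hu : q + (u + 1 : ℕ) < 2 * n
    · rw [← leftTree_of_termUp hq hu (by push_cast; omega)]
      exact AddSubgroup.mem_sup_right (apply_mem_sumRange _ _ _)
    · rw [termUp, bmHom_apply, g1_of_not_right K (by push_cast at *; omega), act_zero]
      exact zero_mem _
  | succ d =>
    have := diffR_W (s := s) q u d y
    rw [← sub_sub, eq_sub_iff_add_eq, add_comm, ← eq_sub_iff_add_eq] at this
    rw [this]
    have h' := ih (u + d) (by omega) u d rfl
    exact sub_mem (sub_mem (add_mem (h' _).2 (hD _ _ (by omega) _)) (h' _).1)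
      (AddSubgroup.mem_sup_left ⟨_, rfl⟩)

theorem exact_diffD_diffR (hs : s * s = 1) (v : QQ n K) (hv : diffD n s v = 0) :
    ∃ w, diffR n s w = v := by
  refine exists_eq_of_sup_eq_top (diffR n s).toAddMonoidHom (diffD n s).toAddMonoidHom
    (fun a => LinearMap.congr_fun (diffD_comp_diffR hs) a) (sumRange leftTree) ?_ ?_ v hv
  · intro v
    obtain ⟨y, y', rfl⟩ := Q_eq_sum K v
    refine sum_mem fun x _ => ?_
    have := fun y => term_mem (K := K) (s := s) x.le_start _ x.up x.down rfl y
    exact add_mem (this _).2 (this _).1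
  · intro v hv h
    obtain ⟨y, rfl⟩ := mem_sumRange.1 hv
    exact sum_eq_zero_of_triangular _ (diffD n s).toAddMonoidHom coordP (fun x => x.up + x.down)
      (fun x x' hx hl => coordP_diffD_leftTree_of_ne hx hl _) (fun x => coordP_diffD_leftTree) h

theorem leftNonTop_eq_zero {x : PathIdx n} {y : Lam n K} (h : E n K x.pos * y = 0) :
    leftNonTop x y = 0 := by
  unfold leftNonTop
  split_ifs
  · rfl
  · rw [bmHom_apply, ← bm_E_right_act_g0, h, bm_zero_right, zero_act]

theorem diffR_leftNonTop {x : PathIdx n} (hx : x ≠ topIdx x.1) (y : Lam n K) :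
    diffR n s (leftNonTop x y) =
      termUp x.start x.up x.down (S n K (x.pos + 1) x.pos * (s • chi n K x.pos • y)) +
        termDown x.start (x.up + 1) x.down (chi n K x.pos • y) -
      (termDown x.start x.up x.down (S n K (x.pos - 1) x.pos * (s • chi n K x.pos • y)) +
        termUp x.start x.up (x.down + 1) (chi n K x.pos • y)) := by
  have := diffR_W (s := s) x.start x.up x.down (chi n K x.pos • y)
  rw [leftNonTop, if_neg hx]
  refine Eq.trans ?_ this
  change _ = diffR n s (bm _ (chi n K x.pos • chi n K x.pos • y) ⊳ _)
  rw [smul_smul, chi_mul_self, one_smul]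
  rfl

/-- The coordinate is taken at the path `x₁` obtained by extending `x` by one step, down if possible
and otherwise up, together with the arrow leading back to the end of `x`. Among paths that are not
longer than `x`, only `x` itself contributes there. -/
theorem exists_coord_leftNonTop (x : PathIdx n) : ∃ c : QQ n K →+ Lam n K,
    (∀ x', x' ≠ x → x'.up + x'.down ≤ x.up + x.down → ∀ y, c (diffR n s (leftNonTop x' y)) = 0) ∧
    ∀ y, c (diffR n s (leftNonTop x y)) = 0 → leftNonTop x y = 0 := by
  by_cases hx : x = topIdx x.1
  · refine ⟨0, fun _ _ _ _ => rfl, fun y _ => ?_⟩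
    rw [leftNonTop, if_pos hx, AddMonoidHom.zero_apply]
  have hp : x.pos = x.start + x.up - x.down := rfl
  have hb := x.pos_bounds
  have hu := x.up_lt
  have hd := x.down_le
  have hs := x.le_start
  have hz : ∀ x' : PathIdx n, x' = topIdx x'.1 → ∀ y : Lam n K, diffR n s (leftNonTop x' y) = 0 := by
    intro x' h y
    rw [leftNonTop, if_pos h, AddMonoidHom.zero_apply, map_zero]
  have hne : ∀ x', x' ≠ x → ¬ (x'.start = x.start ∧ x'.up = x.up ∧ x'.down = x.down) :=
    fun x' h ⟨h1, h2, h3⟩ => h (PathIdx.ext' h1 h2 h3)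
  have hchi : ∀ y : Lam n K, ∀ (c : K), c * c = 1 →
      c • (E n K x.pos * chi n K x.pos • y) = 0 → leftNonTop x y = 0 := by
    intro y c hc h
    refine leftNonTop_eq_zero ?_
    have := congrArg ((chi n K x.pos * c) • ·) h
    simp only [mul_smul_comm, smul_smul, smul_zero] at this
    rwa [show chi n K x.pos * c * (c * chi n K x.pos) = 1 by
      linear_combination c * c * chi_mul_self n K x.pos + hc, one_smul] at this
  by_cases hd' : (x.down + 1 : ℕ) ≤ x.start
  · set x₁ := PathIdx.of x.start x.up (x.down + 1) hs hu hd' with hx₁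
    have e0 : x₁.start = x.start := PathIdx.start_of _ _ _
    have e1 : x₁.up = x.up := rfl
    have e2 : x₁.down = x.down + 1 := rfl
    have ep : x₁.pos = x.pos - 1 := by
      unfold PathIdx.pos
      omega
    have hf := x₁.fold_pos_lt
    set a : Arrow n := ⟨_, hasArrow_fold hf x.fold_pos_lt (by omega)⟩ with ha
    have hsa : fold n x₁.pos = src a := rfl
    have hta : fold n x.pos = tgt a := rfl
    -- The other predecessor of `x₁` contributes at `x₁` with the opposite step, which has a
    -- different end by `fold_succ_ne`.
    have hf2 : fold n (x.pos - 1 - 1) ≠ tgt a := by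
      have := fold_succ_ne (n := n) (q := x.pos - 1)
      rw [sub_add_cancel] at this
      exact this.symm
    refine ⟨coordQ x₁ a, fun x' hx' hl y => ?_, fun y h => ?_⟩
    · by_cases ht : x' = topIdx x'.1
      · rw [hz x' ht, map_zero]
      have := hne x' hx'
      rw [diffR_leftNonTop ht, map_sub, map_add, map_add, coordQ_termUp_of_ne _ _ x'.le_start,
        coordQ_termDown_of_ne _ _ x'.le_start, coordQ_termDown_of_ne _ _ x'.le_start,
        coordQ_termUp_of_ne _ _ x'.le_start, add_zero, sub_zero]
      · omega
      · omega
      · rintro ⟨h1, h2, h3, h4⟩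
        refine hf2 ?_
        rw [← h4]
        congr 1
        omega
      · omega
    · rw [diffR_leftNonTop hx, map_sub, map_add, map_add, coordQ_termUp_of_ne _ _ x.le_start,
        coordQ_termDown_of_ne _ _ x.le_start, coordQ_termDown_of_ne _ _ x.le_start, add_zero,
        zero_add, zero_sub, neg_eq_zero] at h
      · have own := coordQ_termUp x₁ a (chi n K x.pos • y) hsa (by rw [ep, sub_add_cancel]; exact hta)
        rw [e0, e1, e2, h, ep, sub_add_cancel] at own
        exact hchi y _ (sgn_mul_self K _ _) own.symm
      · omega
      · omega
      · omega
  -- A path that can be extended neither down nor up is the longest one, which is excluded.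
  · have hu' : x.start + (x.up + 1 : ℕ) < 2 * n := by
      by_contra h
      refine hx (PathIdx.ext' rfl ?_ ?_)
      · have : x.start = n + x.1.val := rfl
        simp only [topIdx, PathIdx.up] at *
        omega
      · have : x.start = n + x.1.val := rfl
        simp only [topIdx, PathIdx.down] at *
        omega
    set x₁ := PathIdx.of x.start (x.up + 1) x.down hs hu' hd with hx₁
    have e0 : x₁.start = x.start := PathIdx.start_of _ _ _
    have e1 : x₁.up = x.up + 1 := rfl
    have e2 : x₁.down = x.down := rfl
    have ep : x₁.pos = x.pos + 1 := by
      unfold PathIdx.pos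
      omega
    have hf := x₁.fold_pos_lt
    set a : Arrow n := ⟨_, hasArrow_fold hf x.fold_pos_lt (by omega)⟩ with ha
    have hsa : fold n x₁.pos = src a := rfl
    have hta : fold n x.pos = tgt a := rfl
    have hf2 : fold n (x.pos + 1 + 1) ≠ tgt a := by
      have := fold_succ_ne (n := n) (q := x.pos + 1)
      rw [add_sub_cancel_right] at this
      exact this
    refine ⟨coordQ x₁ a, fun x' hx' hl y => ?_, fun y h => ?_⟩
    · by_cases ht : x' = topIdx x'.1
      · rw [hz x' ht, map_zero]
      have := hne x' hx'
      rw [diffR_leftNonTop ht, map_sub, map_add, map_add, coordQ_termUp_of_ne _ _ x'.le_start,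
        coordQ_termDown_of_ne _ _ x'.le_start, coordQ_termDown_of_ne _ _ x'.le_start,
        coordQ_termUp_of_ne _ _ x'.le_start, add_zero, sub_zero]
      · rintro ⟨h1, h2, h3, h4⟩
        refine hf2 ?_
        rw [← h4]
        congr 1
        omega
      · omega
      · omega
      · omega
    · rw [diffR_leftNonTop hx, map_sub, map_add, map_add, coordQ_termUp_of_ne _ _ x.le_start,
        coordQ_termDown_of_ne _ _ x.le_start x.up, coordQ_termUp_of_ne _ _ x.le_start, add_zero,
        zero_add, sub_zero] at h
      · have own := coordQ_termDown x₁ a (chi n K x.pos • y) hsa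
          (by rw [ep, add_sub_cancel_right]; exact hta)
        rw [e0, e1, e2, h, ep, add_sub_cancel_right] at own
        exact hchi y _ (sgn_mul_self K _ _) own.symm
      · omega
      · omega
      · omega

theorem exact_diffR_diffK (hs : s * s = 1) (v : PP n K) (hv : diffR n s v = 0) :
    ∃ w, diffK n s w = v := by
  refine exists_eq_of_sup_eq_top (diffK n s).toAddMonoidHom (diffR n s).toAddMonoidHom
    (fun a => LinearMap.congr_fun (diffR_comp_diffK hs) a) (sumRange leftNonTop)
    (mem_range_diffK_sup hs) ?_ v hv
  intro v hv h
  obtain ⟨y, rfl⟩ := mem_sumRange.1 hv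
  choose c hc hc' using exists_coord_leftNonTop (n := n) (K := K) (s := s)
  exact sum_eq_zero_of_triangular _ (diffR n s).toAddMonoidHom c (fun x => x.up + x.down)
    (fun x x' hx hl => hc x x' hx hl _) (fun x => hc' x _) h

end MiddleTerms

/-! ## The projective resolution -/

section Resolution

variable {n : ℕ} {K : Type u} [Field K]

open ModuleCat

theorem id_comp_eq_comp_id {C : Type*} [Category C] {X Y : C} {f g : X ⟶ Y} (h : f = g) :
    𝟙 X ≫ f = g ≫ 𝟙 Y := by rw [h, Category.id_comp, Category.comp_id]

instance projective_projBimod {ι : Type} [Fintype ι] (s t : ι → Fin n) :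
    Module.Projective (Env n K) (ProjBimod K s t) := by
  classical
  let r (x : ι) : Env n K →ₗ[Env n K] indec n K (s x) (t x) :=
    LinearMap.toSpanSingleton (Env n K) _ ⟨_, Submodule.mem_span_singleton_self _⟩
  refine Module.Projective.of_split
    (LinearMap.pi fun x => (indec n K (s x) (t x)).subtype ∘ₗ LinearMap.proj x :
      ProjBimod K s t →ₗ[Env n K] (ι → Env n K))
    (LinearMap.pi fun x => r x ∘ₗ LinearMap.proj x) ?_
  refine LinearMap.ext fun v => funext fun x => ?_
  exact Subtype.ext (coe_mul_bm_e _ _ (v x))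

/-- Three consecutive degrees suffice for every sign `s`, since the sequence then repeats with `-s`;
the last of them pairs `k` for `s` with `δ` for `-s`. -/
theorem resDSign_comp_and_exact {s : K} (hs : s * s = 1) (i : ℕ) :
    (resDSign n K s (i + 1) ≫ resDSign n K s i = 0) ∧
    ∀ v, (resDSign n K s i).hom v = 0 → ∃ w, (resDSign n K s (i + 1)).hom w = v := by
  induction i using Nat.strong_induction_on generalizing s with
  | _ i ih =>
  match i with
  | 0 =>
    refine ⟨?_, exact_diffD_diffR hs⟩
    exact congrArg ModuleCat.ofHom (diffD_comp_diffR hs)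
  | 1 =>
    refine ⟨?_, exact_diffR_diffK hs⟩
    exact congrArg ModuleCat.ofHom (diffR_comp_diffK hs)
  | 2 =>
    refine ⟨?_, exact_diffK_diffD hs⟩
    exact congrArg ModuleCat.ofHom (diffK_comp_diffD hs)
  | i + 3 => exact ih i (by omega) (s := -s) (by rw [neg_mul_neg, hs])

theorem resD_comp (i : ℕ) : resD n K (i + 1) ≫ resD n K i = 0 :=
  (resDSign_comp_and_exact (one_mul 1) i).1

theorem resD_exact (i : ℕ) : (ShortComplex.mk _ _ (resD_comp (n := n) (K := K) i)).Exact :=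
  (ShortComplex.moduleCat_exact_iff _).2 (resDSign_comp_and_exact (one_mul 1) i).2

theorem resD_comp_resAug : resD n K 0 ≫ resAug n K = 0 :=
  congrArg ModuleCat.ofHom aug_comp_diffD

theorem resAug_exact : (ShortComplex.mk _ _ (resD_comp_resAug (n := n) (K := K))).Exact :=
  (ShortComplex.moduleCat_exact_iff _).2 exact_aug_diffD

instance : Epi (resAug n K) := (ModuleCat.epi_iff_surjective _).2 aug_surjective

instance projective_resObj (i : ℕ) : Projective (resObj n K i) := by
  induction i using Nat.strong_induction_on with
  | _ i ih =>
  match i with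
  | 0 => exact (IsProjective.iff_projective (R := Env n K) (P n K)).1 inferInstance
  | 1 => exact (IsProjective.iff_projective (R := Env n K) (Q n K)).1 inferInstance
  | 2 => exact (IsProjective.iff_projective (R := Env n K) (P n K)).1 inferInstance
  | i + 3 => exact ih i (by omega)

variable (n K)

/-- The chain complex of the explicit projective resolution. -/
def resComplex : ChainComplex (ModuleCat.{u} (Env n K)) ℕ :=
  ChainComplex.of (resObj n K) (resD n K) resD_comp

theorem resComplex_d (i : ℕ) : (resComplex n K).d (i + 1) i = resD n K i :=
  ChainComplex.of_d _ _ _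

theorem resComplex_exactAt_succ (i : ℕ) : (resComplex n K).ExactAt (i + 1) := by
  rw [HomologicalComplex.exactAt_iff' _ (i + 1 + 1) (i + 1) i (by simp) (by simp)]
  refine (ShortComplex.exact_iff_of_iso ?_).2 (resD_exact i)
  exact ShortComplex.isoMk (Iso.refl _) (Iso.refl _) (Iso.refl _)
    (id_comp_eq_comp_id (resComplex_d n K (i + 1)).symm) (id_comp_eq_comp_id (resComplex_d n K i).symm)

/-- The augmentation as a morphism of complexes. -/
def resπ : resComplex n K ⟶ (ChainComplex.single₀ _).obj (bimod n K) :=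
  (ChainComplex.toSingle₀Equiv _ _).symm ⟨resAug n K, by
    rw [resComplex_d]; exact resD_comp_resAug⟩

theorem resπ_f_zero : (resπ n K).f 0 = resAug n K :=
  ChainComplex.toSingle₀Equiv_symm_apply_f_zero _ _

/-- The explicit sequence as a projective resolution. -/
def res : ProjectiveResolution (bimod n K) where
  complex := resComplex n K
  projective i := projective_resObj i
  π := resπ n K
  quasiIso := ⟨fun i => by
    cases i
    · rw [ChainComplex.quasiIsoAt₀_iff, ShortComplex.quasiIso_iff_of_zeros']
      · refine (ShortComplex.exact_and_epi_g_iff_of_iso ?_).2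
          ⟨resAug_exact, by dsimp; infer_instance⟩
        exact ShortComplex.isoMk (Iso.refl _) (Iso.refl _) (Iso.refl _)
          (id_comp_eq_comp_id (resComplex_d n K 0).symm)
          (id_comp_eq_comp_id (resπ_f_zero n K).symm)
      all_goals rfl
    · rw [quasiIsoAt_iff_exactAt']
      · apply resComplex_exactAt_succ
      · apply ChainComplex.exactAt_succ_single_obj⟩

theorem exists_presentation :
    ∃ R : ProjectiveResolution (bimod n K), Nonempty (Presentation R) :=
  ⟨res n K, ⟨{
    iso := fun i => Iso.refl _
    comm := fun i => by
      exact id_comp_eq_comp_id (resComplex_d n K i).symm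
    aug := by
      refine (Category.id_comp _).trans ?_
      refine (resπ_f_zero n K).symm.trans ?_
      exact (Category.comp_id _).symm }⟩⟩

end Resolution

/-! ## Yoneda products in terms of a projective resolution -/

section YonedaProduct

open CochainComplex HomComplex Abelian Limits

variable {C : Type*} [Category C] [Abelian C] {X Y : C} (R : ProjectiveResolution X)

/-- Lifting a morphism from a truncated projective resolution. -/
theorem exists_lift_of_truncation (f₀ : R.complex.X 2 ⟶ R.complex.X 0)
    (f₁ : R.complex.X 3 ⟶ R.complex.X 1)
    (h : f₁ ≫ R.complex.d 1 0 = R.complex.d 3 2 ≫ f₀) :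
    ∃ ψ : ∀ m, R.complex.X (m + 2) ⟶ R.complex.X m, ψ 0 = f₀ ∧ ψ 1 = f₁ ∧
      ∀ m, ψ (m + 1) ≫ R.complex.d (m + 1) m = R.complex.d (m + 3) (m + 2) ≫ ψ m := by
  let T : ChainComplex C ℕ := ChainComplex.truncate.obj (ChainComplex.truncate.obj R.complex)
  -- The twice truncated resolution still has projective terms and the target is exact in positive
  -- degrees, so the first two components extend inductively to a chain map.
  let φ : T ⟶ R.complex := ChainComplex.mkHom T R.complex f₀ f₁ h fun m p => by
    have hp : (T.d (m + 2) (m + 1) ≫ p.2.1) ≫ R.complex.d (m + 1) m = 0 := by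
      rw [Category.assoc, p.2.2, HomologicalComplex.d_comp_d_assoc, zero_comp]
    have : Projective (T.X (m + 2)) := R.projective (m + 4)
    exact ⟨(R.exact_succ m).liftFromProjective _ hp,
      (R.exact_succ m).liftFromProjective_comp _ hp⟩
  exact ⟨φ.f, ChainComplex.mkHom_f_0 _ _ _ _ _ _, ChainComplex.mkHom_f_1 _ _ _ _ _ _,
    fun m => φ.comm (m + 1) m⟩

variable {R} (ψ : ∀ m, R.complex.X (m + 2) ⟶ R.complex.X m)

/-- The cochain given by a family of morphisms of degree two. -/
def degTwoCochain : Cochain R.cochainComplex R.cochainComplex 2 :=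
  Cochain.mk fun p q hpq => if h : q ≤ 0 then
    (R.cochainComplexXIso p ((-q).toNat + 2) (by push_cast; omega)).hom ≫ ψ (-q).toNat ≫
      (R.cochainComplexXIso q (-q).toNat (by omega)).inv
  else 0

theorem degTwoCochain_v {p q : ℤ} (hpq : p + 2 = q) (m : ℕ) (hm : -(m : ℤ) = q) :
    (degTwoCochain ψ).v p q hpq = (R.cochainComplexXIso p (m + 2) (by push_cast; omega)).hom ≫
      ψ m ≫ (R.cochainComplexXIso q m hm).inv := by
  obtain rfl : m = (-q).toNat := by omega
  exact dif_pos (by omega)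

/-- The degree two is even, so the cocycle condition is commutation with the differentials without a
sign. -/
theorem δ_degTwoCochain
    (hψ : ∀ m, ψ (m + 1) ≫ R.complex.d (m + 1) m = R.complex.d (m + 3) (m + 2) ≫ ψ m) : δ 2 3 (degTwoCochain ψ) = 0 := by
  ext p q hpq
  by_cases hq : q ≤ 0
  swap
  · exact (CochainComplex.isZero_of_isStrictlyLE R.cochainComplex 0 q (by omega)).eq_of_tgt _ _
  obtain ⟨m, hm⟩ : ∃ m : ℕ, -(m : ℤ) = q := ⟨(-q).toNat, by omega⟩
  rw [δ_v 2 3 rfl _ p q hpq (q - 1) (p + 1) rfl rfl,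
    degTwoCochain_v ψ _ m hm, degTwoCochain_v ψ _ (m + 1) (by push_cast; omega),
    R.cochainComplex_d (q - 1) q (m + 1) m (by push_cast; omega) hm,
    R.cochainComplex_d p (p + 1) (m + 3) (m + 2) (by push_cast; omega) (by push_cast; omega)]
  simp only [Category.assoc, Iso.inv_hom_id_assoc, reassoc_of% hψ m, Cochain.zero_v]
  have : Int.negOnePow 3 = -1 := by decide
  rw [this, Units.neg_smul, one_smul, add_neg_cancel]

variable (hψ : ∀ m, ψ (m + 1) ≫ R.complex.d (m + 1) m = R.complex.d (m + 3) (m + 2) ≫ ψ m)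

/-- The cocycle given by a morphism of degree two. -/
def degTwoCocycle : Cocycle R.cochainComplex R.cochainComplex 2 :=
  Cocycle.mk (degTwoCochain ψ) 3 rfl (δ_degTwoCochain ψ hψ)

/-- The augmentation of a projective resolution. -/
def augOf (R : ProjectiveResolution X) : R.complex.X 0 ⟶ X :=
  R.π.f 0 ≫ (HomologicalComplex.singleObjXSelf (ComplexShape.down ℕ) 0 X).hom

theorem π'_f_zero_eq : R.π'.f 0 = (R.cochainComplexXIso 0 0 rfl).hom ≫ augOf R ≫
    (HomologicalComplex.singleObjXSelf (ComplexShape.up ℤ) 0 X).inv := by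
  have : augOf R = R.π.f 0 := Category.comp_id _
  rw [this]
  exact R.π'_f_zero

/-- Factors the class of `f` through the endomorphism `ψ` of the resolution. A cochain into a
complex concentrated in degree zero has one relevant component, here `ψ 0` followed by the
augmentation. -/
theorem toSingleMk_eq_postcomp (f : R.complex.X 2 ⟶ X) (hf : ψ 0 ≫ augOf R = f)
    (hd : R.cochainComplex.d (-3 : ℤ) (-2) ≫ (R.cochainComplexXIso (-2) 2 rfl).hom ≫ f = 0) :
    Cocycle.toSingleMk ((R.cochainComplexXIso (-2) 2 rfl).hom ≫ f) (n := 2) (q := 0) (by simp) (-3)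
      (by omega) hd = (degTwoCocycle ψ hψ).postcomp R.π' := by
  ext : 1
  refine (Cochain.toSingleEquiv (show (-2 : ℤ) + 2 = 0 by simp)).injective ?_
  subst hf
  simp [Cochain.toSingleEquiv, degTwoCocycle, degTwoCochain_v ψ _ 0, π'_f_zero_eq]
  refine congrArg (· ≫ _) ?_
  have key {A B D E F : C} (a : A ⟶ B) (b : B ⟶ D) (i : E ≅ D) (c : D ⟶ F) :
      a ≫ b ≫ c = (a ≫ b ≫ i.inv) ≫ i.hom ≫ c := by simp
  exact key _ _ _ _

/-- The target is concentrated in one degree, so only the component `ψ 1` meets `y`; the shift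
identifications introduce no sign. -/
theorem equivHomShift_comp_toSingleMk (y : R.complex.X 1 ⟶ Y)
    (hy : R.cochainComplex.d (-2 : ℤ) (-1) ≫ (R.cochainComplexXIso (-1) 1 rfl).hom ≫ y = 0)
    (hd : R.cochainComplex.d (-4 : ℤ) (-3) ≫ (R.cochainComplexXIso (-3) 3 rfl).hom ≫ ψ 1 ≫ y = 0) :
    ShiftedHom.comp (Cocycle.equivHomShift.symm (degTwoCocycle ψ hψ))
      (Cocycle.equivHomShift.symm (Cocycle.toSingleMk ((R.cochainComplexXIso (-1) 1 rfl).hom ≫ y)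
        (n := 1) (q := 0) (by simp) (-2) (by omega) hy)) (show (1 : ℤ) + 2 = 3 by norm_num) =
      Cocycle.equivHomShift.symm (Cocycle.toSingleMk
        ((R.cochainComplexXIso (-3) 3 rfl).hom ≫ ψ 1 ≫ y) (n := 3) (q := 0) (by simp) (-4)
        (by omega) hd) := by
  refine Cocycle.equivHomShift.injective ?_
  rw [AddEquiv.apply_symm_apply]
  ext : 1
  refine (Cochain.toSingleEquiv (show (-3 : ℤ) + 3 = 0 by simp)).injective ?_
  simp [Cocycle.equivHomShift_apply, Cocycle.equivHomShift_symm_apply, Cochain.toSingleEquiv, ShiftedHom.comp, Cochain.rightUnshift_v _ _ _ _ _ _ _ (add_zero (-3 : ℤ)), CochainComplex.shiftFunctorAdd'_inv_app_f']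
  rw [Cochain.rightShift_v _ _ _ _ (-3) (-3) _ (-1) (by simp),
    Cochain.rightShift_v _ _ _ _ (-1) (-1) _ 0 (by simp), Cochain.toSingleMk_v]
  change ((((degTwoCochain ψ).v (-3) (-1) _) ≫ _) ≫ _) ≫ _ = _
  rw [degTwoCochain_v ψ _ 1 (by simp)]
  simp
  refine congrArg (· ≫ _) ?_
  have key {A B D E F : C} (a : A ⟶ B) (b : B ⟶ D) (i : E ≅ D) (c : D ⟶ F) :
      a ≫ b ≫ i.inv ≫ ((i.hom ≫ c) ≫ 𝟙 F) ≫ 𝟙 F = a ≫ b ≫ c := by simp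
  exact key _ _ _ _

/-- In the derived category an object is replaced by its resolution at both ends of the first class
and at the beginning of the second; the inner replacements `π`, `b`, `α` cancel. -/
theorem shiftedHom_comp_cancel {D : Type*} [Category D] [HasShift D ℤ] {A L S Z B : D}
    (φ : ShiftedHom L L (2 : ℤ)) (η : ShiftedHom L Z (1 : ℤ)) (α : A ⟶ L) (π : L ⟶ S) (b : S ⟶ A)
    (c : Z ⟶ B) (hb : π ≫ b ≫ α = 𝟙 L) :
    ((ShiftedHom.mk₀ (0 : ℤ) rfl α).comp ((φ.comp (ShiftedHom.mk₀ (0 : ℤ) rfl π) (zero_add 2)).comp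
      (ShiftedHom.mk₀ (0 : ℤ) rfl b) (zero_add 2)) (add_zero 2)).comp
      ((ShiftedHom.mk₀ (0 : ℤ) rfl α).comp (η.comp (ShiftedHom.mk₀ (0 : ℤ) rfl c) (zero_add 1))
        (add_zero 1)) (show (1 : ℤ) + 2 = 3 by norm_num) =
    (ShiftedHom.mk₀ (0 : ℤ) rfl α).comp ((φ.comp η (show (1 : ℤ) + 2 = 3 by norm_num)).comp
      (ShiftedHom.mk₀ (0 : ℤ) rfl c) (zero_add 3)) (add_zero 3) := by
  have hb' := congrArg (fun f => f⟦(2 : ℤ)⟧') hb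
  simp only [Functor.map_comp] at hb'
  rw [ShiftedHom.mk₀_comp 0 rfl, ShiftedHom.mk₀_comp 0 rfl, ShiftedHom.mk₀_comp 0 rfl,
    ShiftedHom.comp_mk₀ _ 0 rfl, ShiftedHom.comp_mk₀ _ 0 rfl, ShiftedHom.comp_mk₀ _ 0 rfl,
    ShiftedHom.comp_mk₀ _ 0 rfl]
  simp only [ShiftedHom.comp, Functor.map_comp, Category.assoc]
  rw [reassoc_of% hb']
  have := (shiftFunctorAdd' D (1 : ℤ) 2 3 (by norm_num)).inv.naturality c
  dsimp at this
  rw [this, CategoryTheory.Functor.map_id, Category.id_comp]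

theorem cochainComplex_d_comp {m k : ℕ} {p q : ℤ} {f : R.complex.X k ⟶ Y}
    (h : R.complex.d m k ≫ f = 0) (hm : -(m : ℤ) = p) (hk : -(k : ℤ) = q) :
    R.cochainComplex.d p q ≫ (R.cochainComplexXIso q k hk).hom ≫ f = 0 := by
  rw [R.cochainComplex_d _ _ m k hm hk, Category.assoc, Category.assoc, Iso.inv_hom_id_assoc, h,
    comp_zero]

/-- The classical recipe for a Yoneda product: lift the first cocycle to the resolution and compose
the lift with the second. Only two components of the lift have to be given. -/
theorem extMk_comp_extMk [HasExt C] (f₀ : R.complex.X 2 ⟶ R.complex.X 0)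
    (f₁ : R.complex.X 3 ⟶ R.complex.X 1)
    (h : f₁ ≫ R.complex.d 1 0 = R.complex.d 3 2 ≫ f₀) (f : R.complex.X 2 ⟶ X)
    (hf : f₀ ≫ augOf R = f) (hd : R.complex.d 3 2 ≫ f = 0) (y : R.complex.X 1 ⟶ Y)
    (hy : R.complex.d 2 1 ≫ y = 0) (hd' : R.complex.d 4 3 ≫ f₁ ≫ y = 0) :
    (R.extMk f 3 rfl hd).comp (R.extMk y 2 rfl hy) (show 2 + 1 = 3 from rfl) =
      R.extMk (f₁ ≫ y) 4 rfl hd' := by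
  obtain ⟨ψ, rfl, rfl, hψ⟩ := exists_lift_of_truncation R f₀ f₁ h
  have := HasDerivedCategory.standard C
  ext
  have h1 := toSingleMk_eq_postcomp ψ hψ f hf (cochainComplex_d_comp hd rfl rfl)
  have h2 := equivHomShift_comp_toSingleMk ψ hψ y (cochainComplex_d_comp hy rfl rfl)
    (cochainComplex_d_comp hd' rfl rfl)
  have h3 := congrArg (fun g => ShiftedHom.map g DerivedCategory.Q) h2
  have h4 := congrArg (fun z => ShiftedHom.map (Cocycle.equivHomShift.symm z) DerivedCategory.Q) h1
  simp only [ShiftedHom.map_comp] at h3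
  simp only [Cocycle.equivHomShift_symm_postcomp] at h4
  rw [← ShiftedHom.comp_mk₀ _ 0 rfl, ShiftedHom.map_comp, ShiftedHom.map_mk₀] at h4
  have h5 := shiftedHom_comp_cancel
    (ShiftedHom.map (Cocycle.equivHomShift.symm (degTwoCocycle ψ hψ)) DerivedCategory.Q)
    (ShiftedHom.map (Cocycle.equivHomShift.symm (Cocycle.toSingleMk
      ((R.cochainComplexXIso (-1) 1 rfl).hom ≫ y) (n := 1) (q := 0) (by simp) (-2) (by omega)
        (cochainComplex_d_comp hy rfl rfl))) DerivedCategory.Q)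
    ((DerivedCategory.singleFunctorIsoCompQ C 0).hom.app X ≫ inv (DerivedCategory.Q.map R.π'))
    (DerivedCategory.Q.map R.π') ((DerivedCategory.singleFunctorIsoCompQ C 0).inv.app X)
    ((DerivedCategory.singleFunctorIsoCompQ C 0).inv.app Y) (by simp)
  rw [h3, ← h4] at h5
  rw [Ext.comp_hom, R.extMk_hom, R.extMk_hom, R.extMk_hom]
  exact h5

end YonedaProduct

/-! ## Hochschild cochains -/

section Cochains

variable {n : ℕ} {K : Type u} [Field K] {s : K}

instance : SMulCommClass (Env n K) K (Lam n K) := IsScalarTower.to_smulCommClass'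

/-- The values of the character of a vertex on generators. -/
def vtxCharGen (K : Type u) [Field K] (i : Fin n) : Gen n → K
  | .vtx j => if j = i then 1 else 0
  | .arr _ => 0

/-- The character of the algebra that belongs to a vertex. -/
def vtxChar (K : Type u) [Field K] (i : Fin n) : Lam n K →ₐ[K] K :=
  RingQuot.liftAlgHom K ⟨FreeAlgebra.lift K (vtxCharGen K i), fun x y h => by
    induction h with
    | idem j => simp [vtxCharGen]
    | orth j k h =>
      simp only [map_mul, FreeAlgebra.lift_ι_apply, vtxCharGen, map_zero]
      split_ifs with h1 h2
      · exact absurd (h1.trans h2.symm) h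
      all_goals simp
    | one => simp [vtxCharGen]
    | left a => simp [vtxCharGen]
    | right a => simp [vtxCharGen]
    | preproj j => simp [vtxCharGen]⟩

theorem vtxChar_mk (i : Fin n) (x : FreeAlgebra K (Gen n)) :
    vtxChar K i (mk n K x) = FreeAlgebra.lift K (vtxCharGen K i) x :=
  RingQuot.liftAlgHom_mkAlgHom_apply _ _ _ _

theorem vtxChar_e (i : Fin n) : vtxChar K i (e n K i) = 1 := by
  rw [e, vtxChar_mk, FreeAlgebra.lift_ι_apply]
  exact if_pos rfl

theorem vtxChar_e_of_ne {i j : Fin n} (h : j ≠ i) : vtxChar K i (e n K j) = 0 := by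
  rw [e, vtxChar_mk, FreeAlgebra.lift_ι_apply]
  exact if_neg h

theorem vtxChar_arrow (i : Fin n) (a : Arrow n) : vtxChar K i (arrow n K a) = 0 := by
  rw [arrow, vtxChar_mk, FreeAlgebra.lift_ι_apply]
  rfl

theorem vtxChar_S (i : Fin n) (q q' : ℤ) : vtxChar K i (S n K q q') = 0 := by
  unfold S step
  split_ifs
  · rw [map_smul, vtxChar_arrow, smul_zero]
  · rw [smul_zero, map_zero]

theorem vtxChar_W (i : Fin n) (q : ℤ) {u d : ℕ} (h : u + d ≠ 0) : vtxChar K i (W n K q u d) = 0 := by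
  cases d with
  | zero =>
    cases u with
    | zero => exact absurd rfl h
    | succ u => rw [W_succ_zero, map_mul, vtxChar_S, mul_zero]
  | succ d => rw [← W_mul_down, map_mul, vtxChar_S, mul_zero]

/-- A linear map on closed paths is determined by its values on paths. -/
theorem map_closed_mem {M : Type*} [AddCommGroup M] [Module K M] (φ : Lam n K →ₗ[K] M)
    (N : Submodule K M) (i : Fin n)
    (h : ∀ u d : ℕ, u + d ≠ 0 → n + i.val + u < 2 * n → d ≤ n + i.val →
      fold n (n + i.val + u - d) = i → φ (W n K (n + i.val) u d) ∈ N)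
    (x : Lam n K) (hx : e n K i * x * e n K i = x) (h0 : vtxChar K i x = 0) : φ x ∈ N := by
  -- Projecting to `e_i Λ e_i` and removing the part along `e_i` makes the claim linear in `x` and
  -- free of hypotheses on `x`, so it may be checked on paths.
  have key : φ (e n K i * x * e n K i) - vtxChar K i x • φ (e n K i) ∈ N := by
    clear hx h0
    have hx : x ∈ Submodule.span K (Set.range (path K : PathIdx n → Lam n K)) :=
      span_path K trivial
    induction hx using Submodule.span_induction with
    | zero => simp
    | add x y _ _ hx hy =>
      have := N.add_mem hx hy
      rw [mul_add, add_mul, map_add, map_add, add_smul]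
      rwa [show φ (e n K i * x * e n K i) + φ (e n K i * y * e n K i) -
        (vtxChar K i x • φ (e n K i) + vtxChar K i y • φ (e n K i)) =
        φ (e n K i * x * e n K i) - vtxChar K i x • φ (e n K i) +
        (φ (e n K i * y * e n K i) - vtxChar K i y • φ (e n K i)) by abel]
    | smul c x _ hx =>
      have := N.smul_mem c hx
      rwa [mul_smul_comm, smul_mul_assoc, map_smul, map_smul, smul_assoc, ← smul_sub]
    | mem x hx =>
      obtain ⟨y, rfl⟩ := hx
      have hs : e n K y.1 * path K y = path K y := by
        rw [e_eq_E]
        exact E_mul_W n K _ _ _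
      by_cases hi : i = y.1
      · subst hi
        by_cases h0 : y.up + y.down = 0
        · have : path K y = e n K y.1 := by
            rw [path, show y.up = 0 by omega, show y.down = 0 by omega, W_zero_zero, e_eq_E]
            rfl
          rw [this, e_mul_e, e_mul_e, vtxChar_e, one_smul, sub_self]
          exact N.zero_mem
        · rw [show vtxChar K y.1 (path K y) = 0 from vtxChar_W _ _ h0, hs, zero_smul, sub_zero,
            path, W_mul_e]
          split_ifs with h'
          · exact h _ _ h0 (by have := y.up_lt; simp only [PathIdx.start] at this; omega) (by have := y.down_le; simp only [PathIdx.start] at this; omega) h'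
          · rw [map_zero]
            exact N.zero_mem
      · have h1 : vtxChar K i (path K y) = 0 := by
          rw [← hs, map_mul, vtxChar_e_of_ne (Ne.symm hi), zero_mul]
        rw [h1, ← hs, ← mul_assoc, e_mul_e_of_ne n K hi, zero_mul, zero_mul, map_zero, zero_smul,
          sub_zero]
        exact N.zero_mem
  rwa [hx, h0, zero_smul, sub_zero] at key

theorem diffR_gP (i : Fin n) : diffR n s (gP K i) = ∑ a : Arrow n with src a = i,
    ((s • bm 1 (arrow n K (bar a))) ⊳ gQ K a + bm (arrow n K a) 1 ⊳ gQ K (bar a)) := by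
  have h : diffR n s (gP K i) = bm (e n K i) (e n K i) ⊳ ∑ a : Arrow n with src a = i,
      ((s • bm 1 (arrow n K (bar a))) ⊳ gQ K a + bm (arrow n K a) 1 ⊳ gQ K (bar a)) :=
    lift_gen (s := id) (t := id) (M := QQ n K) (fun i => ∑ a : Arrow n with src a = i,
      ((s • bm 1 (arrow n K (bar a))) ⊳ gQ K a + bm (arrow n K a) 1 ⊳ gQ K (bar a))) i
  rw [h, act_sum]
  refine Finset.sum_congr rfl fun a ha => ?_
  obtain rfl : src a = i := (Finset.mem_filter.1 ha).2
  have h1 : bm (s • e n K (src a)) (arrow n K (bar a)) ⊳ gQ K a =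
      bm (s • 1) (arrow n K (bar a)) ⊳ gQ K a := by
    have := bm_act_gen (K := K) (s := src) (t := tgt) (s • 1) (arrow n K (bar a)) a
    rwa [show e n K (tgt a) * arrow n K (bar a) = _ from e_src_mul_arrow n K (bar a),
      smul_mul_assoc, one_mul] at this
  have h2 : bm (arrow n K a) (e n K (src a)) ⊳ gQ K (bar a) =
      bm (arrow n K a) 1 ⊳ gQ K (bar a) := by
    have := bm_act_gen (K := K) (s := src) (t := tgt) (arrow n K a) 1 (bar a)
    rwa [show arrow n K a * e n K (src (bar a)) = _ from arrow_mul_e_tgt n K a, mul_one] at this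
  rw [act_add, act_act, act_act, mul_smul_comm, bm_mul_bm, bm_mul_bm, e_src_mul_arrow, mul_one,
    one_mul, show arrow n K (bar a) * e n K (src a) = _ from arrow_mul_e_tgt n K (bar a),
    ← bm_smul_left, ← bm_smul_left, h1, h2]

theorem map_diffR_gP (g : QQ n K →ₗ[Env n K] Lam n K) (i : Fin n) :
    g (diffR n 1 (gP K i)) = ∑ a : Arrow n with src a = i,
      (g (gQ K a) * arrow n K (bar a) + arrow n K a * g (gQ K (bar a))) := by
  rw [diffR_gP, map_sum]
  refine Finset.sum_congr rfl fun a _ => ?_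
  rw [map_add, map_act, map_act, one_smul, bm_act_lam, bm_act_lam, one_mul, mul_one]

/-- Every term of such a coboundary contains an arrow. Hence the classes `z_k` are independent. -/
theorem vtxChar_map_diffR (g : QQ n K →ₗ[Env n K] Lam n K) (i j : Fin n) :
    vtxChar K j (g (diffR n 1 (gP K i))) = 0 := by
  rw [map_diffR_gP, map_sum]
  refine Finset.sum_eq_zero fun a _ => ?_
  rw [map_add, map_mul, map_mul, vtxChar_arrow, vtxChar_arrow, mul_zero, zero_mul, add_zero]

/-- The values at the generators of the coboundaries given by `R`. -/
def cobR (n : ℕ) (K : Type u) [Field K] : Submodule K (Fin n → Lam n K) where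
  carrier := {v | ∃ g : QQ n K →ₗ[Env n K] Lam n K, ∀ i, g (diffR n 1 (gP K i)) = v i}
  zero_mem' := ⟨0, fun _ => rfl⟩
  add_mem' := by
    rintro v w ⟨g, hg⟩ ⟨f, hf⟩
    exact ⟨g + f, fun i => by rw [LinearMap.add_apply, hg, hf, Pi.add_apply]⟩
  smul_mem' := by
    rintro c v ⟨g, hg⟩
    exact ⟨c • g, fun i => by rw [LinearMap.smul_apply, hg, Pi.smul_apply]⟩

/-- The coboundary of the cochain with value `x` at `a` and zero at the other arrows. -/
theorem single_add_single_mem_cobR (a : Arrow n) (x : Lam n K)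
    (hx : e n K (src a) * x * e n K (tgt a) = x) :
    Pi.single (src a) (x * arrow n K (bar a)) + Pi.single (tgt a) (arrow n K (bar a) * x) ∈
      cobR n K := by
  let g : QQ n K →ₗ[Env n K] Lam n K := lift K src tgt (Pi.single a x)
  refine ⟨g, fun i => ?_⟩
  have hg : ∀ b, g (gQ K b) = if b = a then x else 0 := by
    intro b
    refine (lift_gen _ b).trans ?_
    rw [bm_act_lam]
    split_ifs with h
    · rw [h, Pi.single_eq_same, hx]
    · rw [Pi.single_eq_of_ne h, mul_zero, zero_mul]
  rw [map_diffR_gP]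
  simp only [hg]
  rw [Finset.sum_add_distrib, Pi.add_apply, Pi.single_apply, Pi.single_apply]
  congr 1
  · simp only [ite_mul, zero_mul, Finset.sum_ite_eq', Finset.mem_filter, Finset.mem_univ, true_and]
    exact if_congr eq_comm rfl rfl
  · have : ∀ b : Arrow n, bar b = a ↔ b = bar a := fun b =>
      ⟨fun h => by rw [← h]; rfl, fun h => by rw [h]; rfl⟩
    simp only [this, mul_ite, mul_zero, Finset.sum_ite_eq', Finset.mem_filter, Finset.mem_univ,
      true_and]
    change (if tgt a = i then _ else _) = _
    exact if_congr eq_comm rfl rfl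

end Cochains

/-! ## Coboundaries and cocycles -/

section Cocycles

variable {n : ℕ} {K : Type u} [Field K]

theorem e_mul_W (i : Fin n) (u d : ℕ) : e n K i * W n K (n + i.val) u d = W n K (n + i.val) u d := by
  rw [e_eq_E]
  exact E_mul_W n K _ _ _

theorem S_mul_W_up (q : ℤ) (u d : ℕ) :
    S n K q (q + 1) * W n K (q + 1) u d = W n K q (u + 1) d := by
  rw [S_up, W_mul_W' n K (by push_cast; ring), zero_add, add_comm]

theorem S_mul_W_down (q : ℤ) (u d : ℕ) :
    S n K q (q - 1) * W n K (q - 1) u d = W n K q u (d + 1) := by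
  rw [S_down, W_mul_W' n K (by push_cast; ring), zero_add, add_comm]

theorem W_mul_S_up {q q' : ℤ} {u d : ℕ} (h : q + u - d = q') :
    W n K q u d * S n K q' (q' + 1) = W n K q (u + 1) d := by
  rw [← h, W_mul_up]

theorem W_mul_S_down {q q' : ℤ} {u d : ℕ} (h : q + u - d = q') :
    W n K q u d * S n K q' (q' - 1) = W n K q u (d + 1) := by
  rw [← h, W_mul_down]

theorem fold_eq_zero_iff {u d : ℕ} : fold n (n + u - d) = 0 ↔ u = d ∨ d = u + 1 := by
  unfold fold
  split_ifs <;> omega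

theorem W_mul_loop {u d : ℕ} (h : fold n (n + u - d) = 0) : W n K n u d * step n K 0 0 =
    if u = d then W n K n u (d + 1) else W n K n (u + 1) d := by
  rcases fold_eq_zero_iff.1 h with rfl | rfl
  · rw [if_pos rfl, step_loop, W_mul_S_down (by ring)]
  · rw [if_neg (by omega), step_loop']
    have := W_mul_S_up (n := n) (K := K) (q := n) (u := u) (d := u + 1) (q' := n - 1)
      (by push_cast; ring)
    rwa [sub_add_cancel] at this

/-- On either side the loop adds one step; the reflection shows that it is the same step, up if `d =
u + 1` and down if `u = d`. -/
theorem loop_mul_W_comm {u d : ℕ} (h : fold n (n + u - d) = 0) :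
    step n K 0 0 * W n K n u d = W n K n u d * step n K 0 0 := by
  have hn : (2 * n - 1 - n : ℤ) = n - 1 := by ring
  have hn' : (2 * n - 1 - (n - 1) : ℤ) = n := by ring
  rw [W_mul_loop h]
  rcases fold_eq_zero_iff.1 h with rfl | rfl
  · have := S_mul_W_up (n := n) (K := K) (n - 1) u u
    rw [if_pos rfl]
    rwa [sub_add_cancel, ← step_loop', ← W_reflect n K (n - 1), hn'] at this
  · rw [if_neg (by omega), step_loop, ← W_reflect, hn, S_mul_W_down]

/-- A nontrivial closed path at `j + 1` can be written with its last arrow coming from `j`. The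
coboundary of the rest, placed on the opposite arrow, is this path plus the rotated path at `j`, so
induction leads to the first vertex. -/
theorem single_closed_mem_cobR (h2 : (2 : K) ≠ 0) (j : ℕ) (hj : j < n) (u d : ℕ) (h0 : u + d ≠ 0)
    (hu : n + j + u < 2 * n) (hd : d ≤ n + j) (h : fold n (n + j + u - d) = j) :
    Pi.single ⟨j, hj⟩ (W n K (n + j) u d) ∈ cobR n K := by
  induction j generalizing u d with
  | zero =>
    let a : Arrow n := ⟨(⟨0, hj⟩, ⟨0, hj⟩), Or.inl ⟨rfl, rfl⟩⟩
    have ha : arrow n K a = step n K 0 0 := by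
      rw [show step n K 0 0 = step n K (⟨0, hj⟩ : Fin n) (⟨0, hj⟩ : Fin n) from rfl, step_coe,
        dif_pos a.2]
    have key : ∀ x, e n K ⟨0, hj⟩ * x * e n K ⟨0, hj⟩ = x →
        x * step n K 0 0 = W n K n u d → step n K 0 0 * x = W n K n u d →
        Pi.single ⟨0, hj⟩ (W n K n u d) ∈ cobR n K := by
      intro x hx h3 h4
      have := single_add_single_mem_cobR a x hx
      rw [show bar a = a from rfl, ha, h3, h4, show tgt a = src a from rfl, ← two_smul K] at this
      -- The loop is its own opposite and commutes with closed paths, so its coboundary is twice the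
      -- path.
      have := (cobR n K).smul_mem (2 : K)⁻¹ this
      rwa [smul_smul, inv_mul_cancel₀ h2, one_smul] at this
    have hW : ∀ u d : ℕ, fold n (n + u - d) = 0 →
        e n K ⟨0, hj⟩ * W n K n u d * e n K ⟨0, hj⟩ = W n K n u d := by
      intro u d h
      have := e_mul_W (K := K) ⟨0, hj⟩ u d
      simp only [Nat.cast_zero, add_zero] at this
      rw [this, W_mul_e, if_pos h]
    simp only [Nat.cast_zero, add_zero] at h ⊢
    rcases fold_eq_zero_iff.1 h with rfl | rfl
    · obtain ⟨v, rfl⟩ : ∃ v, u = v + 1 := ⟨u - 1, by omega⟩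
      have hv := fold_eq_zero_iff (n := n).2 (Or.inr rfl : v = v + 1 ∨ v + 1 = v + 1)
      have hm := W_mul_loop (K := K) hv
      rw [if_neg (by omega)] at hm
      exact key (W n K n v (v + 1)) (hW _ _ hv) hm ((loop_mul_W_comm hv).trans hm)
    · have hv := fold_eq_zero_iff (n := n).2 (Or.inl rfl : u = u ∨ u = u + 1)
      have hm := W_mul_loop (K := K) hv
      rw [if_pos rfl] at hm
      exact key (W n K n u u) (hW _ _ hv) hm ((loop_mul_W_comm hv).trans hm)
  | succ j ih =>
    let a : Arrow n := ⟨(⟨j + 1, hj⟩, ⟨j, by omega⟩), Or.inr (Or.inr rfl)⟩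
    have ha : arrow n K (bar a) = S n K (n + j) (n + j + 1) := by
      rw [← step_up, show step n K j (j + 1) =
        step n K (⟨j, by omega⟩ : Fin n) (⟨j + 1, hj⟩ : Fin n) from rfl, step_coe,
        dif_pos (show HasArrow n (_, _) from Or.inr (Or.inl rfl))]
      rfl
    have key : ∀ u' d' v f : ℕ, fold n (n + (j + 1 : ℕ) + u' - d') = j →
        W n K (n + (j + 1 : ℕ)) u' d' * S n K (n + j) (n + j + 1) = W n K (n + (j + 1 : ℕ)) u d →
        S n K (n + j) (n + j + 1) * W n K (n + (j + 1 : ℕ)) u' d' = W n K (n + j) v f →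
        v + f ≠ 0 → n + j + v < 2 * n → fold n (n + j + v - f) = j →
        Pi.single ⟨j + 1, hj⟩ (W n K (n + (j + 1 : ℕ)) u d) ∈ cobR n K := by
      intro u' d' v f h1 h3 h4 h5 h6 h7
      have := single_add_single_mem_cobR a (W n K (n + (j + 1 : ℕ)) u' d') (by
        have := e_mul_W (K := K) ⟨j + 1, hj⟩ u' d'
        simp only at this
        rw [show src a = ⟨j + 1, hj⟩ from rfl, this, W_mul_e]
        exact if_pos h1)
      rw [ha, h3, h4] at this
      refine (Submodule.add_mem_iff_left _ ?_).1 this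
      by_cases h8 : f ≤ n + j
      · exact ih _ v f h5 h6 h8 h7
      · rw [W_eq_zero_down n K (q := n + j) (d := f) v (by omega), Pi.single_zero]
        exact (cobR n K).zero_mem
    -- A closed path ends at its starting position `n + j + 1` or at the reflected one.
    have hud : u = d ∨ d = u + 2 * j + 3 := by
      unfold fold at h
      split_ifs at h <;> omega
    rcases hud with rfl | rfl
    · obtain ⟨v, rfl⟩ : ∃ v, u = v + 1 := ⟨u - 1, by omega⟩
      refine key v (v + 1) (v + 1) (v + 1) ?_ ?_ ?_ (by omega) (by omega) ?_
      · rw [show (n + (j + 1 : ℕ) + v - (v + 1 : ℕ) : ℤ) = n + j by push_cast; ring, fold_add]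
      · rw [W_mul_S_up (by push_cast; ring)]
      · rw [show (n + (j + 1 : ℕ) : ℤ) = n + j + 1 by push_cast; ring, S_mul_W_up]
      · rw [add_sub_cancel_right, fold_add]
    · have hr := S_reflect n K (n + j) (n + j + 1)
      rw [show (2 * n - 1 - (n + j + 1) : ℤ) = 2 * n - 1 - (n + j) - 1 by ring] at hr
      refine key u (u + 2 * j + 2) (u + 1) (u + 2 * j + 2) ?_ ?_ ?_ (by omega) (by omega) ?_
      · rw [show (n + (j + 1 : ℕ) + u - (u + 2 * j + 2 : ℕ) : ℤ) = 2 * n - 1 - (n + j) by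
          push_cast; ring, fold_reflect, fold_add]
      · rw [← hr, W_mul_S_down (by push_cast; ring)]
      · rw [show (n + (j + 1 : ℕ) : ℤ) = n + j + 1 by push_cast; ring, S_mul_W_up]
      · rw [show (n + j + (u + 1 : ℕ) - (u + 2 * j + 2 : ℕ) : ℤ) = 2 * n - 1 - (n + j) by
          push_cast; ring, fold_reflect, fold_add]

theorem mem_cobR (h2 : (2 : K) ≠ 0) (v : Fin n → Lam n K)
    (hv : ∀ i, e n K i * v i * e n K i = v i) (h : ∀ i, vtxChar K i (v i) = 0) : v ∈ cobR n K := by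
  rw [← Finset.univ_sum_single v]
  refine Submodule.sum_mem _ fun i _ => ?_
  exact map_closed_mem (LinearMap.single K (fun _ => Lam n K) i) (cobR n K) i
    (fun u d h0 hu hd h => single_closed_mem_cobR h2 i i.2 u d h0 hu hd h) (v i) (hv i) (h i)

end Cocycles

/-! ## Liftings and products -/

section Liftings

variable (n : ℕ) (K : Type u) [Field K]

/-- The cocycle that sends each generator to its arrow. -/
def yHom : QQ n K →ₗ[Env n K] Lam n K := lift K src tgt fun a => arrow n K a

variable {n K}

theorem yHom_gQ (a : Arrow n) : yHom n K (gQ K a) = arrow n K a := by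
  have : yHom n K (gQ K a) = bm (e n K (src a)) (e n K (tgt a)) ⊳ arrow n K a := lift_gen _ a
  rw [this, bm_act_lam, e_src_mul_arrow, arrow_mul_e_tgt]

theorem yHom_g1 {q q' : ℤ} (hq : q' = q + 1 ∨ q' = q - 1) :
    yHom n K (g1 K n q q') = S n K q q' := by
  by_cases h : 0 ≤ q ∧ q < 2 * n
  swap
  · rw [g1_of_not_left K h, S_eq_zero_left n K h, map_zero]
  by_cases h' : 0 ≤ q' ∧ q' < 2 * n
  swap
  · rw [g1_of_not_right K h', S_eq_zero_right n K h', map_zero]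
  rw [← fold_lt_iff] at h h'
  set a : Arrow n := ⟨_, hasArrow_fold h h' hq⟩ with ha
  rw [g1_eq K (a := a) rfl rfl, S_eq_smul_arrow K (a := a) rfl rfl, map_act, yHom_gQ, bm_act_lam,
    smul_mul_assoc, smul_mul_assoc, one_mul, mul_one]

/-- `T` is the sum of `x' ⊗ x'' y` over all factorizations of the path as `x'`, a step, `x''`. Its
boundary telescopes, and `ỹ` maps each of the `u + d` terms to the whole path times `y`. -/
theorem exists_diffD_eq (q : ℤ) (u d : ℕ) (y : Lam n K) : ∃ T : QQ n K,
    diffD n 1 T = bm (W n K q u d) y ⊳ g0 K n (q + u - d) - bm 1 (W n K q u d * y) ⊳ g0 K n q ∧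
      yHom n K T = ((u + d : ℕ) : K) • (W n K q u d * y) := by
  induction d generalizing y with
  | zero =>
    induction u generalizing y with
    | zero =>
      refine ⟨0, ?_, ?_⟩
      · rw [W_zero_zero, Nat.cast_zero, add_zero, sub_zero, bm_E_left_act_g0, bm_E_right_act_g0,
          sub_self, map_zero]
      · rw [map_zero, Nat.cast_zero, zero_smul]
    | succ u ih =>
      obtain ⟨T, h, hy⟩ := ih (S n K (q + u) (q + u + 1) * y)
      have h1 := diffD_g1 n (1 : K) (q := q + u) (q' := q + u + 1) (Or.inl rfl)
      refine ⟨bm (W n K q u 0) y ⊳ g1 K n (q + u) (q + u + 1) + T, ?_, ?_⟩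
      · rw [map_add, map_act, h1, h]
        simp only [act_sub, act_act, bm_mul_bm, one_smul, mul_one, one_mul, W_succ_zero, mul_assoc,
          Nat.cast_zero, sub_zero]
        rw [show (q + (u + 1 : ℕ) : ℤ) = q + u + 1 by push_cast; ring]
        abel
      · rw [map_add, map_act, yHom_g1 (Or.inl rfl), bm_act_lam, hy, W_succ_zero, ← mul_assoc,
          show ((u + 1 + 0 : ℕ) : K) = (1 : K) + (u + 0 : ℕ) by push_cast; ring, add_smul, one_smul]
  | succ d ih =>
    obtain ⟨T, h, hy⟩ := ih (S n K (q + u - d) (q + u - d - 1) * y)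
    have h1 := diffD_g1 n (1 : K) (q := q + u - d) (q' := q + u - d - 1) (Or.inr rfl)
    refine ⟨bm (W n K q u d) y ⊳ g1 K n (q + u - d) (q + u - d - 1) + T, ?_, ?_⟩
    · rw [map_add, map_act, h1, h]
      simp only [act_sub, act_act, bm_mul_bm, one_smul, mul_one, one_mul, W_mul_down, ← mul_assoc]
      rw [show (q + u - (d + 1 : ℕ) : ℤ) = q + u - d - 1 by push_cast; ring]
      abel
    · rw [map_add, map_act, yHom_g1 (Or.inr rfl), bm_act_lam, hy, ← mul_assoc, W_mul_down,
        show ((u + (d + 1) : ℕ) : K) = (1 : K) + (u + d : ℕ) by push_cast; ring, add_smul, one_smul]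

theorem diffK_gP_eq_sum (i : Fin n) : diffK n 1 (gP K i) = ∑ j : Fin n, ∑ b : BasisIdx n i j,
    bm ((-1 : K) ^ deg b • W n K (n + i.val) (upIdx b) (downIdx b))
      (W n K (n + i.val + upIdx b - downIdx b) (n - 1 - i - upIdx b) (n + i - downIdx b)) ⊳
        gP K j := by
  let f (u d : ℕ) : PP n K := bm ((-1 : K) ^ (u + d) • W n K (n + i.val) u d)
    (W n K (n + i.val + u - d) (n - 1 - i - u) (n + i - d)) ⊳ g0 K n (n + i.val + u - d)
  have hf := sum_basisIdx i f
  rw [diffK_gP (one_mul 1) i, casimir, one_smul, bm_one_one, one_act]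
  refine Eq.trans ?_ (hf.symm.trans ?_)
  · rw [show n - 1 - i.val + 1 = n - i by have := i.2; omega]
    refine Finset.sum_congr rfl fun u _ => Finset.sum_congr rfl fun d _ => ?_
    simp only [f]
    push_cast
    rfl
  · refine Finset.sum_congr rfl fun j _ => Finset.sum_congr rfl fun b _ => ?_
    simp only [f]
    rw [g0_eq K (fold_idx b), deg_eq]

theorem W_mul_W_compl {i j : Fin n} (b : BasisIdx n i j) :
    W n K (n + i.val) (upIdx b) (downIdx b) *
      W n K (n + i.val + upIdx b - downIdx b) (n - 1 - i - upIdx b) (n + i - downIdx b) =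
        omega K i := by
  have h1 := upIdx_lt b
  have h2 := downIdx_lt b
  rw [W_mul_W' n K rfl, omega_eq, show upIdx b + (n - 1 - i - upIdx b) = n - 1 - i by omega,
    show downIdx b + (n + i - downIdx b) = n + i by omega]

theorem e_mul_omega_mul_e (i : Fin n) : e n K i * omega K i * e n K i = omega K i := by
  have h := i.2
  rw [omega_eq, e_mul_W, W_mul_e, if_pos]
  rw [show (n + i.val + (n - 1 - i : ℕ) - (n + i : ℕ) : ℤ) = 2 * n - 1 - (n + i.val) by omega,
    fold_reflect, fold_add]

/-- For each `m` the paths with flags `true` and `false` have lengths of opposite parity. -/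
theorem sum_neg_one_pow_deg (i j : Fin n) : ∑ b : BasisIdx n i j, (-1 : K) ^ deg b = 0 := by
  rw [Fintype.sum_prod_type]
  refine Finset.sum_eq_zero fun m _ => ?_
  rw [Fintype.sum_bool, show (-1 : K) ^ deg (m, false) = -(-1) ^ deg (i := i) (j := j) (m, true) by
    have h1 := deg_compl (i := i) (j := j) (m, true)
    have h2 := m.1.2
    have h3 : i.val ≤ m.1.val := (le_max_left i j).trans m.2
    have h4 : j.val ≤ m.1.val := (le_max_right i j).trans m.2
    simp only [deg, if_true, Bool.false_eq_true, if_false]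
    refine Eq.trans ?_ (neg_one_mul _)
    rw [← pow_succ']
    exact neg_one_pow_congr (by simp only [Nat.even_iff]; omega), add_neg_cancel]

/-- The morphism `e_i ⊗ e_i ↦ δ_{ik} e_k ⊗ e_k` of degree two lifts to the next term, and composing
the lifting with `yHom` gives multiples of the elements `ω_i`. -/
theorem exists_lift (k : Fin n) (c : Fin n → K)
    (hc : ∀ i, c i = ∑ b : BasisIdx n i k, (-1 : K) ^ deg b * deg b) :
    ∃ f : PP n K →ₗ[Env n K] QQ n K,
      diffD n 1 ∘ₗ f = (lift K id id (Pi.single k (gP K k)) : PP n K →ₗ[Env n K] PP n K) ∘ₗ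
        diffK n 1 ∧ ∀ i, yHom n K (f (gP K i)) = c i • omega K i := by
  -- `T i b` has boundary `x ⊗ x^* - e_i ⊗ ω_i` for the basis path `x` of `b`, and `ỹ` maps it to
  -- `deg x` times `ω_i`.
  choose T hT hT' using fun (i : Fin n) (b : BasisIdx n i k) =>
    exists_diffD_eq (K := K) (n + i.val) (upIdx b) (downIdx b)
      (W n K (n + i.val + upIdx b - downIdx b) (n - 1 - i - upIdx b) (n + i - downIdx b))
  let f : PP n K →ₗ[Env n K] QQ n K :=
    lift K id id fun i => ∑ b, bm ((-1 : K) ^ deg b • (1 : Lam n K)) 1 ⊳ T i b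
  let f₀ : PP n K →ₗ[Env n K] PP n K := lift K id id (Pi.single k (gP K k))
  have hf : ∀ i, f (gP K i) = bm (e n K i) (e n K i) ⊳
      ∑ b, bm ((-1 : K) ^ deg b • (1 : Lam n K)) 1 ⊳ T i b := fun i => lift_gen _ i
  have hf₀ : ∀ i, f₀ (gP K i) = if i = k then gP K k else 0 := by
    intro i
    have h : f₀ (gP K i) = bm (e n K i) (e n K i) ⊳ (Pi.single k (gP K k) : Fin n → PP n K) i :=
      lift_gen _ i
    rw [h]
    split_ifs with hik
    · subst hik
      rw [Pi.single_eq_same]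
      exact bm_e_act_gen i
    · rw [Pi.single_eq_of_ne hik, act_zero]
  refine ⟨f, proj_ext fun i => ?_, fun i => ?_⟩
  · change diffD n 1 (f (gP K i)) = f₀ (diffK n 1 (gP K i))
    have h1 : bm (e n K i) (e n K i) ⊳ f₀ (diffK n 1 (gP K i)) = f₀ (diffK n 1 (gP K i)) := by
      rw [← map_act, ← map_act]
      congr 2
      exact bm_e_act_gen i
    rw [← h1, hf, map_act]
    congr 1
    rw [diffK_gP_eq_sum, map_sum, map_sum, Finset.sum_eq_single k]
    rotate_left
    · intro j _ hj
      rw [map_sum]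
      refine Finset.sum_eq_zero fun b _ => ?_
      rw [map_act, hf₀, if_neg hj, act_zero]
    · exact fun h => absurd (Finset.mem_univ _) h
    rw [map_sum]
    simp only [map_act, hf₀, if_true, hT, W_mul_W_compl, act_sub, act_act, bm_mul_bm, one_mul,
      mul_one, smul_mul_assoc]
    -- The superfluous terms `e_i ⊗ ω_i` have total coefficient `∑ (-1)^{deg x} = 0`.
    rw [Finset.sum_sub_distrib, ← sum_act, ← bm_sum_left, ← Finset.sum_smul, sum_neg_one_pow_deg,
      zero_smul, bm_zero_left, zero_act, sub_zero]
    exact Finset.sum_congr rfl fun b _ => by rw [g0_eq K (fold_idx b)]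
  · rw [hf, map_act, map_sum, hc, bm_act_lam]
    simp only [map_act, hT', W_mul_W_compl, bm_act_lam, mul_one, smul_mul_assoc, one_mul, smul_smul,
      ← deg_eq]
    rw [← Finset.sum_smul, mul_smul_comm, smul_mul_assoc]
    rw [e_mul_omega_mul_e]

/-! ### Vanishing of long paths, and the cocycles on `P`. -/

theorem W_eq_zero_of_le (q : ℤ) {u d : ℕ} (h : 2 * n ≤ u + d) : W n K q u d = 0 := by
  by_cases hd : (d : ℤ) ≤ q
  · exact W_eq_zero_up n K (q := q) (u := u) d (by omega)
  · exact W_eq_zero_down n K (q := q) (d := d) u (by omega)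

/-- A product of two paths is a path of at least the total length. -/
theorem exists_W_mul_W (q q' : ℤ) (u d u' d' : ℕ) : ∃ v f : ℕ, u + d + u' + d' ≤ v + f ∧
    W n K q u d * W n K q' u' d' = W n K q v f := by
  by_cases h : fold n (q + u - d) = fold n q'
  · have : q + u - d = q' ∨ q + u - d = 2 * n - 1 - q' := by
      unfold fold at h
      split_ifs at h <;> omega
    rcases this with h' | h'
    · exact ⟨_, _, by omega, W_mul_W' n K h' u' d'⟩
    · refine ⟨u + d', d + u', by omega, ?_⟩
      rw [← W_reflect n K q', W_mul_W' n K h']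
  -- The paths do not compose and the product is zero; any path of length at least `2n` represents
  -- it.
  · refine ⟨2 * n + u + d + u' + d', 0, by omega, ?_⟩
    rw [W_eq_zero_of_le q (u := 2 * n + u + d + u' + d') (by omega), ← W_mul_E, ← E_mul_W n K q',
      mul_assoc, ← mul_assoc (E n K _) (E n K _), E_mul_E_of_ne K h, zero_mul, mul_zero]

theorem exists_arrow_eq_smul_W (a : Arrow n) : ∃ (q : ℤ) (u d : ℕ), u + d = 1 ∧
    arrow n K a = sgn K (src a) (tgt a) • W n K q u d := by
  have h := fold_add n (src a)
  rcases arrow_lift a h with h' | h'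
  · exact ⟨_, 1, 0, rfl, by rw [arrow_eq_smul_S K h h', S_up]⟩
  · exact ⟨_, 0, 1, rfl, by rw [arrow_eq_smul_S K h h', S_down]⟩

theorem arrow_mul_omega (a : Arrow n) (i : Fin n) : arrow n K a * omega K i = 0 := by
  obtain ⟨q, u, d, h, ha⟩ := exists_arrow_eq_smul_W (K := K) a
  obtain ⟨v, f, h', hv⟩ := exists_W_mul_W (K := K) q (n + i.val) u d (n - 1 - i) (n + i)
  have := i.2
  rw [ha, omega_eq, smul_mul_assoc, hv, W_eq_zero_of_le q (by omega), smul_zero]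

theorem omega_mul_arrow (a : Arrow n) (i : Fin n) : omega K i * arrow n K a = 0 := by
  obtain ⟨q, u, d, h, ha⟩ := exists_arrow_eq_smul_W (K := K) a
  obtain ⟨v, f, h', hv⟩ := exists_W_mul_W (K := K) (n + i.val) q (n - 1 - i) (n + i) u d
  have := i.2
  rw [ha, omega_eq, mul_smul_comm, hv, W_eq_zero_of_le _ (by omega), smul_zero]

theorem omega_ne_zero (i : Fin n) : omega K i ≠ 0 := by
  have := i.2
  intro h
  have h1 := coef_W (n := n) K (q := n + i.val) (u := n - 1 - i) (d := n + i) (by omega) (n - 1 - i) (n + i)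
  rw [← omega_eq, h, map_zero, if_pos rfl] at h1
  exact zero_ne_one h1

theorem map_bimod_closed {ι : Type} {s t : ι → Fin n} [DecidableEq ι]
    (g : PB K s t →ₗ[Env n K] Lam n K) (x : ι) :
    e n K (s x) * g (gn K s t x) * e n K (t x) = g (gn K s t x) := by
  rw [← bm_act_lam, ← map_act, bm_e_act_gen]

theorem map_closed_mem' {M : Type*} [AddCommGroup M] [Module K M] (φ : Lam n K →ₗ[K] M)
    (N : Submodule K M) (i : Fin n)
    (h : ∀ u d : ℕ, n + i.val + u < 2 * n → d ≤ n + i.val →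
      fold n (n + i.val + u - d) = i → φ (W n K (n + i.val) u d) ∈ N)
    (x : Lam n K) (hx : e n K i * x * e n K i = x) : φ x ∈ N := by
  have h1 := map_closed_mem φ N i (fun u d _ => h u d) (x - vtxChar K i x • e n K i)
    (by rw [mul_sub, sub_mul, hx, mul_smul_comm, smul_mul_assoc, e_mul_e, e_mul_e])
    (by rw [map_sub, map_smul, vtxChar_e, smul_eq_mul, mul_one, sub_self])
  have h2 := h 0 0 (by have := i.2; omega) (by omega) (by
    rw [Nat.cast_zero, add_zero, sub_zero, fold_add])
  rw [W_zero_zero, ← e_eq_E] at h2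
  have := N.add_mem h1 (N.smul_mem (vtxChar K i x) h2)
  rwa [← map_smul, ← map_add, sub_add_cancel] at this

/-- The differential induced by `k` vanishes. -/
theorem map_diffK_gP (g : PP n K →ₗ[Env n K] Lam n K) (i : Fin n) :
    g (diffK n 1 (gP K i)) = 0 := by
  rw [diffK_gP_eq_sum, map_sum]
  refine Finset.sum_eq_zero fun j _ => ?_
  -- Since `x x^*` already has the maximal length `2n - 1`, a nontrivial path inserted between the
  -- factors gives zero, and only the coefficient of `e_j` in the value survives.
  have key : ∀ b : BasisIdx n i j,
      W n K (n + i.val) (upIdx b) (downIdx b) * g (gP K j) *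
        W n K (n + i.val + upIdx b - downIdx b) (n - 1 - i - upIdx b) (n + i - downIdx b) =
      vtxChar K j (g (gP K j)) • omega K i := by
    intro b
    have hg := map_bimod_closed (s := id) (t := id) g j
    simp only [id] at hg
    set v := g (gP K j) with hv
    let φ : Lam n K →ₗ[K] Lam n K := LinearMap.mulRight K
      (W n K (n + i.val + upIdx b - downIdx b) (n - 1 - i - upIdx b) (n + i - downIdx b)) ∘ₗ
        LinearMap.mulLeft K (W n K (n + i.val) (upIdx b) (downIdx b))
    have hφ : ∀ x, φ x = W n K (n + i.val) (upIdx b) (downIdx b) * x *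
      W n K (n + i.val + upIdx b - downIdx b) (n - 1 - i - upIdx b) (n + i - downIdx b) :=
      fun _ => rfl
    have h1 := map_closed_mem φ ⊥ j (fun u d h _ _ _ => by
      obtain ⟨v, f, h1, h2⟩ := exists_W_mul_W (K := K) (n + i.val) (n + j.val) (upIdx b) (downIdx b)
        u d
      obtain ⟨v', f', h1', h2'⟩ := exists_W_mul_W (K := K) (n + i.val)
        (n + i.val + upIdx b - downIdx b) v f (n - 1 - i - upIdx b) (n + i - downIdx b)
      have h3 := upIdx_lt b
      have h4 := downIdx_lt b
      rw [hφ, h2, h2', W_eq_zero_of_le _ (by omega)]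
      exact zero_mem _) (v - vtxChar K j v • e n K j)
      (by rw [mul_sub, sub_mul, hg, mul_smul_comm, smul_mul_assoc, e_mul_e, e_mul_e])
      (by rw [map_sub, map_smul, vtxChar_e, smul_eq_mul, mul_one, sub_self])
    rw [Submodule.mem_bot, map_sub, sub_eq_zero, map_smul] at h1
    rw [← hφ, h1, hφ, W_mul_e, if_pos (fold_idx b), W_mul_W_compl]
  rw [map_sum]
  simp only [map_act, bm_act_lam, smul_mul_assoc, key]
  rw [← Finset.sum_smul, sum_neg_one_pow_deg, zero_smul]

theorem map_diffD_gQ (s : K) (g : PP n K →ₗ[Env n K] Lam n K) (a : Arrow n) :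
    g (diffD n s (gQ K a)) = arrow n K a * g (gP K (tgt a)) - s • (g (gP K (src a)) * arrow n K a) := by
  rw [diffD_gQ, map_sub, map_act, map_act, bm_act_lam, bm_act_lam, mul_one, smul_mul_assoc,
    one_mul, smul_mul_assoc]

/-- Prefixing the step up from `n + i - 1` maps the closed paths with `d < n + i` to distinct basis
paths; the only closed path that it kills has `d = n + i`, and this is `ω_i`. -/
theorem mem_span_omega {i : Fin n} {x : Lam n K} (hx : e n K i * x * e n K i = x)
    (h : S n K (n + i.val - 1) (n + i.val) * x = 0) : x ∈ Submodule.span K {omega K i} := by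
  -- A left inverse of prefixing the step on the closed paths that survive. So `φ`, the identity
  -- minus `r` after prefixing, kills them and fixes `ω_i`, while it fixes `x` by hypothesis.
  let r : Lam n K →ₗ[K] Lam n K := ∑ u ∈ Finset.range (n - i), ∑ d ∈ Finset.range (n + i),
    (coef K (n + i.val - 1) (u + 1) d).smulRight (W n K (n + i.val) u d)
  let φ := LinearMap.id - r ∘ₗ LinearMap.mulLeft K (S n K (n + i.val - 1) (n + i.val))
  have := map_closed_mem' φ (Submodule.span K {omega K i}) i (fun u d hu hd hf => by
    have h1 := S_mul_W_up (n := n) (K := K) (n + i.val - 1) u d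
    rw [sub_add_cancel] at h1
    by_cases hd' : d < n + i
    · have : φ (W n K (n + i.val) u d) = 0 := by
        simp only [φ, r, LinearMap.sub_apply, LinearMap.comp_apply, LinearMap.mulLeft_apply, h1,
          LinearMap.id_apply, LinearMap.sum_apply, LinearMap.smulRight_apply]
        rw [sub_eq_zero, Finset.sum_eq_single u, Finset.sum_eq_single d, coef_W, if_pos rfl, one_smul]
        · omega
        · intro d' hd' hne
          rw [Finset.mem_range] at hd'
          rw [coef_W, if_neg (fun h => hne (Prod.mk.inj h).2.symm), zero_smul]
          omega
        · exact fun h => absurd (Finset.mem_range.2 hd') h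
        · intro u' hu' hne
          rw [Finset.mem_range] at hu'
          refine Finset.sum_eq_zero fun d' hd' => ?_
          rw [Finset.mem_range] at hd'
          rw [coef_W, if_neg (fun h => hne (by have := (Prod.mk.inj h).1; omega)), zero_smul]
          omega
        · exact fun h => absurd (Finset.mem_range.2 (by omega)) h
      rw [this]
      exact zero_mem _
    · obtain rfl : d = n + i := by omega
      have hu' : u = n - 1 - i := by
        unfold fold at hf
        split_ifs at hf <;> omega
      have : φ (W n K (n + i.val) u (n + i)) = omega K i := by
        simp only [φ, LinearMap.sub_apply, LinearMap.comp_apply, LinearMap.mulLeft_apply, h1]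
        rw [W_eq_zero_down n K (q := n + i.val - 1) (d := n + i) _ (by omega), map_zero, sub_zero,
          hu', omega_eq]
        rfl
      rw [this]
      exact Submodule.subset_span rfl) x hx
  have h2 : φ x = x := by
    simp only [φ, LinearMap.sub_apply, LinearMap.comp_apply, LinearMap.mulLeft_apply, h, map_zero,
      sub_zero, LinearMap.id_apply]
  rwa [h2] at this

/-- The cocycles in degree three. -/
theorem mem_span_omega_of_cocycle (h2 : (2 : K) ≠ 0) (g : PP n K →ₗ[Env n K] Lam n K)
    (hg : ∀ a, g (diffD n (-1) (gQ K a)) = 0) (i : Fin n) :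
    g (gP K i) ∈ Submodule.span K {omega K i} := by
  have hc : ∀ j, e n K j * g (gP K j) * e n K j = g (gP K j) := fun j =>
    map_bimod_closed (s := id) (t := id) g j
  have hg' : ∀ a : Arrow n, arrow n K a * g (gP K (tgt a)) + g (gP K (src a)) * arrow n K a = 0 := by
    intro a
    have := hg a
    rwa [map_diffD_gQ, neg_smul, one_smul, sub_neg_eq_add] at this
  obtain ⟨i, hi⟩ := i
  induction i with
  | zero =>
    let a : Arrow n := ⟨(⟨0, hi⟩, ⟨0, hi⟩), Or.inl ⟨rfl, rfl⟩⟩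
    have ha : arrow n K a = step n K 0 0 := by
      rw [show step n K 0 0 = step n K (⟨0, hi⟩ : Fin n) (⟨0, hi⟩ : Fin n) from rfl, step_coe,
        dif_pos a.2]
    have h := hg' a
    -- The twist turns the cocycle condition at the loop into an anticommutator; as closed paths
    -- commute with the loop, it says that twice the product vanishes.
    have hcomm : step n K 0 0 * g (gP K ⟨0, hi⟩) = g (gP K ⟨0, hi⟩) * step n K 0 0 := by
      let φ : Lam n K →ₗ[K] Lam n K := LinearMap.mulLeft K (step n K 0 0) -
        LinearMap.mulRight K (step n K 0 0)
      have := map_closed_mem' φ ⊥ ⟨0, hi⟩ (fun u d hu hd h => by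
        rw [Submodule.mem_bot]
        simp only [φ, LinearMap.sub_apply, LinearMap.mulLeft_apply, LinearMap.mulRight_apply,
          Nat.cast_zero, add_zero] at h ⊢
        rw [sub_eq_zero]
        exact loop_mul_W_comm h) _ (hc ⟨0, hi⟩)
      simpa [φ, sub_eq_zero] using this
    refine mem_span_omega (hc _) ?_
    rw [ha, show tgt a = ⟨0, hi⟩ from rfl, show src a = ⟨0, hi⟩ from rfl, ← hcomm, ← two_smul K] at h
    have := (smul_eq_zero.1 h).resolve_left h2
    simp only [Nat.cast_zero, add_zero]
    rwa [← step_loop']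
  | succ i ih =>
    let a : Arrow n := ⟨(⟨i, by omega⟩, ⟨i + 1, hi⟩), Or.inr (Or.inl rfl)⟩
    have ha : arrow n K a = S n K (n + i) (n + i + 1) := by
      rw [← step_up, show step n K i (i + 1) =
        step n K (⟨i, by omega⟩ : Fin n) (⟨i + 1, hi⟩ : Fin n) from rfl, step_coe, dif_pos a.2]
    have h := hg' a
    -- By induction the value at the preceding vertex is annihilated by arrows, so the cocycle
    -- condition at `a` reduces to the hypothesis of `mem_span_omega`.
    obtain ⟨c, hc'⟩ := Submodule.mem_span_singleton.1 (ih (by omega))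
    refine mem_span_omega (hc _) ?_
    rw [show src a = ⟨i, by omega⟩ from rfl, ← hc', smul_mul_assoc, omega_mul_arrow, smul_zero,
      add_zero, ha] at h
    push_cast
    rwa [show (n + (i + 1) - 1 : ℤ) = n + i by ring, ← add_assoc]

end Liftings

/-! ## Classes of cocycles -/

section Classes

variable {n : ℕ} {K : Type u} [Field K] {R : ProjectiveResolution (bimod n K)} (p : Presentation R)

variable (n) in
/-- Multiplication by a scalar as an endomorphism of the bimodule. -/
def scal (c : K) : bimod n K ⟶ bimod n K :=
  ModuleCat.ofHom (c • LinearMap.id : Lam n K →ₗ[Env n K] Lam n K)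

/-- Matches scalar multiplication on the algebra with the linear structure of the category of
bimodules, through which scalars act on `Ext`. -/
theorem scal_eq_smul (c : K) :
    scal n c = (Linear.homModule (R := K) (bimod n K) (bimod n K)).toSMul.smul c (𝟙 _) := by
  ext x
  exact (algebraMap_smul (Env n K) c (x : Lam n K)).symm

namespace Presentation

theorem cls_congr {i : ℕ} {f g : resObj n K i ⟶ bimod n K} (h : f = g) (hf : resD n K i ≫ f = 0) :
    p.cls f hf = p.cls g (h ▸ hf) := by
  subst h
  rfl

theorem cls_add {i : ℕ} {f g : resObj n K i ⟶ bimod n K} (hf : resD n K i ≫ f = 0)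
    (hg : resD n K i ≫ g = 0) : p.cls (f + g) (by rw [Preadditive.comp_add, hf, hg, add_zero]) =
      p.cls f hf + p.cls g hg := by
  unfold cls
  rw [R.add_extMk]
  simp only [Preadditive.comp_add]

theorem cls_smul {i : ℕ} (c : K) {f : resObj n K i ⟶ bimod n K} (hf : resD n K i ≫ f = 0) :
    p.cls (f ≫ scal n c) (by rw [reassoc_of% hf, Limits.zero_comp]) = c • p.cls f hf := by
  unfold cls
  rw [Abelian.Ext.smul_eq_comp_mk₀, R.extMk_comp_mk₀]
  congr 1
  rw [Category.assoc, scal_eq_smul]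
  rfl

theorem sum_smul_cls {ι : Type*} (t : Finset ι) {i : ℕ} (c : ι → K)
    (f : ι → (resObj n K i ⟶ bimod n K)) (hf : ∀ k, resD n K i ≫ f k = 0)
    (h : resD n K i ≫ ∑ k ∈ t, f k ≫ scal n (c k) = 0) :
    ∑ k ∈ t, c k • p.cls (f k) (hf k) = p.cls (∑ k ∈ t, f k ≫ scal n (c k)) h := by
  classical
  induction t using Finset.induction_on with
  | empty =>
    rw [Finset.sum_empty, p.cls_congr (Finset.sum_empty)]
    unfold cls
    simp
  | insert k t hk ih =>
    have h1 : ∀ k, resD n K i ≫ f k ≫ scal n (c k) = 0 := fun k => by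
      rw [reassoc_of% hf k, Limits.zero_comp]
    have h2 : resD n K i ≫ ∑ k ∈ t, f k ≫ scal n (c k) = 0 := by
      rw [Preadditive.comp_sum]
      exact Finset.sum_eq_zero fun k _ => h1 k
    rw [Finset.sum_insert hk, ih h2, p.cls_congr (Finset.sum_insert hk), p.cls_add (h1 k) h2,
      p.cls_smul]

theorem cls_surjective {i : ℕ} (x : HH n K i) :
    ∃ (f : resObj n K i ⟶ bimod n K) (hf : resD n K i ≫ f = 0), p.cls f hf = x := by
  obtain ⟨f, hf, rfl⟩ := R.extMk_surjective x (i + 1) rfl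
  refine ⟨(p.iso i).inv ≫ f, ?_, ?_⟩
  · rw [← cancel_epi (p.iso (i + 1)).hom, reassoc_of% p.comm i, Iso.hom_inv_id_assoc, hf,
      Limits.comp_zero]
  · unfold cls
    congr 1
    rw [Iso.hom_inv_id_assoc]

theorem cls_eq_zero_iff {i : ℕ} {f : resObj n K (i + 1) ⟶ bimod n K}
    (hf : resD n K (i + 1) ≫ f = 0) : p.cls f hf = 0 ↔ ∃ g, resD n K i ≫ g = f := by
  unfold cls
  rw [R.extMk_eq_zero_iff _ _ _ _ i rfl]
  constructor
  · rintro ⟨g, hg⟩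
    refine ⟨(p.iso i).inv ≫ g, ?_⟩
    rw [← cancel_epi (p.iso (i + 1)).hom, reassoc_of% p.comm i, Iso.hom_inv_id_assoc, hg]
  · rintro ⟨g, rfl⟩
    exact ⟨(p.iso i).hom ≫ g, by rw [reassoc_of% p.comm i]⟩

theorem cls_comp_cls (f₀ : resObj n K 2 ⟶ resObj n K 0) (f₁ : resObj n K 3 ⟶ resObj n K 1)
    (h : f₁ ≫ resD n K 0 = resD n K 2 ≫ f₀) {f : resObj n K 2 ⟶ bimod n K}
    (hf : f₀ ≫ resAug n K = f) (hd : resD n K 2 ≫ f = 0) {y : resObj n K 1 ⟶ bimod n K}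
    (hy : resD n K 1 ≫ y = 0) {g : resObj n K 3 ⟶ bimod n K} (hg : f₁ ≫ y = g)
    (hg' : resD n K 3 ≫ g = 0) :
    (p.cls f hd).comp (p.cls y hy) (show 2 + 1 = 3 from rfl) = p.cls g hg' := by
  subst hf hg
  unfold cls
  rw [extMk_comp_extMk ((p.iso 2).hom ≫ f₀ ≫ (p.iso 0).inv) ((p.iso 3).hom ≫ f₁ ≫ (p.iso 1).inv)]
  · congr 1
    simp only [Category.assoc, Iso.inv_hom_id_assoc]
  · rw [← cancel_mono (p.iso 0).hom]
    simp only [Category.assoc, ← p.comm, Iso.inv_hom_id_assoc, Iso.inv_hom_id, Category.comp_id, h]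
    rw [reassoc_of% p.comm 2]
  · have := p.aug
    rw [augOf, ← this]
    simp only [Category.assoc, Iso.inv_hom_id_assoc]
  · simp only [Category.assoc, Iso.inv_hom_id_assoc]
    rw [← reassoc_of% p.comm 3, hg', Limits.comp_zero]

end Presentation

end Classes

/-! ## The canonical bases -/

section Bases

variable {n : ℕ} {K : Type u} [Field K] {R : ProjectiveResolution (bimod n K)} (p : Presentation R)

/-- A bimodule morphism from `P` to the algebra as a linear map. -/
abbrev homP (f : P n K →ₗ[Env n K] bimod n K) : PP n K →ₗ[Env n K] Lam n K := f

theorem lift_gP (v : Fin n → Lam n K) (i : Fin n) :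
    (lift K id id v : PP n K →ₗ[Env n K] Lam n K) (gP K i) = e n K i * v i * e n K i := by
  have : (lift K id id v : PP n K →ₗ[Env n K] Lam n K) (gP K i) =
    bm (e n K i) (e n K i) ⊳ v i := lift_gen _ i
  rw [this, bm_act_lam]

theorem zRep_gP (k i : Fin n) : homP (zRep K k).hom (gP K i) = if i = k then e n K i else 0 := by
  refine (lift_gP _ i).trans ?_
  split_ifs with h
  · rw [h, e_mul_e, e_mul_e]
  · rw [mul_zero, zero_mul]

theorem tRep_gP (k i : Fin n) : homP (tRep K k).hom (gP K i) = if i = k then omega K i else 0 := by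
  refine (lift_gP _ i).trans ?_
  split_ifs with h
  · rw [h, e_mul_omega_mul_e]
  · rw [mul_zero, zero_mul]

theorem resD_one_comp_yRep : resD n K 1 ≫ yRep n K = 0 := by
  have : yHom n K ∘ₗ diffR n 1 = 0 := proj_ext fun i => by
    rw [LinearMap.comp_apply, map_diffR_gP, Finset.sum_congr rfl fun a _ => by
      rw [yHom_gQ, yHom_gQ], Finset.sum_add_distrib, preproj_rel, add_zero, LinearMap.zero_apply]
  exact congrArg ModuleCat.ofHom this

theorem resD_two_comp (f : resObj n K 2 ⟶ bimod n K) : resD n K 2 ≫ f = 0 := by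
  have : homP f.hom ∘ₗ diffK n 1 = 0 := proj_ext fun i => map_diffK_gP _ i
  exact congrArg ModuleCat.ofHom this

theorem resD_three_comp_tRep (k : Fin n) : resD n K 3 ≫ tRep K k = 0 := by
  have : homP (tRep K k).hom ∘ₗ diffD n (-1) = 0 := proj_ext fun a => by
    rw [LinearMap.comp_apply, map_diffD_gQ, tRep_gP, tRep_gP, LinearMap.zero_apply]
    split_ifs <;> simp only [arrow_mul_omega, omega_mul_arrow, mul_zero, zero_mul, smul_zero, sub_zero]
  exact congrArg ModuleCat.ofHom this

theorem hom_ext_two {f g : resObj n K 2 ⟶ bimod n K}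
    (h : ∀ i, homP f.hom (gP K i) = homP g.hom (gP K i)) : f = g := by
  have : homP f.hom = homP g.hom := proj_ext h
  exact congrArg ModuleCat.ofHom this

theorem hom_ext_three {f g : resObj n K 3 ⟶ bimod n K}
    (h : ∀ i, homP f.hom (gP K i) = homP g.hom (gP K i)) : f = g := by
  have : homP f.hom = homP g.hom := proj_ext h
  exact congrArg ModuleCat.ofHom this

theorem sum_zRep_gP (c : Fin n → K) (i : Fin n) :
    homP (∑ k, zRep K k ≫ scal n (c k)).hom (gP K i) = c i • e n K i := by
  have : homP (∑ k, zRep K k ≫ scal n (c k)).hom = ∑ k, c k • homP (zRep K k).hom :=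
    ModuleCat.hom_sum _ _
  rw [this, LinearMap.sum_apply, Finset.sum_eq_single i]
  · rw [LinearMap.smul_apply, zRep_gP, if_pos rfl]
  · intro k _ hk
    rw [LinearMap.smul_apply, zRep_gP, if_neg (Ne.symm hk), smul_zero]
  · exact fun h => absurd (Finset.mem_univ _) h

theorem sum_tRep_gP (c : Fin n → K) (i : Fin n) :
    homP (∑ k, tRep K k ≫ scal n (c k)).hom (gP K i) = c i • omega K i := by
  have : homP (∑ k, tRep K k ≫ scal n (c k)).hom = ∑ k, c k • homP (tRep K k).hom :=
    ModuleCat.hom_sum _ _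
  rw [this, LinearMap.sum_apply, Finset.sum_eq_single i]
  · rw [LinearMap.smul_apply, tRep_gP, if_pos rfl]
  · intro k _ hk
    rw [LinearMap.smul_apply, tRep_gP, if_neg (Ne.symm hk), smul_zero]
  · exact fun h => absurd (Finset.mem_univ _) h

theorem resD_three_comp_sum_tRep (c : Fin n → K) :
    resD n K 3 ≫ ∑ k, tRep K k ≫ scal n (c k) = 0 := by
  rw [Preadditive.comp_sum]
  refine Finset.sum_eq_zero fun k _ => ?_
  rw [← Category.assoc, resD_three_comp_tRep, Limits.zero_comp]

/-- The classes `z_k` form a basis. -/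
def zBasis (h2 : (2 : K) ≠ 0) : Module.Basis (Fin n) K (HH n K 2) :=
  Module.Basis.mk (v := fun k => p.cls (zRep K k) (resD_two_comp _))
    (by
      rw [Fintype.linearIndependent_iff]
      intro c hc i
      rw [p.sum_smul_cls _ c _ _ (resD_two_comp _), p.cls_eq_zero_iff] at hc
      obtain ⟨g, hg⟩ := hc
      have h1 := sum_zRep_gP c i
      rw [← hg] at h1
      have h3 := vtxChar_map_diffR (show QQ n K →ₗ[Env n K] Lam n K from g.hom) i i
      have h4 : vtxChar K i (c i • e n K i) = 0 := (congrArg (vtxChar K i) h1).symm.trans h3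
      rwa [map_smul, vtxChar_e, smul_eq_mul, mul_one] at h4)
    (by
      rintro x -
      obtain ⟨f, hf, rfl⟩ := p.cls_surjective x
      -- The coefficient of `e_k` in the value at the generator of `k`; what remains has no trivial
      -- paths and is a coboundary by `mem_cobR`.
      let c : Fin n → K := fun k => vtxChar K k (homP f.hom (gP K k))
      obtain ⟨g, hg⟩ := mem_cobR h2
        (fun i => homP f.hom (gP K i) - c i • e n K i) (fun i => by
          have := map_bimod_closed (s := id) (t := id) (homP f.hom) i
          simp only [id] at this
          rw [mul_sub, sub_mul, this, mul_smul_comm, smul_mul_assoc, e_mul_e, e_mul_e])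
        (fun i => by rw [map_sub, map_smul, vtxChar_e, smul_eq_mul, mul_one, sub_self])
      obtain ⟨γ, h1⟩ : ∃ γ : resObj n K 1 ⟶ bimod n K,
          resD n K 1 ≫ γ + ∑ k, zRep K k ≫ scal n (c k) = f := by
        refine ⟨ModuleCat.ofHom g, ?_⟩
        refine hom_ext_two fun i => ?_
        have h2 := sum_zRep_gP c i
        have h3 := hg i
        refine (congrArg₂ (· + ·) h3 h2).trans ?_
        exact sub_add_cancel _ _
      have h3 : p.cls f hf = ∑ k, c k • p.cls (zRep K k) (resD_two_comp _) := by
        rw [p.cls_congr h1.symm, p.cls_add (resD_two_comp _) (resD_two_comp _),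
          (p.cls_eq_zero_iff (resD_two_comp _)).2 ⟨_, rfl⟩, zero_add, p.sum_smul_cls]
      rw [h3]
      exact Submodule.sum_mem _ fun k _ => Submodule.smul_mem _ _ (Submodule.subset_span ⟨k, rfl⟩))

/-- The classes `t_k` form a basis. -/
def tBasis (h2 : (2 : K) ≠ 0) : Module.Basis (Fin n) K (HH n K 3) :=
  Module.Basis.mk (v := fun k => p.cls (tRep K k) (resD_three_comp_tRep k))
    (by
      rw [Fintype.linearIndependent_iff]
      intro c hc i
      rw [p.sum_smul_cls _ c _ _ (resD_three_comp_sum_tRep c), p.cls_eq_zero_iff] at hc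
      obtain ⟨g, hg⟩ := hc
      have h1 := sum_tRep_gP c i
      -- The coboundaries induced by `k` are zero, so a cocycle in degree three with zero class is
      -- itself zero.
      rw [← hg, resD_two_comp] at h1
      exact (smul_eq_zero.1 h1.symm).resolve_right (omega_ne_zero i))
    (by
      rintro x -
      obtain ⟨f, hf, rfl⟩ := p.cls_surjective x
      have h1 : ∀ i, ∃ c : K, c • omega K i = homP f.hom (gP K i) := fun i =>
        Submodule.mem_span_singleton.1 (mem_span_omega_of_cocycle h2 (homP f.hom) (fun a => by
          have := congrArg (fun g => g.hom (gQ K a)) hf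
          exact this) i)
      choose c hc using h1
      have h3 : f = ∑ k, tRep K k ≫ scal n (c k) := hom_ext_three fun i => by
        rw [sum_tRep_gP, hc]
      have h4 : p.cls f hf = ∑ k, c k • p.cls (tRep K k) (resD_three_comp_tRep k) := by
        rw [p.cls_congr h3, p.sum_smul_cls]
      rw [h4]
      exact Submodule.sum_mem _ fun k _ => Submodule.smul_mem _ _ (Submodule.subset_span ⟨k, rfl⟩))

theorem zBasis_apply (h2 : (2 : K) ≠ 0) (k : Fin n) :
    zBasis p h2 k = p.cls (zRep K k) (resD_two_comp _) := Module.Basis.mk_apply _ _ _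

theorem tBasis_apply (h2 : (2 : K) ≠ 0) (k : Fin n) :
    tBasis p h2 k = p.cls (tRep K k) (resD_three_comp_tRep k) := Module.Basis.mk_apply _ _ _

theorem mulBy_cls_zRep (k : Fin n) (c : Fin n → K)
    (hc : ∀ i, c i = ∑ b : BasisIdx n i k, (-1 : K) ^ deg b * deg b) :
    mulBy (p.cls (yRep n K) resD_one_comp_yRep) (p.cls (zRep K k) (resD_two_comp _)) =
      ∑ i, c i • p.cls (tRep K i) (resD_three_comp_tRep i) := by
  obtain ⟨f, hf, hy⟩ := exists_lift k c hc
  rw [p.sum_smul_cls _ c _ _ (resD_three_comp_sum_tRep c)]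
  refine p.cls_comp_cls (ModuleCat.ofHom (lift K id id (Pi.single k (gP K k)) :
    PP n K →ₗ[Env n K] PP n K)) (ModuleCat.ofHom f) (congrArg ModuleCat.ofHom hf)
    (hom_ext_two fun i => ?_) (resD_two_comp _) resD_one_comp_yRep (hom_ext_three fun i => ?_)
    (resD_three_comp_sum_tRep c)
  · rw [zRep_gP]
    have h : (lift K id id (Pi.single k (gP K k)) : PP n K →ₗ[Env n K] PP n K) (gP K i) =
      bm (e n K i) (e n K i) ⊳ (Pi.single k (gP K k) : Fin n → PP n K) i := lift_gen _ i
    refine (congrArg (aug n) h).trans ?_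
    have ha : aug n (gP K k) = e n K k := (lift_gP _ k).trans (by rw [e_mul_e, e_mul_e])
    rw [map_act, bm_act_lam]
    split_ifs with hik
    · subst hik
      rw [Pi.single_eq_same, ha, e_mul_e, e_mul_e]
    · rw [Pi.single_eq_of_ne hik, map_zero, mul_zero, zero_mul]
  · rw [sum_tRep_gP]
    exact hy i

end Bases

/-! ## The matrix -/

section Matrix

/-- The matrix of the multiplication by `y`. -/
def yMatrix (n : ℕ) : Matrix (Fin n) (Fin n) ℤ := Matrix.of fun j k =>
  (-1) ^ (j.val + k.val + 1) * (2 * (min j.val k.val : ℕ) + 1) * (n - (max j.val k.val : ℕ))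

theorem yMatrix_apply (n : ℕ) (j k : Fin n) : yMatrix n j k =
    (-1) ^ (j.val + k.val + 1) * (2 * (min j.val k.val : ℕ) + 1) * (n - (max j.val k.val : ℕ)) := rfl

theorem yMatrix_isSymm (n : ℕ) : (yMatrix n).IsSymm := by
  ext j k
  rw [Matrix.transpose_apply, yMatrix_apply, yMatrix_apply, min_comm, max_comm, add_comm k.val]

theorem yMatrix_apply_of_le {n : ℕ} {j k : Fin n} (h : j ≤ k) : yMatrix n j k =
    (-1) ^ (k.val - j.val + 1) * (2 * ((j.val : ℤ) + 1) - 1) * ((n : ℤ) - ((k.val : ℤ) + 1) + 1) := by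
  have h' : j.val ≤ k.val := h
  rw [yMatrix_apply, min_eq_left h', max_eq_right h', show (-1 : ℤ) ^ (j.val + k.val + 1) =
    (-1) ^ (k.val - j.val + 1) from neg_one_pow_congr (by simp only [Nat.even_iff]; omega)]
  ring

/-- The matrix of the multiplication by `y` without its signs, in the opposite order. -/
def revMatrix (m : ℕ) : Matrix (Fin (m + 1)) (Fin (m + 1)) ℤ := Matrix.of fun i k =>
  (2 * ((m : ℤ) - (max i.val k.val : ℕ)) + 1) * ((min i.val k.val : ℕ) + 1)

theorem det_revMatrix (m : ℕ) : (revMatrix m).det = (2 * m + 3) ^ m := by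
  -- From each row but the first, the preceding row is subtracted.
  let A : Matrix (Fin (m + 1)) (Fin (m + 1)) ℤ := Matrix.of fun i k =>
    if k < i then -2 * ((k.val : ℤ) + 1) else 2 * ((m : ℤ) - k.val) + 1
  -- Then the first row is subtracted from all others, which leaves a constant strictly below the
  -- diagonal.
  let B : Matrix (Fin (m + 1)) (Fin (m + 1)) ℤ := Matrix.of fun i k =>
    if i = 0 then 2 * ((m : ℤ) - k.val) + 1 else if k < i then -(2 * (m : ℤ) + 3) else 0
  have h1 : (revMatrix m).det = A.det := by
    refine Matrix.det_eq_of_forall_row_eq_smul_add_pred (fun _ => 1) (fun j => ?_) fun i j => ?_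
    · simp [revMatrix, A]
    · simp only [revMatrix, A, Matrix.of_apply, Fin.val_succ, Fin.val_castSucc, one_mul,
        Fin.lt_def]
      by_cases h : j.val < i.val + 1
      · rw [if_pos h, max_eq_left (by omega), max_eq_left (by omega), min_eq_right (by omega),
          min_eq_right (by omega)]
        push_cast
        ring
      · rw [if_neg h, max_eq_right (by omega), max_eq_right (by omega), min_eq_left (by omega),
          min_eq_left (by omega)]
        push_cast
        ring
  have h2 : A.det = B.det := by
    refine Matrix.det_eq_of_forall_row_eq_smul_add_const (fun i => if i = 0 then 0 else 1) 0
      (if_pos rfl) fun i k => ?_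
    simp only [A, B, Matrix.of_apply, if_true]
    by_cases hi : i = 0
    · subst hi
      simp
    · rw [if_neg hi, if_neg hi]
      split_ifs <;> ring
  -- The last column has the single nonzero entry `1`, in the first row. Its minor is triangular
  -- with constant diagonal `-(2 m + 3)`, and the cofactor sign `(-1) ^ m` cancels the signs of the
  -- diagonal.
  rw [h1, h2, Matrix.det_succ_column B (Fin.last m), Finset.sum_eq_single 0]
  · have hB : B 0 (Fin.last m) = 1 := by simp [B]
    have hs : ∀ i j, B.submatrix (Fin.succAbove 0) (Fin.last m).succAbove i j =
        if j ≤ i then -(2 * (m : ℤ) + 3) else 0 := by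
      intro i j
      simp [B, Fin.castSucc_lt_succ_iff]
    have ht : (B.submatrix (Fin.succAbove 0) (Fin.last m).succAbove).IsLowerTriangular :=
      fun i j (hij : i < j) => by rw [hs, if_neg (not_le_of_gt hij)]
    rw [hB, Matrix.det_of_isLowerTriangular _ ht,
      Finset.prod_congr rfl (g := fun _ => -(2 * (m : ℤ) + 3))
      (fun i _ => by rw [hs, if_pos le_rfl]), Finset.prod_const, Finset.card_univ, Fintype.card_fin,
      Fin.val_zero, zero_add, Fin.val_last, mul_one, ← mul_pow, neg_one_mul, neg_neg]
  · intro i _ hi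
    have hB : B i (Fin.last m) = 0 := by simp [B, hi, Fin.le_last]
    rw [hB, mul_zero, zero_mul]
  · exact fun h => absurd (Finset.mem_univ _) h

theorem det_yMatrix (n : ℕ) (hn : 1 ≤ n) :
    (yMatrix n).det = (-1) ^ n * (2 * (n : ℤ) + 1) ^ (n - 1) := by
  obtain ⟨m, rfl⟩ : ∃ m, n = m + 1 := ⟨n - 1, by omega⟩
  -- Reversing both orders replaces `min` by `m - max`, the form suited to the row operations.
  let M := (revMatrix m).submatrix Fin.revPerm Fin.revPerm
  have h : yMatrix (m + 1) = Matrix.of fun j k => (-1 : ℤ) ^ (j.val + 1) *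
      (Matrix.of fun j k => (-1 : ℤ) ^ k.val * M j k : Matrix (Fin (m + 1)) (Fin (m + 1)) ℤ) j k := by
    ext j k
    have hj := j.2
    have hk := k.2
    rw [yMatrix_apply]
    simp only [M, revMatrix, Matrix.of_apply, Matrix.submatrix_apply, Fin.revPerm_apply, Fin.val_rev]
    rw [show max (m + 1 - (j.val + 1)) (m + 1 - (k.val + 1)) = m - min j.val k.val by omega,
      show min (m + 1 - (j.val + 1)) (m + 1 - (k.val + 1)) = m - max j.val k.val by omega,
      Nat.cast_sub (by omega), Nat.cast_sub (by omega)]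
    push_cast
    ring
  -- For each index the row sign `(-1) ^ (j + 1)` and the column sign `(-1) ^ j` multiply to `-1`.
  rw [h, Matrix.det_mul_column, Matrix.det_mul_row, ← mul_assoc, ← Finset.prod_mul_distrib,
    Finset.prod_congr rfl (g := fun _ => (-1 : ℤ)) (fun i _ => by
      rw [← pow_add]
      exact Odd.neg_one_pow ⟨i.val, by ring⟩), Finset.prod_const, Finset.card_univ,
    Fintype.card_fin, Matrix.det_submatrix_equiv_self, det_revMatrix, Nat.add_sub_cancel]
  push_cast
  ring

variable {K : Type u} [Field K]

theorem rank_yMatrix_of_not_dvd (n : ℕ) (hn : 1 ≤ n) (h : ¬ ringChar K ∣ 2 * n + 1) :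
    ((yMatrix n).map (Int.cast : ℤ → K)).rank = n := by
  rw [Matrix.rank_of_isUnit, Fintype.card_fin]
  rw [Matrix.isUnit_iff_isUnit_det, isUnit_iff_ne_zero]
  have h1 : ((yMatrix n).map (Int.cast : ℤ → K)).det = ((yMatrix n).det : ℤ) :=
    ((Int.castRingHom K).map_det _).symm
  rw [h1, det_yMatrix n hn]
  push_cast
  refine mul_ne_zero (pow_ne_zero _ (neg_ne_zero.2 one_ne_zero)) (pow_ne_zero _ fun h0 => h ?_)
  rw [← ringChar.spec]
  exact_mod_cast h0

/-- From `2n + 1 = 0` one gets `n - max = -(2 max + 1) / 2`, so the entry at `(j, k)` is `(-1) ^ (j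
+ k) (2 j + 1) (2 k + 1) / 2` and the matrix is an outer product. It is nonzero because its upper
right corner is `(-1) ^ n`. -/
theorem rank_yMatrix_of_dvd (n : ℕ) (hn : 1 ≤ n) (h2 : (2 : K) ≠ 0) (h : ringChar K ∣ 2 * n + 1) :
    ((yMatrix n).map (Int.cast : ℤ → K)).rank = 1 := by
  have h0 : (2 : K) * n + 1 = 0 := by exact_mod_cast (ringChar.spec K (2 * n + 1)).2 h
  have hv : (yMatrix n).map (Int.cast : ℤ → K) =
      Matrix.vecMulVec (fun j => (-1 : K) ^ j.val * (2 * (j.val : K) + 1) * 2⁻¹)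
        (fun k => (-1 : K) ^ k.val * (2 * (k.val : K) + 1)) := by
    ext j k
    rw [Matrix.map_apply, yMatrix_apply, Matrix.vecMulVec_apply]
    rcases le_total j.val k.val with hjk | hjk
    · rw [min_eq_left hjk, max_eq_right hjk]
      push_cast
      field_simp
      linear_combination (-1) ^ (j.val + k.val + 1) * (2 * (j.val : K) + 1) * h0
    · rw [min_eq_right hjk, max_eq_left hjk]
      push_cast
      field_simp
      linear_combination (-1) ^ (j.val + k.val + 1) * (2 * (k.val : K) + 1) * h0
  refine le_antisymm ?_ ?_
  · rw [hv]
    exact Matrix.rank_vecMulVec_le _ _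
  · rw [Nat.one_le_iff_ne_zero]
    intro hr
    have h1 := LinearMap.range_eq_bot.1 (Submodule.finrank_eq_zero.1 hr)
    have h3 := congrFun (LinearMap.congr_fun h1 (Pi.single ⟨n - 1, by omega⟩ 1)) ⟨0, by omega⟩
    rw [Matrix.mulVecLin_apply, Matrix.mulVec_single_one] at h3
    have h4 : yMatrix n ⟨0, by omega⟩ ⟨n - 1, by omega⟩ = (-1) ^ n := by
      rw [yMatrix_apply]
      simp only [zero_add, Nat.sub_add_cancel hn, Nat.zero_min, Nat.zero_max, Nat.cast_sub hn]
      push_cast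
      ring
    change ((yMatrix n ⟨0, by omega⟩ ⟨n - 1, by omega⟩ : ℤ) : K) = 0 at h3
    rw [h4] at h3
    push_cast at h3
    exact pow_ne_zero _ (neg_ne_zero.2 one_ne_zero) h3

/-! ### The alternating sums of lengths as matrix entries. -/

theorem sum_deg_pair {n : ℕ} {i j : Fin n} (m : {m : Fin n // max i j ≤ m}) :
    (-1 : ℤ) ^ deg (i := i) (j := j) (m, true) * deg (i := i) (j := j) (m, true) +
      (-1 : ℤ) ^ deg (i := i) (j := j) (m, false) * deg (i := i) (j := j) (m, false) =
    (-1) ^ (i.val + j.val) * (4 * m.1.val - 2 * i.val - 2 * j.val - 2 * n + 1) := by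
  have h2 := m.1.2
  have h3 : i.val ≤ m.1.val := (le_max_left i j).trans m.2
  have h4 : j.val ≤ m.1.val := (le_max_right i j).trans m.2
  simp only [deg, if_true, Bool.false_eq_true, if_false]
  rw [show (-1 : ℤ) ^ (2 * m.1.val - i.val - j.val) = (-1) ^ (i.val + j.val) from
    neg_one_pow_congr (by simp only [Nat.even_iff]; omega),
    show (-1 : ℤ) ^ (i.val + j.val + (2 * (n - 1 - m.1.val) + 1)) = (-1) ^ (i.val + j.val + 1) from
    neg_one_pow_congr (by simp only [Nat.even_iff]; omega)]
  zify [show i.val ≤ 2 * m.1.val by omega, show j.val ≤ 2 * m.1.val - i.val by omega,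
    show 1 ≤ n by omega, show m.1.val ≤ n - 1 by omega]
  ring

theorem sum_Ico_linear (M N : ℕ) (h : M ≤ N) (a : ℤ) :
    ∑ m ∈ Finset.Ico M N, (4 * (m : ℤ) + a) = (N - M) * (2 * (M + N - 1) + a) := by
  induction N, h using Nat.le_induction with
  | base => simp
  | succ N h ih =>
    rw [Finset.sum_Ico_succ_top h, ih]
    push_cast
    ring

/-- The pairs of paths with equal `m` contribute an arithmetic progression for `M ≤ m < n`, where `M
= max i j`. Up to the sign `(-1) ^ (i + j)` its sum is `(n - M) (2 M - 2 i - 2 j - 1)`, that is `-(n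
- M) (2 min i j + 1)`. -/
theorem sum_deg {n : ℕ} (i j : Fin n) :
    ∑ b : BasisIdx n i j, (-1 : ℤ) ^ deg b * deg b = yMatrix n i j := by
  have hm : max i.val j.val = (max i j).val := (Fin.coe_max i j).symm
  have h1 : ∑ m ∈ Finset.Ico (max i.val j.val) n, (4 * (m : ℤ) + (- 2 * i.val - 2 * j.val - 2 * n + 1)) =
      ∑ m : {m : Fin n // max i j ≤ m}, (4 * (m.1.val : ℤ) + (- 2 * i.val - 2 * j.val - 2 * n + 1)) := by
    symm
    refine Finset.sum_bij (fun m _ => m.1.val) (fun m _ => ?_) (fun m _ m' _ h => ?_) (fun m h => ?_)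
      fun _ _ => rfl
    · rw [Finset.mem_Ico, hm]
      exact ⟨m.2, m.1.2⟩
    · exact Subtype.ext (Fin.ext h)
    · rw [Finset.mem_Ico, hm] at h
      exact ⟨⟨⟨m, h.2⟩, h.1⟩, Finset.mem_univ _, rfl⟩
  rw [Fintype.sum_prod_type, Finset.sum_congr rfl fun m _ => by
    rw [Fintype.sum_bool, sum_deg_pair m], ← Finset.mul_sum, yMatrix_apply]
  rw [sum_Ico_linear _ _ (by omega)] at h1
  rw [Finset.sum_congr rfl (g := fun m => (4 * (m.1.val : ℤ) + (- 2 * i.val - 2 * j.val - 2 * n + 1)))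
    (fun m _ => by ring), ← h1, show (max i.val j.val : ℕ) = i.val + j.val - min i.val j.val by omega,
    Nat.cast_sub (by omega)]
  push_cast
  ring

end Matrix

end PrepL

end

theorem lemma5p1 {K : Type u} [Field K] [IsAlgClosed K] (hK : ringChar K ≠ 2)
    (n : ℕ) (hn : 1 ≤ n) :
    (∃ R : ProjectiveResolution (PrepL.bimod n K), Nonempty (PrepL.Presentation R)) ∧
    ∀ (R : ProjectiveResolution (PrepL.bimod n K)) (p : PrepL.Presentation R),
      ∃ (hy : PrepL.resD n K 1 ≫ PrepL.yRep n K = 0)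
        (hz : ∀ k : Fin n, PrepL.resD n K 2 ≫ PrepL.zRep K k = 0)
        (ht : ∀ k : Fin n, PrepL.resD n K 3 ≫ PrepL.tRep K k = 0)
        (bz : Module.Basis (Fin n) K (PrepL.HH n K 2))
        (bt : Module.Basis (Fin n) K (PrepL.HH n K 3)),
        (∀ k, bz k = p.cls (PrepL.zRep K k) (hz k)) ∧
        (∀ k, bt k = p.cls (PrepL.tRep K k) (ht k)) ∧
        ∃ C : Matrix (Fin n) (Fin n) ℤ,
          LinearMap.toMatrix bz bt (PrepL.mulBy (p.cls (PrepL.yRep n K) hy)) =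
            C.map (Int.cast : ℤ → K) ∧
          C.IsSymm ∧
          (∀ j k : Fin n, j ≤ k →
            C j k = (-1) ^ (k.val - j.val + 1) * (2 * ((j.val : ℤ) + 1) - 1) *
              ((n : ℤ) - ((k.val : ℤ) + 1) + 1)) ∧
          C.det = (-1) ^ n * (2 * (n : ℤ) + 1) ^ (n - 1) ∧
          (¬ ringChar K ∣ 2 * n + 1 → (C.map (Int.cast : ℤ → K)).rank = n) ∧
          (ringChar K ∣ 2 * n + 1 → (C.map (Int.cast : ℤ → K)).rank = 1) := by
  have h2 : (2 : K) ≠ 0 := Ring.two_ne_zero hK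
  refine ⟨PrepL.exists_presentation n K, fun R p => ⟨PrepL.resD_one_comp_yRep,
    fun _ => PrepL.resD_two_comp _, PrepL.resD_three_comp_tRep, PrepL.zBasis p h2,
    PrepL.tBasis p h2, PrepL.zBasis_apply p h2, PrepL.tBasis_apply p h2, PrepL.yMatrix n, ?_,
    PrepL.yMatrix_isSymm n, fun _ _ => PrepL.yMatrix_apply_of_le, PrepL.det_yMatrix n hn,
    PrepL.rank_yMatrix_of_not_dvd n hn, PrepL.rank_yMatrix_of_dvd n hn h2⟩⟩
  ext j k
  rw [LinearMap.toMatrix_apply, PrepL.zBasis_apply, PrepL.mulBy_cls_zRep p k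
    (fun i => (PrepL.yMatrix n i k : K)) fun i => by
      rw [← PrepL.sum_deg]
      push_cast
      rfl]
  simp only [← PrepL.tBasis_apply p h2]
  rw [Module.Basis.repr_sum_self, Matrix.map_apply]
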